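/- Consider the thin-film free boundary problem with partial wetting, for an unknown height $u(t,x)$ and contact points $\lambda_-(t)<\lambda_+(t)$, $t\ge 0$: $$u_t+(u\,u_{xxx})_x=0\quad\text{for } t>0,\ x\in(\lambda_-(t),\lambda_+(t)),$$ $$u(t,\lambda_\pm(t))=0,\qquad |u_x(t,\lambda_\pm(t))|=1,\qquad \lim_{x\to\lambda_\pm(t)}u_{xxx}(t,x)=\dot\lambda_\pm(t)\quad\text{for } t>0,$$ with $u>0$ on $(\lambda_-(t),\lambda_+(t))$ for $t\ge0$ and $u(0,\cdot)=u_0$, where $u_0$ also satisfies $u_0(\lambda_\pm(0))=0$ and $|u_{0,x}(\lambda_\pm(0))|=1$. Call $u$ a *global smooth solution* if in addition $\lambda_\pm$ are continuous on $[0,\infty)$ and $C^\infty$ on $(0,\infty)$, $u$ is $C^\infty$ on $\{(t,x): t>0,\ \lambda_-(t)\le x\le\lambda_+(t)\}$ (up to the free boundary), and $u,u_x,u_{xx}$ are continuous on $\{(t,x): t\ge0,\ \lambda_-(t)\le x\le\lambda_+(t)\}$. Let $u^\infty(x)=\frac12(1-x^2)_+$. For a global smooth solution with $$\int_{\lambda_-(0)}^{\lambda_+(0)}u_0\,dx=\tfrac23,\qquad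 \int_{\lambda_-(0)}^{\lambda_+(0)}x\,u_0\,dx=0,$$ define, for $t\ge0$ and $y\in[-1,1]$, the mass Lagrangian coordinate $Z(t,y)\in[\lambda_-(t),\lambda_+(t)]$ by $$\int_{\lambda_-(t)}^{Z(t,y)}u(t,x)\,dx=\frac12\int_{-1}^{y}(1-x^2)\,dx ,$$ put $\tilde u(t,y)=u(t,Z(t,y))$, and let $$E(t)=\frac12\int_{-1}^{1}\left|\partial_y\!\left(\frac{\tilde u(t,y)}{u^\infty(y)}\right)\right|^2dy .$$ **Theorem.** There exist constants $c_0>0$ and $\gamma>0$ such that every global smooth solution $u$ as above with mass $2/3$, center of mass $0$ and $E(0)<c_0$ satisfies $$E(t)\le E(0)\,e^{-\gamma t}\qquad\text{for all } t\ge0 .$$ -/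

import Mathlib

open Set Filter Topology
open scoped ContDiff

namespace ThinFilm

/-- The closed space-time region `{(t, x) : t ∈ T, lm t ≤ x ≤ lp t}` between the two contact
points, over a set `T` of times. -/
def wetRegion (T : Set ℝ) (lm lp : ℝ → ℝ) : Set (ℝ × ℝ) :=
  {p | p.1 ∈ T ∧ p.2 ∈ Icc (lm p.1) (lp p.1)}

/-- `u`, with left and right contact points `lm` and `lp`, is a global smooth solution of the
thin-film equation `u_t + (u u_xxx)_x = 0` with partial wetting (contact slope of modulus one),
with initial value `u 0` on `[lm 0, lp 0]`.  Only the values `u t x` with `0 ≤ t` and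
`lm t ≤ x ≤ lp t` matter.  For `t > 0` the solution is smooth up to the free boundary; at `t = 0`
it is only required that `u`, `u_x`, `u_xx` are continuous down to the initial time. -/
structure IsGlobalSmoothSolution (u : ℝ → ℝ → ℝ) (lm lp : ℝ → ℝ) : Prop where
  /-- The wetted interval is nondegenerate. -/
  lt : ∀ t, 0 ≤ t → lm t < lp t
  /-- The film has positive height strictly between the contact points. -/
  pos : ∀ t, 0 ≤ t → ∀ x ∈ Ioo (lm t) (lp t), 0 < u t x
  /-- The contact points are smooth functions of `t > 0` ... -/
  smooth_left : ContDiffOn ℝ ∞ lm (Ioi 0)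
  smooth_right : ContDiffOn ℝ ∞ lp (Ioi 0)
  /-- ... which start from their initial positions. -/
  continuous_left : ContinuousOn lm (Ici 0)
  continuous_right : ContinuousOn lp (Ici 0)
  /-- For positive times `u` is smooth up to the free boundary. -/
  smooth : ContDiffOn ℝ ∞ (Function.uncurry u) (wetRegion (Ioi 0) lm lp)
  /-- The initial datum is `C²` up to the contact points ... -/
  contDiffOn_zero : ContDiffOn ℝ 2 (u 0) (Icc (lm 0) (lp 0))
  /-- ... and is attained together with its first two space derivatives. -/
  attained : ∀ k : ℕ, k ≤ 2 → ContinuousOn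
    (fun p : ℝ × ℝ => iteratedDerivWithin k (u p.1) (Icc (lm p.1) (lp p.1)) p.2)
    (wetRegion (Ici 0) lm lp)
  /-- The equation `u_t + (u u_xxx)_x = 0` between the contact points. -/
  equation : ∀ t, 0 < t → ∀ x ∈ Ioo (lm t) (lp t),
    deriv (fun s => u s x) t + deriv (fun z => u t z * iteratedDeriv 3 (u t) z) x = 0
  /-- The height vanishes at the contact points. -/
  height_left : ∀ t, 0 ≤ t → u t (lm t) = 0
  height_right : ∀ t, 0 ≤ t → u t (lp t) = 0
  /-- The slope (one-sided derivative) at the contact points has modulus one. -/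
  slope_left : ∀ t, 0 ≤ t → |derivWithin (u t) (Icc (lm t) (lp t)) (lm t)| = 1
  slope_right : ∀ t, 0 ≤ t → |derivWithin (u t) (Icc (lm t) (lp t)) (lp t)| = 1
  /-- Each contact point moves with velocity `lim u_xxx`. -/
  velocity_left : ∀ t, 0 < t →
    Tendsto (iteratedDeriv 3 (u t)) (𝓝[>] (lm t)) (𝓝 (deriv lm t))
  velocity_right : ∀ t, 0 < t →
    Tendsto (iteratedDeriv 3 (u t)) (𝓝[<] (lp t)) (𝓝 (deriv lp t))

/-- The mass `∫ u dx` at time `t`. -/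
noncomputable def mass (u : ℝ → ℝ → ℝ) (lm lp : ℝ → ℝ) (t : ℝ) : ℝ :=
  ∫ x in (lm t)..(lp t), u t x

/-- The center of mass `∫ x u dx` (not normalized by the mass) at time `t`. -/
noncomputable def centerOfMass (u : ℝ → ℝ → ℝ) (lm lp : ℝ → ℝ) (t : ℝ) : ℝ :=
  ∫ x in (lm t)..(lp t), x * u t x

/-- The steady state `(1 - x²)₊ / 2`. -/
noncomputable def steady (x : ℝ) : ℝ := (1 / 2) * max (1 - x ^ 2) 0

/-- The mass Lagrangian coordinate: `lagrangian u lm lp t y` is the (unique, see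
`existsUnique_lagrangian`) point `x` of `[lm t, lp t]` such that
`∫_{lm t}^x u(t, s) ds = (1/2) ∫_{-1}^y (1 - s²) ds`. -/
noncomputable def lagrangian (u : ℝ → ℝ → ℝ) (lm lp : ℝ → ℝ) (t y : ℝ) : ℝ :=
  Classical.epsilon fun x : ℝ => x ∈ Icc (lm t) (lp t) ∧
    ∫ s in (lm t)..x, u t s = (1 / 2) * ∫ s in (-1 : ℝ)..y, (1 - s ^ 2)

/-- The energy `E(t) = (1/2) ∫_{-1}^1 |∂_y (ũ(t, y) / u^∞(y))|² dy`, where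
`ũ(t, y) = u(t, Z(t, y))` and `Z` is the mass Lagrangian coordinate. -/
noncomputable def energy (u : ℝ → ℝ → ℝ) (lm lp : ℝ → ℝ) (t : ℝ) : ℝ :=
  (1 / 2) * ∫ y in (-1 : ℝ)..1,
    |deriv (fun z => u t (lagrangian u lm lp t z) / steady z) y| ^ 2

/-- For a film of mass `2/3` which is positive between its contact points, the condition that
defines the mass Lagrangian coordinate has exactly one solution. -/
theorem existsUnique_lagrangian (u : ℝ → ℝ → ℝ) (lm lp : ℝ → ℝ) (t y : ℝ) (hlt : lm t < lp t)
    (hc : ContinuousOn (u t) (Icc (lm t) (lp t))) (hpos : ∀ x ∈ Ioo (lm t) (lp t), 0 < u t x)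
    (hm : mass u lm lp t = 2 / 3) (hy : y ∈ Icc (-1 : ℝ) 1) :
    ∃! x : ℝ, x ∈ Icc (lm t) (lp t) ∧
      ∫ s in (lm t)..x, u t s = (1 / 2) * ∫ s in (-1 : ℝ)..y, (1 - s ^ 2) := by
  have hint : ∀ p ∈ Icc (lm t) (lp t), ∀ q ∈ Icc (lm t) (lp t),
      IntervalIntegrable (u t) MeasureTheory.volume p q := fun p hp q hq =>
    (hc.mono (uIcc_subset_Icc hp hq)).intervalIntegrable
  have hl : lm t ∈ Icc (lm t) (lp t) := ⟨le_rfl, hlt.le⟩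
  have hr : lp t ∈ Icc (lm t) (lp t) := ⟨hlt.le, le_rfl⟩
  have hF : ContinuousOn (fun x => ∫ s in (lm t)..x, u t s) (Icc (lm t) (lp t)) := by
    have := intervalIntegral.continuousOn_primitive_interval
      (μ := MeasureTheory.volume) (f := u t) (a := lm t) (b := lp t)
      (by rw [uIcc_of_le hlt.le]; exact hc.integrableOn_Icc)
    rwa [uIcc_of_le hlt.le] at this
  have hmono : StrictMonoOn (fun x => ∫ s in (lm t)..x, u t s) (Icc (lm t) (lp t)) := by
    intro p hp q hq hpq
    have h1 := intervalIntegral.integral_add_adjacent_intervals (hint _ hl _ hp) (hint _ hp _ hq)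
    have h2 : 0 < ∫ s in p..q, u t s :=
      intervalIntegral.intervalIntegral_pos_of_pos_on (hint _ hp _ hq)
        (fun x hx => hpos x ⟨hp.1.trans_lt hx.1, hx.2.trans_le hq.2⟩) hpq
    simp only
    linarith
  have hval : (1 / 2) * ∫ s in (-1 : ℝ)..y, (1 - s ^ 2) = (1 / 2) * (y - y ^ 3 / 3 + 2 / 3) := by
    rw [intervalIntegral.integral_sub (by simp)
      ((continuous_pow 2).intervalIntegrable _ _)]
    simp only [intervalIntegral.integral_const, integral_pow, smul_eq_mul]
    ring
  have hmem : (1 / 2) * ∫ s in (-1 : ℝ)..y, (1 - s ^ 2) ∈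
      Icc (∫ s in (lm t)..(lm t), u t s) (∫ s in (lm t)..(lp t), u t s) := by
    have hm' : ∫ s in (lm t)..(lp t), u t s = 2 / 3 := hm
    rw [hval, hm', intervalIntegral.integral_same]
    obtain ⟨h1, h2⟩ := hy
    constructor
    · nlinarith [mul_nonneg (sq_nonneg (y + 1)) (by linarith : (0 : ℝ) ≤ 2 - y)]
    · nlinarith [mul_nonneg (sq_nonneg (y - 1)) (by linarith : (0 : ℝ) ≤ y + 2)]
  obtain ⟨x, hx, hxe⟩ := intermediate_value_Icc hlt.le hF hmem
  exact ⟨x, ⟨hx, hxe⟩, fun z hz => hmono.injOn hz.1 hx (hz.2.trans hxe.symm)⟩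

end ThinFilm

/-! Write `w = (1 - y²)/2` and `a = ũ / w`, with `b = a'`, `c = b'`, `d = c'`. In the mass
coordinate `∂_x = a ∂_y`, and mass particles move with velocity `u_xxx`. Hence `a_t = -a u_xxxx`, so
`E = ½ ∫ b²` satisfies `E' = -∫ b (a u_xxxx)_y`. The slope at a contact point is constant in time;
differentiating it along the contact line and using the equation together with `λ' = u_xxx` gives
`u_xxxx = 0` there (`dx_four_left`, `dx_four_right`). Therefore `E' = ∫ c a u_xxxx`, without
boundary terms.

Expressing `u_xxxx` through `a` and integrating by parts again (`integral_mul_deriv_le`) produces a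
dissipation with quadratic part `∫ (a⁵ w d² + 8 a⁵ c²)` and boundary terms of favourable sign. All
other terms carry additional powers of `b`; completing squares reduces them to `∫ b² c²`, `∫ b⁴` and
`∫ b⁶`. The slope condition forces `a = 1` at both ends, so `b` has a zero by Rolle. This yields the
Poincaré inequality `∫ b² ≤ 16 ∫ c²` and the bound `b⁴ ≤ 4 ∫ b² ∫ c²`. Together with the weighted
interpolation `integral_sq_cube_le` it gives `∫ b² c² ≤ C ∫ b² (∫ c² + ∫ w d²)`, which the
dissipation absorbs when the energy is small (`integral_dissip_ge`). Thus `E' ≤ -γ E` as long as `E`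
is below a threshold, and a first-exit-time argument (`le_mul_exp_of_rate_le`) keeps it there.

The remaining work justifies the computation. The quotient by the degenerate weight `w` has bounded
derivatives up to the boundary by Hardy-type estimates (`hardy_bound`, `isProfile_of_bounded`). The
bounds on `a` and `b` need only two space derivatives of `u`, hence hold uniformly down to `t = 0`
(`exists_uniform_bounds`) and make the energy continuous there. The motion law of the particles is
obtained by implicit differentiation of the mass (`hasDerivAt_lagrangian`). -/

namespace ThinFilm

open MeasureTheory

/-! ### Bounded continuous functions on `(-1, 1)` -/

/-- Continuous and bounded on the open interval `(-1, 1)`. -/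
@[fun_prop]
def BddCont (f : ℝ → ℝ) : Prop :=
  ContinuousOn f (Ioo (-1) 1) ∧ ∃ C, ∀ y ∈ Ioo (-1 : ℝ) 1, |f y| ≤ C

@[fun_prop]
theorem BddCont.const (k : ℝ) : BddCont fun _ => k :=
  ⟨continuousOn_const, |k|, fun _ _ => le_rfl⟩

@[fun_prop]
theorem BddCont.id : BddCont fun y => y :=
  ⟨continuousOn_id, 1, fun _ hy => abs_le.2 ⟨hy.1.le, hy.2.le⟩⟩

@[fun_prop]
theorem BddCont.add {f g : ℝ → ℝ} (hf : BddCont f) (hg : BddCont g) :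
    BddCont fun y => f y + g y := by
  obtain ⟨hf, C, hC⟩ := hf
  obtain ⟨hg, D, hD⟩ := hg
  exact ⟨hf.add hg, C + D, fun y hy => (abs_add_le _ _).trans (add_le_add (hC y hy) (hD y hy))⟩

@[fun_prop]
theorem BddCont.neg {f : ℝ → ℝ} (hf : BddCont f) : BddCont fun y => -f y := by
  obtain ⟨hf, C, hC⟩ := hf
  exact ⟨hf.neg, C, fun y hy => by rw [abs_neg]; exact hC y hy⟩

@[fun_prop]
theorem BddCont.sub {f g : ℝ → ℝ} (hf : BddCont f) (hg : BddCont g) :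
    BddCont fun y => f y - g y := by
  simpa only [sub_eq_add_neg] using hf.add hg.neg

@[fun_prop]
theorem BddCont.mul {f g : ℝ → ℝ} (hf : BddCont f) (hg : BddCont g) :
    BddCont fun y => f y * g y := by
  obtain ⟨hf, C, hC⟩ := hf
  obtain ⟨hg, D, hD⟩ := hg
  refine ⟨hf.mul hg, C * D, fun y hy => ?_⟩
  rw [abs_mul]
  exact mul_le_mul (hC y hy) (hD y hy) (abs_nonneg _) ((abs_nonneg _).trans (hC y hy))

@[fun_prop]
theorem BddCont.pow {f : ℝ → ℝ} (hf : BddCont f) (n : ℕ) : BddCont fun y => f y ^ n := by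
  obtain ⟨hf, C, hC⟩ := hf
  refine ⟨hf.pow n, C ^ n, fun y hy => ?_⟩
  rw [abs_pow]
  exact pow_le_pow_left₀ (abs_nonneg _) (hC y hy) n

@[fun_prop]
theorem BddCont.div_const {f : ℝ → ℝ} (hf : BddCont f) (k : ℝ) : BddCont fun y => f y / k := by
  simpa only [div_eq_mul_inv] using hf.mul (BddCont.const k⁻¹)

theorem BddCont.intervalIntegrable {f : ℝ → ℝ} (hf : BddCont f) :
    IntervalIntegrable f volume (-1) 1 := by
  obtain ⟨hf, C, hC⟩ := hf
  rw [intervalIntegrable_iff_integrableOn_Ioo_of_le (by norm_num)]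
  exact Integrable.of_bound (hf.aestronglyMeasurable measurableSet_Ioo) C
    ((ae_restrict_iff' measurableSet_Ioo).2 (Eventually.of_forall hC))

/-- The product of a bounded function with one that tends to zero tends to zero. -/
theorem BddCont.tendsto_mul_left {f g : ℝ → ℝ} (hf : BddCont f)
    (hg : Tendsto g (𝓝[>] (-1)) (𝓝 0)) :
    Tendsto (fun y => f y * g y) (𝓝[>] (-1)) (𝓝 0) := by
  obtain ⟨-, C, hC⟩ := hf
  refine squeeze_zero_norm' (a := fun y => C * |g y|) ?_ (by simpa using hg.abs.const_mul C)
  filter_upwards [Ioo_mem_nhdsGT (show (-1 : ℝ) < 1 by norm_num)] with y hy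
  rw [Real.norm_eq_abs, abs_mul]
  exact mul_le_mul_of_nonneg_right (hC y hy) (abs_nonneg _)

theorem BddCont.tendsto_mul_right {f g : ℝ → ℝ} (hf : BddCont f)
    (hg : Tendsto g (𝓝[<] 1) (𝓝 0)) :
    Tendsto (fun y => f y * g y) (𝓝[<] 1) (𝓝 0) := by
  obtain ⟨-, C, hC⟩ := hf
  refine squeeze_zero_norm' (a := fun y => C * |g y|) ?_ (by simpa using hg.abs.const_mul C)
  filter_upwards [Ioo_mem_nhdsLT (show (-1 : ℝ) < 1 by norm_num)] with y hy
  rw [Real.norm_eq_abs, abs_mul]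
  exact mul_le_mul_of_nonneg_right (hC y hy) (abs_nonneg _)

theorem BddCont.integral_le {f g : ℝ → ℝ} (hf : BddCont f) (hg : BddCont g)
    (h : ∀ y ∈ Ioo (-1 : ℝ) 1, f y ≤ g y) :
    ∫ y in (-1 : ℝ)..1, f y ≤ ∫ y in (-1 : ℝ)..1, g y :=
  intervalIntegral.integral_mono_on_of_le_Ioo (by norm_num) hf.intervalIntegrable
    hg.intervalIntegrable h

theorem integral_deriv_eq_sub {P P' : ℝ → ℝ} {l r : ℝ}
    (hd : ∀ y ∈ Ioo (-1 : ℝ) 1, HasDerivAt P (P' y) y) (hP' : BddCont P')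
    (hl : Tendsto P (𝓝[>] (-1)) (𝓝 l)) (hr : Tendsto P (𝓝[<] 1) (𝓝 r)) :
    ∫ y in (-1 : ℝ)..1, P' y = r - l :=
  intervalIntegral.integral_eq_sub_of_hasDerivAt_of_tendsto (by norm_num) hd
    hP'.intervalIntegrable hl hr

theorem abs_sub_le_integral {f f' g : ℝ → ℝ}
    (hd : ∀ y ∈ Ioo (-1 : ℝ) 1, HasDerivAt f (f' y) y) (hf' : BddCont f') (hg : BddCont g)
    (h : ∀ y ∈ Ioo (-1 : ℝ) 1, |f' y| ≤ g y) {x y : ℝ} (hx : x ∈ Ioo (-1 : ℝ) 1)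
    (hy : y ∈ Ioo (-1 : ℝ) 1) : |f y - f x| ≤ ∫ s in (-1 : ℝ)..1, g s := by
  wlog hxy : x ≤ y generalizing x y
  · rw [abs_sub_comm]; exact this hy hx (le_of_not_ge hxy)
  have hsub : Icc x y ⊆ Ioo (-1) 1 := Icc_subset_Ioo hx.1 hy.2
  have hu : uIcc x y ⊆ uIcc (-1) 1 := by
    rw [uIcc_of_le hxy, uIcc_of_le (by norm_num)]
    exact hsub.trans Ioo_subset_Icc_self
  have hgi := hg.intervalIntegrable.mono_set hu
  rw [← intervalIntegral.integral_eq_sub_of_hasDerivAt (f := f) (f' := f')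
    (fun z hz => hd z (hsub (by rwa [uIcc_of_le hxy] at hz)))
    (hf'.intervalIntegrable.mono_set hu)]
  rw [← Real.norm_eq_abs]
  refine (intervalIntegral.norm_integral_le_of_norm_le hxy (Eventually.of_forall fun z hz =>
    (Real.norm_eq_abs _).trans_le (h z (hsub (Ioc_subset_Icc_self hz)))) hgi).trans ?_
  refine intervalIntegral.integral_mono_interval hx.1.le hxy hy.2.le ?_ hg.intervalIntegrable
  rw [← restrict_Ioo_eq_restrict_Ioc]
  exact (ae_restrict_iff' measurableSet_Ioo).2
    (Eventually.of_forall fun z hz => (abs_nonneg _).trans (h z hz))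

/-- Supplies the boundary values of the second derivative `c`, which occur in the integration by
parts of the dissipation. -/
theorem exists_tendsto_of_deriv_bddCont {f f' : ℝ → ℝ}
    (hd : ∀ y ∈ Ioo (-1 : ℝ) 1, HasDerivAt f (f' y) y) (hf' : BddCont f') :
    (∃ l, Tendsto f (𝓝[>] (-1)) (𝓝 l)) ∧ ∃ r, Tendsto f (𝓝[<] 1) (𝓝 r) := by
  have h01 : (-1 : ℝ) < 1 := by norm_num
  have hi : IntegrableOn f' (Icc (-1) 1) := by
    rw [integrableOn_Icc_iff_integrableOn_Ioo,
      ← intervalIntegrable_iff_integrableOn_Ioo_of_le h01.le]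
    exact hf'.intervalIntegrable
  have h0 : (0 : ℝ) ∈ Ioo (-1 : ℝ) 1 := by constructor <;> norm_num
  have hF : ContinuousOn (fun y => f 0 + ∫ s in (0 : ℝ)..y, f' s) (Icc (-1) 1) := by
    have := intervalIntegral.continuousOn_primitive_interval' (a := 0)
      hf'.intervalIntegrable (by rw [uIcc_of_le h01.le]; exact Ioo_subset_Icc_self h0)
    rw [uIcc_of_le h01.le] at this
    exact continuousOn_const.add this
  have heq : ∀ y ∈ Ioo (-1 : ℝ) 1, f 0 + ∫ s in (0 : ℝ)..y, f' s = f y := by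
    intro y hy
    have hsub : uIcc 0 y ⊆ Ioo (-1) 1 := (ordConnected_Ioo).uIcc_subset h0 hy
    rw [intervalIntegral.integral_eq_sub_of_hasDerivAt (f := f) (f' := f')
      (fun z hz => hd z (hsub hz)) (hf'.intervalIntegrable.mono_set ?_)]
    · ring
    · rw [uIcc_of_le h01.le]; exact hsub.trans Ioo_subset_Icc_self
  constructor
  · refine ⟨_, ((hF (-1) (left_mem_Icc.2 h01.le)).tendsto.mono_left
      ?_).congr' ?_⟩
    · exact nhdsWithin_le_iff.2 (mem_of_superset (Ioo_mem_nhdsGT h01) Ioo_subset_Icc_self)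
    · filter_upwards [Ioo_mem_nhdsGT h01] with y hy using heq y hy
  · refine ⟨_, ((hF 1 (right_mem_Icc.2 h01.le)).tendsto.mono_left
      ?_).congr' ?_⟩
    · exact nhdsWithin_le_iff.2 (mem_of_superset (Ioo_mem_nhdsLT h01) Ioo_subset_Icc_self)
    · filter_upwards [Ioo_mem_nhdsLT h01] with y hy using heq y hy

/-! ### The equilibrium parabola and profiles relative to it -/

/-- The equilibrium profile `(1 - y²) / 2` as a polynomial. -/
noncomputable def parab (y : ℝ) : ℝ := (1 - y ^ 2) / 2

theorem parab_pos {y : ℝ} (hy : y ∈ Ioo (-1 : ℝ) 1) : 0 < parab y := by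
  unfold parab; nlinarith [hy.1, hy.2]

theorem parab_le (y : ℝ) : parab y ≤ 1 / 2 := by
  unfold parab; nlinarith [sq_nonneg y]

theorem hasDerivAt_parab (y : ℝ) : HasDerivAt parab (-y) y := by
  have := (((hasDerivAt_id y).pow 2).const_sub 1).div_const 2
  refine this.congr_deriv ?_
  simp only [id]
  push_cast
  ring

theorem continuous_parab : Continuous parab := by unfold parab; fun_prop

@[fun_prop]
theorem bddCont_parab : BddCont parab := by unfold ThinFilm.parab; fun_prop

theorem tendsto_parab_left : Tendsto parab (𝓝[>] (-1)) (𝓝 0) := by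
  have := (continuous_parab.tendsto (-1)).mono_left (nhdsWithin_le_nhds (s := Ioi (-1)))
  simpa [ThinFilm.parab] using this

theorem tendsto_parab_right : Tendsto parab (𝓝[<] 1) (𝓝 0) := by
  have := (continuous_parab.tendsto 1).mono_left (nhdsWithin_le_nhds (s := Iio 1))
  simpa [ThinFilm.parab] using this

/-- A relative height `a` on `(-1, 1)` with boundary values one and three bounded derivatives
`b`, `c`, `d`. -/
structure IsProfile (a b c d : ℝ → ℝ) : Prop where
  deriv₁ : ∀ y ∈ Ioo (-1 : ℝ) 1, HasDerivAt a (b y) y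
  deriv₂ : ∀ y ∈ Ioo (-1 : ℝ) 1, HasDerivAt b (c y) y
  deriv₃ : ∀ y ∈ Ioo (-1 : ℝ) 1, HasDerivAt c (d y) y
  bdd₀ : BddCont a
  bdd₁ : BddCont b
  bdd₂ : BddCont c
  bdd₃ : BddCont d
  left : Tendsto a (𝓝[>] (-1)) (𝓝 1)
  right : Tendsto a (𝓝[<] 1) (𝓝 1)

/-! ### Interpolation, sup bounds and coercivity of the dissipation for a fixed profile -/

namespace IsProfile

variable {a b c d : ℝ → ℝ}

/-- The pointwise estimate behind `integral_sq_le`. -/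
theorem interpolation_pointwise {ℓ y w φ b c d : ℝ} (hℓ : 0 < ℓ) (hℓ1 : ℓ ≤ 1) (hw : 0 < w)
    (hwy : w = (1 - y ^ 2) / 2) (hφ : φ = w / (w + ℓ)) :
    c ^ 2 ≤ ((-(ℓ * φ) + y ^ 2 * (1 - φ) ^ 2) * c ^ 2 + 2 * (-(ℓ * y * φ)) * c * d
      + (ℓ + 4) * (-(y * (1 - φ) ^ 2 / ℓ) * (b * c) + φ * (c * c + b * d)))
      + (c ^ 2 / 2 + 2 * ℓ * (w * d ^ 2) + 27 / ℓ ^ 2 * b ^ 2) := by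
  -- Rescaling `b` by the layer width `ℓ` removes all negative powers of `ℓ`.
  obtain ⟨β, rfl⟩ : ∃ β, b = ℓ * β := ⟨b / ℓ, by field_simp⟩
  have hwl : 0 < w + ℓ := by linarith
  have h1 : φ * (w + ℓ) = w := by rw [hφ]; field_simp
  have hφ0 : 0 < φ := by rw [hφ]; positivity
  have hφ1 : φ < 1 := by rw [hφ, div_lt_one hwl]; linarith
  have hwq : w * (1 - φ) = ℓ * φ := by linarith
  have hy1 : y ^ 2 ≤ 1 := by linarith
  -- After multiplication by `(w + ℓ)²` this is `4 ℓ w ≤ (w + ℓ)²`.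
  have hφw : 4 * ℓ * φ ^ 2 ≤ w := by
    have : 4 * ℓ * φ ^ 2 * (w + ℓ) ^ 2 ≤ w * (w + ℓ) ^ 2 := by
      have : 4 * ℓ * φ ^ 2 * (w + ℓ) ^ 2 = 4 * ℓ * (φ * (w + ℓ)) ^ 2 := by ring
      rw [this, h1]
      nlinarith [mul_nonneg hw.le (sq_nonneg (w - ℓ))]
    exact le_of_mul_le_mul_right this (by positivity)
  have e1 : -(y * (1 - φ) ^ 2 / ℓ) * (ℓ * β * c) = -(y * (1 - φ) ^ 2) * (β * c) := by
    field_simp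
  have e2 : 27 / ℓ ^ 2 * (ℓ * β) ^ 2 = 27 * β ^ 2 := by field_simp
  rw [e1, e2]
  have hq1 : (1 - φ) ^ 2 ≤ 1 := by nlinarith
  -- The two parts of the total derivative together dominate `c²`: the term `y² (1 - φ)²` in the
  -- boundary layer, `(ℓ + 4) φ` away from it. The cross terms are then paid for by two quarters of
  -- `c²`, two copies of `ℓ w d²`, and `(2 + 25) β²`, the origin of the constant 27.
  have k1 : c ^ 2 * (1 - (-(ℓ * φ) + y ^ 2 * (1 - φ) ^ 2) - (ℓ + 4) * φ) ≤ 0 := by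
    refine mul_nonpos_of_nonneg_of_nonpos (sq_nonneg c) ?_
    have : y ^ 2 = 1 - 2 * w := by linarith
    rw [this]
    have : w * (1 - φ) ^ 2 = ℓ * φ * (1 - φ) := by rw [← hwq]; ring
    nlinarith [mul_pos hφ0 (sub_pos.2 hφ1), mul_nonneg hφ0.le (sub_nonneg.2 hℓ1), sq_nonneg φ,
      mul_nonneg (mul_nonneg hφ0.le (sub_nonneg.2 hφ1.le)) (sub_nonneg.2 hℓ1)]
  have k2 : 0 ≤ c ^ 2 / 4 + 2 * (-(ℓ * y * φ)) * c * d + ℓ * (w * d ^ 2) := by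
    have : ℓ * (w * d ^ 2) ≥ 4 * (ℓ * y * φ) ^ 2 * d ^ 2 := by
      have : 4 * (ℓ * y * φ) ^ 2 ≤ ℓ * w := by
        have : (4 * ℓ * φ ^ 2) * y ^ 2 ≤ w * 1 := mul_le_mul hφw hy1 (sq_nonneg _) hw.le
        nlinarith
      nlinarith [mul_le_mul_of_nonneg_right this (sq_nonneg d)]
    nlinarith [sq_nonneg (c / 2 - 2 * (ℓ * y * φ) * d)]
  have k3 : 0 ≤ ℓ * (w * d ^ 2) + (ℓ + 4) * (φ * (ℓ * β * d)) + 2 * β ^ 2 := by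
    have hk : (ℓ + 4) ^ 2 * (ℓ * φ ^ 2) ≤ 8 * w := by
      have : (ℓ + 4) ^ 2 ≤ 25 := by nlinarith
      nlinarith [mul_le_mul_of_nonneg_right this (by positivity : 0 ≤ ℓ * φ ^ 2)]
    have : 0 ≤ (4 * ℓ * w) * (ℓ * (w * d ^ 2) + (ℓ + 4) * (φ * (ℓ * β * d)) + 2 * β ^ 2) := by
      have : (4 * ℓ * w) * (ℓ * (w * d ^ 2) + (ℓ + 4) * (φ * (ℓ * β * d)) + 2 * β ^ 2)
          = (2 * ℓ * w * d + (ℓ + 4) * φ * ℓ * β) ^ 2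
            + ℓ * β ^ 2 * (8 * w - (ℓ + 4) ^ 2 * (ℓ * φ ^ 2)) := by ring
      rw [this]
      have := mul_nonneg (mul_nonneg hℓ.le (sq_nonneg β)) (sub_nonneg.2 hk)
      positivity
    exact nonneg_of_mul_nonneg_right this (by positivity)
  have k4 : 0 ≤ c ^ 2 / 4 + (ℓ + 4) * (-(y * (1 - φ) ^ 2) * (β * c)) + 25 * β ^ 2 := by
    have hs : ((ℓ + 4) * (y * (1 - φ) ^ 2)) ^ 2 ≤ 25 := by
      have h3 : (ℓ + 4) ^ 2 ≤ 25 := by nlinarith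
      have h4 : ((1 - φ) ^ 2) ^ 2 ≤ 1 := by nlinarith [sq_nonneg (1 - φ)]
      have h5 : y ^ 2 * ((1 - φ) ^ 2) ^ 2 ≤ 1 * 1 :=
        mul_le_mul hy1 h4 (sq_nonneg _) zero_le_one
      have := mul_le_mul h3 h5 (by positivity) (by norm_num)
      calc _ = (ℓ + 4) ^ 2 * (y ^ 2 * ((1 - φ) ^ 2) ^ 2) := by ring
        _ ≤ _ := by linarith
    rw [show (ℓ + 4) * (-(y * (1 - φ) ^ 2) * (β * c))
      = -((ℓ + 4) * (y * (1 - φ) ^ 2) * (β * c)) by ring]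
    generalize (ℓ + 4) * (y * (1 - φ) ^ 2) = X at hs ⊢
    have e : c ^ 2 / 4 + -(X * (β * c)) + 25 * β ^ 2
      = (c / 2 - X * β) ^ 2 + (25 - X ^ 2) * β ^ 2 := by ring
    rw [e]
    have := mul_nonneg (sub_nonneg.2 hs) (sq_nonneg β)
    positivity
  linarith

/-- The cutoff `φ = w / (w + ℓ)` vanishes at the ends and is close to one outside a layer of width
about `ℓ`. Integrating the derivative of a combination of `y φ c²` and `φ b c` gives no boundary
term: the first part controls `c²` in the layer, where the weight in front of `d²` degenerates, and
the second is the usual interpolation in the interior. -/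
theorem integral_sq_le (h : IsProfile a b c d) {ℓ : ℝ} (hℓ : 0 < ℓ) (hℓ1 : ℓ ≤ 1) :
    ∫ y in (-1 : ℝ)..1, c y ^ 2 ≤ 4 * ℓ * (∫ y in (-1 : ℝ)..1, parab y * d y ^ 2)
      + 54 / ℓ ^ 2 * ∫ y in (-1 : ℝ)..1, b y ^ 2 := by
  have hb := h.bdd₁
  have hc := h.bdd₂
  have hd := h.bdd₃
  set φ : ℝ → ℝ := fun y => parab y / (parab y + ℓ) with hφ
  have hφb : BddCont φ := by
    refine ⟨?_, 1, fun y hy => ?_⟩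
    · refine continuous_parab.continuousOn.div (continuous_parab.add_const ℓ).continuousOn
        fun y hy => ?_
      have := parab_pos hy; positivity
    · have := parab_pos hy
      rw [abs_of_nonneg (by positivity), div_le_one (by positivity)]
      linarith
  have hφd : ∀ y ∈ Ioo (-1 : ℝ) 1, HasDerivAt φ (-(y * (1 - φ y) ^ 2 / ℓ)) y := by
    intro y hy
    have hw := parab_pos hy
    have := (hasDerivAt_parab y).div ((hasDerivAt_parab y).add_const ℓ) (by positivity)
    refine this.congr_deriv ?_
    simp only [hφ]
    field_simp
    ring
  set T : ℝ → ℝ := fun y => -(ℓ * y * φ y) * c y ^ 2 + (ℓ + 4) * (φ y * (b y * c y)) with hT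
  set T' : ℝ → ℝ := fun y => (-(ℓ * φ y) + y ^ 2 * (1 - φ y) ^ 2) * c y ^ 2
      + 2 * (-(ℓ * y * φ y)) * c y * d y
      + (ℓ + 4) * (-(y * (1 - φ y) ^ 2 / ℓ) * (b y * c y) + φ y * (c y * c y + b y * d y)) with hT'
  have hTd : ∀ y ∈ Ioo (-1 : ℝ) 1, HasDerivAt T (T' y) y := by
    intro y hy
    have h1 := ((((hasDerivAt_id y).const_mul ℓ).mul (hφd y hy)).neg).mul
      ((h.deriv₃ y hy).pow 2)
    have h2 := ((hφd y hy).mul ((h.deriv₂ y hy).mul (h.deriv₃ y hy))).const_mul (ℓ + 4)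
    refine (h1.add h2).congr_deriv ?_
    simp only [hT', id, Pi.mul_apply, Pi.neg_apply, Pi.pow_apply]
    field_simp
    push_cast
    ring
  have hT'b : BddCont T' := by simp only [hT']; fun_prop
  have hφl : Tendsto φ (𝓝[>] (-1)) (𝓝 0) := by
    have := tendsto_parab_left.div (tendsto_parab_left.add_const ℓ) (by simpa using hℓ.ne')
    rwa [zero_div] at this
  have hφr : Tendsto φ (𝓝[<] 1) (𝓝 0) := by
    have := tendsto_parab_right.div (tendsto_parab_right.add_const ℓ) (by simpa using hℓ.ne')
    rwa [zero_div] at this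
  have hTeq : T = fun y => (-(ℓ * y) * c y ^ 2 + (ℓ + 4) * (b y * c y)) * φ y := by
    ext y; simp only [hT]; ring
  have hG : BddCont fun y => -(ℓ * y) * c y ^ 2 + (ℓ + 4) * (b y * c y) := by fun_prop
  have hint : ∫ y in (-1 : ℝ)..1, T' y = 0 := by
    rw [integral_deriv_eq_sub hTd hT'b (l := 0) (r := 0), sub_zero]
    · rw [hTeq]; exact hG.tendsto_mul_left hφl
    · rw [hTeq]; exact hG.tendsto_mul_right hφr
  have key := BddCont.integral_le (f := fun y => c y ^ 2)
    (g := fun y => T' y + (c y ^ 2 / 2 + 2 * ℓ * (parab y * d y ^ 2) + 27 / ℓ ^ 2 * b y ^ 2))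
    (by fun_prop) (by fun_prop) fun y hy =>
      interpolation_pointwise hℓ hℓ1 (parab_pos hy) rfl rfl
  have i1 : IntervalIntegrable (fun y => c y ^ 2 / 2) volume (-1) 1 :=
    BddCont.intervalIntegrable (by fun_prop)
  have i2 : IntervalIntegrable (fun y => 2 * ℓ * (parab y * d y ^ 2)) volume (-1) 1 :=
    BddCont.intervalIntegrable (by fun_prop)
  have i3 : IntervalIntegrable (fun y => 27 / ℓ ^ 2 * b y ^ 2) volume (-1) 1 :=
    BddCont.intervalIntegrable (by fun_prop)
  rw [intervalIntegral.integral_add hT'b.intervalIntegrable ((i1.add i2).add i3),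
    intervalIntegral.integral_add (i1.add i2) i3, intervalIntegral.integral_add i1 i2,
    intervalIntegral.integral_div, intervalIntegral.integral_const_mul,
    intervalIntegral.integral_const_mul, hint] at key
  have : 54 / ℓ ^ 2 * (∫ y in (-1 : ℝ)..1, b y ^ 2)
    = 2 * (27 / ℓ ^ 2 * ∫ y in (-1 : ℝ)..1, b y ^ 2) := by ring
  rw [this]
  linarith

theorem integral_sq_nonneg (f : ℝ → ℝ) : 0 ≤ ∫ y in (-1 : ℝ)..1, f y ^ 2 :=
  intervalIntegral.integral_nonneg (by norm_num) fun _ _ => sq_nonneg _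

theorem integral_weighted_nonneg (f : ℝ → ℝ) : 0 ≤ ∫ y in (-1 : ℝ)..1, parab y * f y ^ 2 :=
  intervalIntegral.integral_nonneg (by norm_num) fun y hy =>
    mul_nonneg (by unfold parab; nlinarith [hy.1, hy.2]) (sq_nonneg _)

/-- Interpolation of `∫ c²` between `∫ b²` and the dissipation. -/
theorem integral_sq_cube_le (h : IsProfile a b c d) :
    (∫ y in (-1 : ℝ)..1, c y ^ 2) ^ 3 ≤ 8 * 54 ^ 3 * (∫ y in (-1 : ℝ)..1, b y ^ 2)
      * ((∫ y in (-1 : ℝ)..1, c y ^ 2) + ∫ y in (-1 : ℝ)..1, parab y * d y ^ 2) ^ 2 := by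
  have hint := fun ℓ hℓ hℓ1 => h.integral_sq_le (ℓ := ℓ) hℓ hℓ1
  have hB := integral_sq_nonneg b
  have hK := integral_sq_nonneg c
  have hM := integral_weighted_nonneg d
  generalize (∫ y in (-1 : ℝ)..1, b y ^ 2) = B at *
  generalize (∫ y in (-1 : ℝ)..1, c y ^ 2) = K at *
  generalize (∫ y in (-1 : ℝ)..1, parab y * d y ^ 2) = M at *
  rcases hK.eq_or_lt with rfl | hK
  · rw [zero_pow (by norm_num)]; positivity
  have hD : 0 < K + M := by linarith
  -- Nearly optimal width: it is at most one and makes `4 ℓ M ≤ K / 2`. The constant is `2 · 54 ·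
  -- 108² = 8 · 54³`.
  have h1 := hint (K / (108 * (K + M))) (by positivity)
    (by rw [div_le_one (by positivity)]; linarith)
  have h2 : 4 * (K / (108 * (K + M))) * M ≤ K / 2 := by
    rw [show 4 * (K / (108 * (K + M))) * M = K * (4 * M) / (108 * (K + M)) by ring,
      div_le_div_iff₀ (by positivity) (by norm_num)]
    nlinarith [mul_nonneg hK.le hM]
  have h3 : 54 / (K / (108 * (K + M))) ^ 2 * B = 54 * 108 ^ 2 * B * (K + M) ^ 2 / K ^ 2 := by
    field_simp
  rw [h3] at h1
  have h4 : K / 2 ≤ 54 * 108 ^ 2 * B * (K + M) ^ 2 / K ^ 2 := by linarith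
  rw [le_div_iff₀ (by positivity)] at h4
  nlinarith

theorem exists_deriv_eq_zero (h : IsProfile a b c d) : ∃ y ∈ Ioo (-1 : ℝ) 1, b y = 0 :=
  exists_hasDerivAt_eq_zero' (by norm_num) h.left h.right h.deriv₁

/-- Integrate `(s b²)' = 2 s b c ≤ s² b² + c²` from a zero of `b`. Keeping `s` free allows
optimization afterwards without square roots. -/
theorem mul_sq_le (h : IsProfile a b c d) (s : ℝ) {y : ℝ} (hy : y ∈ Ioo (-1 : ℝ) 1) :
    s * b y ^ 2 ≤ s ^ 2 * (∫ y in (-1 : ℝ)..1, b y ^ 2) + ∫ y in (-1 : ℝ)..1, c y ^ 2 := by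
  obtain ⟨x, hx, hbx⟩ := h.exists_deriv_eq_zero
  have hb := h.bdd₁
  have hc := h.bdd₂
  have := abs_sub_le_integral (f := fun y => s * b y ^ 2) (f' := fun y => 2 * s * (b y * c y))
    (g := fun y => s ^ 2 * b y ^ 2 + c y ^ 2)
    (fun z hz => by
      refine (((h.deriv₂ z hz).pow 2).const_mul s).congr_deriv ?_
      push_cast; ring)
    (by fun_prop) (by fun_prop)
    (fun z _ => abs_le.2 ⟨by nlinarith [sq_nonneg (s * b z + c z)],
      by nlinarith [sq_nonneg (s * b z - c z)]⟩) hx hy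
  rw [intervalIntegral.integral_add (BddCont.intervalIntegrable (by fun_prop))
    (BddCont.intervalIntegrable (by fun_prop)), intervalIntegral.integral_const_mul] at this
  simp only [hbx] at this
  have h2 := le_abs_self (s * b y ^ 2 - s * 0 ^ 2)
  linarith

/-- The quadratic polynomial in `s` from `mul_sq_le` is nonnegative, so its discriminant is not
positive. -/
theorem pow_four_le (h : IsProfile a b c d) {y : ℝ} (hy : y ∈ Ioo (-1 : ℝ) 1) :
    b y ^ 4 ≤ 4 * (∫ y in (-1 : ℝ)..1, b y ^ 2) * ∫ y in (-1 : ℝ)..1, c y ^ 2 := by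
  have := discrim_le_zero (a := ∫ y in (-1 : ℝ)..1, b y ^ 2) (b := -b y ^ 2)
    (c := ∫ y in (-1 : ℝ)..1, c y ^ 2) fun s => by nlinarith [h.mul_sq_le s hy]
  unfold discrim at this
  nlinarith

/-- Integrating `mul_sq_le` with `s = 1/4` over an interval of length 2 leaves `B/4 ≤ B/8 + 2 K`. -/
theorem integral_sq_le_integral_deriv_sq (h : IsProfile a b c d) :
    ∫ y in (-1 : ℝ)..1, b y ^ 2 ≤ 16 * ∫ y in (-1 : ℝ)..1, c y ^ 2 := by
  have hb := h.bdd₁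
  have := BddCont.integral_le (f := fun y => 1 / 4 * b y ^ 2) (by fun_prop) (BddCont.const _)
    fun y hy => h.mul_sq_le (1 / 4) hy
  simp only [intervalIntegral.integral_const_mul, intervalIntegral.integral_const,
    smul_eq_mul] at this
  linarith

/-- Integrate `|b| ≤ 2 b² + 1/8` from the boundary, where `a = 1`. -/
theorem abs_sub_one_le (h : IsProfile a b c d)
    (hB : ∫ y in (-1 : ℝ)..1, b y ^ 2 ≤ 1 / 16) {y : ℝ} (hy : y ∈ Ioo (-1 : ℝ) 1) :
    |a y - 1| ≤ 1 / 2 := by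
  have hb := h.bdd₁
  have h1 : ∀ x ∈ Ioo (-1 : ℝ) 1, |a y - a x| ≤ 1 / 2 := by
    intro x hx
    have := abs_sub_le_integral (g := fun y => 2 * b y ^ 2 + 1 / 8) h.deriv₁ h.bdd₁ (by fun_prop)
      (fun z _ => abs_le.2 ⟨by nlinarith [sq_nonneg (b z + 1 / 4)],
        by nlinarith [sq_nonneg (b z - 1 / 4)]⟩) hx hy
    rw [intervalIntegral.integral_add (BddCont.intervalIntegrable (by fun_prop)) (by simp),
      intervalIntegral.integral_const_mul, intervalIntegral.integral_const, smul_eq_mul] at this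
    linarith
  refine le_of_tendsto (((tendsto_const_nhds (x := a y)).sub h.left).abs) ?_
  filter_upwards [Ioo_mem_nhdsGT (show (-1 : ℝ) < 1 by norm_num)] with x hx using h1 x hx

/-- The density of the dissipation, without its boundary contribution. -/
noncomputable def dissip (a b c d : ℝ → ℝ) (y : ℝ) : ℝ :=
  a y ^ 5 * parab y * d y ^ 2 + 8 * a y ^ 5 * c y ^ 2 + 6 * a y ^ 4 * parab y * b y * c y * d y
    + 5 * a y ^ 3 * b y ^ 2 * c y ^ 2 * parab y + 16 * a y ^ 4 * y * b y * c y ^ 2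
    + 15 * a y ^ 3 * y * b y ^ 3 * c y + 25 * a y ^ 4 * b y ^ 2 * c y
    - a y ^ 2 * b y ^ 4 * c y * parab y

/-- Three completed squares absorb the terms of third order: half of `a⁵ w d²` takes `b c d`, one
copy of `a⁵ c²` takes `y b c²`, another takes `b² c`. With `a⁵ ≥ 1/32` there remain `w d² / 64` and
`6 c² / 32`; the leftover terms have degree at least four in `b` and `c`. -/
theorem dissip_pointwise {a b c d y w : ℝ} (ha : |a - 1| ≤ 1 / 2) (hy : |y| ≤ 1) (hw : 0 ≤ w)
    (hw1 : w ≤ 1 / 2) :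
    1 / 64 * (w * d ^ 2) + 3 / 16 * c ^ 2 - 265 * (b ^ 2 * c ^ 2) - 556 * b ^ 4 - b ^ 6 ≤
      a ^ 5 * w * d ^ 2 + 8 * a ^ 5 * c ^ 2 + 6 * a ^ 4 * w * b * c * d
    + 5 * a ^ 3 * b ^ 2 * c ^ 2 * w + 16 * a ^ 4 * y * b * c ^ 2
    + 15 * a ^ 3 * y * b ^ 3 * c + 25 * a ^ 4 * b ^ 2 * c
    - a ^ 2 * b ^ 4 * c * w := by
  obtain ⟨h1, h2⟩ := abs_le.1 ha
  obtain ⟨hy1, hy2⟩ := abs_le.1 hy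
  have ha0 : 1 / 2 ≤ a := by linarith
  have ha1 : a ≤ 3 / 2 := by linarith
  have ha3 : 0 ≤ a ^ 3 := by positivity
  have a5 : 1 / 32 ≤ a ^ 5 := by
    have := pow_le_pow_left₀ (by norm_num) ha0 5; norm_num at this ⊢; exact this
  have a3 : a ^ 3 ≤ 27 / 8 := by
    have := pow_le_pow_left₀ (by linarith) ha1 3; norm_num at this ⊢; exact this
  have a2 : a ^ 2 ≤ 9 / 4 := by
    have := pow_le_pow_left₀ (by linarith) ha1 2; norm_num at this ⊢; exact this
  have s1 : 0 ≤ a ^ 3 * w * (a * d + 6 * b * c) ^ 2 := by positivity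
  have s2 : 0 ≤ a ^ 3 * (c ^ 2 * (a + 8 * y * b) ^ 2) := by positivity
  have s3 : 0 ≤ a ^ 3 * (a * c + 25 / 2 * b ^ 2) ^ 2 := by positivity
  have s4 : -(15 / 2 * (a ^ 3 * (b ^ 4 + b ^ 2 * c ^ 2))) ≤ 15 * a ^ 3 * y * b ^ 3 * c := by
    have e : 0 ≤ a ^ 3 * (b ^ 2 * (b ^ 2 + c ^ 2 + 2 * y * (b * c))) := by
      have : 0 ≤ b ^ 2 + c ^ 2 + 2 * y * (b * c) := by
        nlinarith [sq_nonneg (b + y * c), mul_nonneg (sub_nonneg.2 (abs_le_one_iff_mul_self_le_one.1 hy))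
          (sq_nonneg c)]
      positivity
    nlinarith
  have s5 : a ^ 2 * b ^ 4 * c * w ≤ a ^ 2 * w * (b ^ 2 * (b ^ 4 + c ^ 2)) / 2 := by
    nlinarith [mul_nonneg (mul_nonneg (sq_nonneg a) hw) (mul_nonneg (sq_nonneg b)
      (sq_nonneg (b ^ 2 - c)))]
  have hb2 : 0 ≤ b ^ 2 * c ^ 2 := by positivity
  have hb4 : 0 ≤ b ^ 4 := by positivity
  have hb6 : 0 ≤ b ^ 6 := by positivity
  have aw : a ^ 2 * w ≤ 9 / 8 := by nlinarith [mul_le_mul a2 hw1 hw (by norm_num)]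
  have t1 := mul_le_mul_of_nonneg_right a5 (mul_nonneg hw (sq_nonneg d))
  have t2 := mul_le_mul_of_nonneg_right a5 (sq_nonneg c)
  have t3 := mul_le_mul_of_nonneg_right a3 hb2
  have t4 := mul_le_mul_of_nonneg_right a3 hb4
  have t5 := mul_le_mul_of_nonneg_right aw hb6
  have t6 := mul_le_mul_of_nonneg_right aw hb2
  have t7 : a ^ 3 * (b ^ 2 * c ^ 2) * w ≤ a ^ 3 * (b ^ 2 * c ^ 2) * (1 / 2) :=
    mul_le_mul_of_nonneg_left hw1 (by positivity)
  have t8 : a ^ 3 * (b ^ 2 * c ^ 2) * y ^ 2 ≤ a ^ 3 * (b ^ 2 * c ^ 2) * 1 :=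
    mul_le_mul_of_nonneg_left (by nlinarith) (by positivity)
  nlinarith

/-- Each error term is at most a constant times `∫ b²` times the coercive part `∫ c² + ∫ w d²`, so
smallness of `∫ b²` suffices. Poincaré then converts what is left of `∫ c²` into `∫ b²`. -/
theorem integral_dissip_ge (h : IsProfile a b c d)
    (hB : ∫ y in (-1 : ℝ)..1, b y ^ 2 ≤ 1 / 10 ^ 8) :
    1 / 2048 * (∫ y in (-1 : ℝ)..1, b y ^ 2) ≤ ∫ y in (-1 : ℝ)..1, dissip a b c d y := by
  have ha := h.bdd₀
  have hb := h.bdd₁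
  have hc := h.bdd₂
  have hd := h.bdd₃
  have hbK := h.integral_sq_le_integral_deriv_sq
  have hcube := h.integral_sq_cube_le
  have hB0 := integral_sq_nonneg b
  have hK0 := integral_sq_nonneg c
  have hM0 := integral_weighted_nonneg d
  have hsup : ∀ y ∈ Ioo (-1 : ℝ) 1, b y ^ 4 ≤ _ := fun y hy => h.pow_four_le hy
  have key := BddCont.integral_le (f := fun y => 1 / 64 * (parab y * d y ^ 2) + 3 / 16 * c y ^ 2
      - 265 * (b y ^ 2 * c y ^ 2) - 556 * b y ^ 4 - b y ^ 6)
    (g := dissip a b c d) (by fun_prop) (by unfold dissip; fun_prop) fun y hy =>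
      dissip_pointwise (h.abs_sub_one_le (hB.trans (by norm_num)) hy)
        (abs_le.2 ⟨hy.1.le, hy.2.le⟩) (parab_pos hy).le (parab_le y)
  rw [intervalIntegral.integral_sub (BddCont.intervalIntegrable (by fun_prop))
      (BddCont.intervalIntegrable (by fun_prop)),
    intervalIntegral.integral_sub (BddCont.intervalIntegrable (by fun_prop))
      (BddCont.intervalIntegrable (by fun_prop)),
    intervalIntegral.integral_sub (BddCont.intervalIntegrable (by fun_prop))
      (BddCont.intervalIntegrable (by fun_prop)),
    intervalIntegral.integral_add (BddCont.intervalIntegrable (by fun_prop))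
      (BddCont.intervalIntegrable (by fun_prop))] at key
  simp only [intervalIntegral.integral_const_mul] at key
  set B := ∫ y in (-1 : ℝ)..1, b y ^ 2 with hBdef
  set K := ∫ y in (-1 : ℝ)..1, c y ^ 2 with hKdef
  set M := ∫ y in (-1 : ℝ)..1, parab y * d y ^ 2 with hMdef
  have i1 : ∫ y in (-1 : ℝ)..1, b y ^ 2 * c y ^ 2 ≤ √(4 * B * K) * K := by
    rw [hKdef, ← intervalIntegral.integral_const_mul, ← hKdef]
    refine BddCont.integral_le (by fun_prop) (by fun_prop) fun y hy =>
      mul_le_mul_of_nonneg_right ?_ (sq_nonneg _)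
    exact Real.le_sqrt_of_sq_le (by rw [← pow_mul]; exact hsup y hy)
  -- Squared, this is `4 B K³ ≤ 2245² B² (K + M)²`, which follows from the cubic interpolation
  -- because `4 · 8 · 54³ < 2245²`.
  have i2 : √(4 * B * K) * K ≤ 2245 * B * (K + M) := by
    refine abs_le_of_sq_le_sq' ?_ (by positivity) |>.2
    rw [mul_pow, Real.sq_sqrt (by positivity)]
    nlinarith [mul_le_mul_of_nonneg_left hcube (by positivity : 0 ≤ 4 * B),
      mul_nonneg (sq_nonneg B) (sq_nonneg (K + M))]
  have i3 : ∫ y in (-1 : ℝ)..1, b y ^ 4 ≤ 8 * B * K := by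
    have := BddCont.integral_le (f := fun y => b y ^ 4) (by fun_prop) (BddCont.const _) hsup
    simp only [intervalIntegral.integral_const, smul_eq_mul] at this
    linarith
  have i4 : ∫ y in (-1 : ℝ)..1, b y ^ 6 ≤ 4 * B * K * B := by
    rw [hBdef, ← intervalIntegral.integral_const_mul, ← hBdef]
    refine BddCont.integral_le (by fun_prop) (by fun_prop) fun y hy => ?_
    calc b y ^ 6 = b y ^ 4 * b y ^ 2 := by ring
      _ ≤ _ := mul_le_mul_of_nonneg_right (hsup y hy) (sq_nonneg _)
  have j1 : B * (K + M) ≤ 1 / 10 ^ 8 * (K + M) := mul_le_mul_of_nonneg_right hB (by positivity)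
  have j2 : B * K ≤ 1 / 10 ^ 8 * K := mul_le_mul_of_nonneg_right hB hK0
  have j3 : 4 * B * K * B ≤ 4 * B * K := mul_le_of_le_one_right (by positivity) (by linarith)
  linarith

/-- The speed of the slope of `u` at the contact line, i.e. the fourth derivative of the height,
in Lagrangian terms and divided by `a`. -/
noncomputable def flux (a b c d e : ℝ → ℝ) (y : ℝ) : ℝ :=
  a y ^ 3 * e y * parab y - 5 * a y ^ 3 * d y * y - 10 * a y ^ 3 * c y
    + 7 * a y ^ 2 * b y * d y * parab y + 4 * a y ^ 2 * c y ^ 2 * parab y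
    - 30 * a y ^ 2 * b y * c y * y + 11 * a y * b y ^ 2 * c y * parab y
    - 15 * a y * b y ^ 3 * y - 25 * a y ^ 2 * b y ^ 2 + b y ^ 4 * parab y

/-- Since `s` vanishes at the ends, `-∫ b s' = ∫ c s`. A second integration by parts eliminates `e`,
the fourth derivative of `a`. For `a` near 1 its model is `∫ c (w e - 5 y d - 10 c) = -∫ w d² - 8 ∫
c² - 2 c(1)² - 2 c(-1)²`. -/
theorem integral_mul_deriv_le (h : IsProfile a b c d) {e s s' : ℝ → ℝ}
    (hde : ∀ y ∈ Ioo (-1 : ℝ) 1, HasDerivAt d (e y) y)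
    (hs : ∀ y ∈ Ioo (-1 : ℝ) 1, s y = a y ^ 2 * flux a b c d e y)
    (hs' : ∀ y ∈ Ioo (-1 : ℝ) 1, HasDerivAt s (s' y) y) (hsb : BddCont s) (hs'b : BddCont s')
    (hsl : Tendsto s (𝓝[>] (-1)) (𝓝 0)) (hsr : Tendsto s (𝓝[<] 1) (𝓝 0)) :
    -∫ y in (-1 : ℝ)..1, b y * s' y ≤ -∫ y in (-1 : ℝ)..1, dissip a b c d y := by
  have ha := h.bdd₀
  have hb := h.bdd₁
  have hc := h.bdd₂
  have hd := h.bdd₃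
  have h1 : ∫ y in (-1 : ℝ)..1, (c y * s y + b y * s' y) = 0 - 0 :=
    integral_deriv_eq_sub (fun y hy => (h.deriv₂ y hy).mul (hs' y hy)) (by fun_prop)
      (hb.tendsto_mul_left hsl) (hb.tendsto_mul_right hsr)
  have hdb : BddCont (dissip a b c d) := by unfold dissip; fun_prop
  obtain ⟨⟨l, hl⟩, r, hr⟩ := exists_tendsto_of_deriv_bddCont h.deriv₃ hd
  -- The primitive consists of a multiple of `w`, which vanishes at the ends, and of `-2 y a⁵ c²`,
  -- whose boundary contribution is negative at both ends.
  have h2 : ∫ y in (-1 : ℝ)..1, (c y * s y + dissip a b c d y) = -2 * r ^ 2 - 2 * l ^ 2 := by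
    have hG : BddCont fun y => a y ^ 5 * c y * d y + 4 * a y ^ 4 * b y * c y ^ 2 := by fun_prop
    refine integral_deriv_eq_sub (P := fun y => (a y ^ 5 * c y * d y + 4 * a y ^ 4 * b y * c y ^ 2)
        * parab y + -2 * y * a y ^ 5 * c y ^ 2) (fun y hy => ?_) (by fun_prop) ?_ ?_
    · have d1 := h.deriv₁ y hy
      have d2 := h.deriv₂ y hy
      have d3 := h.deriv₃ y hy
      have d4 := hde y hy
      have := (((((d1.pow 5).mul d3).mul d4).add ((((d1.pow 4).const_mul 4).mul d2).mul
        (d3.pow 2))).mul (hasDerivAt_parab y)).add ((((hasDerivAt_id y).const_mul (-2)).mul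
        (d1.pow 5)).mul (d3.pow 2))
      refine this.congr_deriv ?_
      rw [hs y hy]
      simp only [flux, dissip, Pi.mul_apply, Pi.pow_apply, Pi.add_apply, id]
      have : y ^ 2 = 1 - 2 * parab y := by unfold parab; ring
      push_cast
      ring
    · have hid : Tendsto (fun y : ℝ => y) (𝓝[>] (-1)) (𝓝 (-1)) := nhdsWithin_le_nhds
      have := (hG.tendsto_mul_left tendsto_parab_left).add
        (((hid.const_mul (-2)).mul (h.left.pow 5)).mul (hl.pow 2))
      convert this using 2
      ring
    · have hid : Tendsto (fun y : ℝ => y) (𝓝[<] 1) (𝓝 1) := nhdsWithin_le_nhds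
      have := (hG.tendsto_mul_right tendsto_parab_right).add
        (((hid.const_mul (-2)).mul (h.right.pow 5)).mul (hr.pow 2))
      convert this using 2
      ring
  rw [intervalIntegral.integral_add (BddCont.intervalIntegrable (by fun_prop))
    (BddCont.intervalIntegrable (by fun_prop))] at h1
  rw [intervalIntegral.integral_add (BddCont.intervalIntegrable (by fun_prop))
    hdb.intervalIntegrable] at h2
  nlinarith [sq_nonneg r, sq_nonneg l]

end IsProfile

/-! ### Weighted Hardy bounds and regularity of profiles up to the boundary -/

theorem nonneg_of_deriv_nonneg {G G' : ℝ → ℝ} (hd : ∀ y ∈ Ioo (-1 : ℝ) 1, HasDerivAt G (G' y) y)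
    (hG' : ∀ y ∈ Ioo (-1 : ℝ) 1, 0 ≤ G' y) (hl : Tendsto G (𝓝[>] (-1)) (𝓝 0)) {y : ℝ}
    (hy : y ∈ Ioo (-1 : ℝ) 1) : 0 ≤ G y := by
  have hm : MonotoneOn G (Ioo (-1) 1) := by
    refine monotoneOn_of_deriv_nonneg (convex_Ioo _ _)
      (fun z hz => (hd z hz).continuousAt.continuousWithinAt) ?_ ?_
    · rw [interior_Ioo]
      exact fun z hz => (hd z hz).differentiableAt.differentiableWithinAt
    · rw [interior_Ioo]
      exact fun z hz => by rw [(hd z hz).deriv]; exact hG' z hz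
  refine le_of_tendsto hl ?_
  filter_upwards [Ioo_mem_nhdsGT hy.1] with z hz
  exact hm ⟨hz.1, hz.2.trans hy.2⟩ hy hz.2.le

/-- Compare `w^(k+1) h` with the barrier `R (1 + y)^(k+1)`: because `w ≤ 1 + y`, the barrier grows
at least as fast. On the left half `1 + y ≤ 2 w`, so the weight can be divided out at the cost of
`2^(k+1)`. -/
theorem hardy_left {h r : ℝ → ℝ} {R : ℝ} {k : ℕ}
    (hd : ∀ y ∈ Ioo (-1 : ℝ) 1,
      HasDerivAt (fun y => parab y ^ (k + 1) * h y) (parab y ^ k * r y) y)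
    (hr : ∀ y ∈ Ioo (-1 : ℝ) 1, |r y| ≤ R)
    (hl : Tendsto (fun y => parab y ^ (k + 1) * h y) (𝓝[>] (-1)) (𝓝 0)) {y : ℝ}
    (hy : y ∈ Ioo (-1 : ℝ) 1) (hy0 : y ≤ 0) : |h y| ≤ 2 ^ (k + 1) * R := by
  have hR : 0 ≤ R := (abs_nonneg _).trans (hr y hy)
  have hA : ∀ y : ℝ, HasDerivAt (fun y => R * (1 + y) ^ (k + 1)) (R * ((k + 1) * (1 + y) ^ k)) y := by
    intro y
    have := (((hasDerivAt_id y).const_add 1).pow (k + 1)).const_mul R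
    refine this.congr_deriv ?_
    simp
  have hAl : Tendsto (fun y : ℝ => R * (1 + y) ^ (k + 1)) (𝓝[>] (-1)) (𝓝 0) := by
    have : Continuous fun y : ℝ => R * (1 + y) ^ (k + 1) := by fun_prop
    simpa using (this.tendsto (-1)).mono_left (nhdsWithin_le_nhds (s := Ioi (-1)))
  have hb : ∀ z ∈ Ioo (-1 : ℝ) 1, |parab z ^ k * r z| ≤ R * ((k + 1) * (1 + z) ^ k) := by
    intro z hz
    have hw := parab_pos hz
    have hz1 : 0 < 1 + z := by linarith [hz.1]
    rw [abs_mul, abs_of_pos (pow_pos hw k), mul_comm]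
    refine mul_le_mul (hr z hz) ?_ (by positivity) hR
    have h1 : parab z ^ k ≤ (1 + z) ^ k :=
      pow_le_pow_left₀ hw.le (by unfold parab; nlinarith [hz.1, hz.2]) k
    nlinarith [pow_pos hz1 k, (Nat.cast_nonneg k : (0 : ℝ) ≤ k)]
  have h1 : 0 ≤ R * (1 + y) ^ (k + 1) - parab y ^ (k + 1) * h y :=
    nonneg_of_deriv_nonneg (fun z hz => (hA z).sub (hd z hz))
      (fun z hz => by linarith [(abs_le.1 (hb z hz)).2]) (by
        have := hAl.sub hl
        rw [sub_zero] at this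
        exact this) hy
  have h2 : 0 ≤ R * (1 + y) ^ (k + 1) + parab y ^ (k + 1) * h y :=
    nonneg_of_deriv_nonneg (fun z hz => (hA z).add (hd z hz))
      (fun z hz => by linarith [(abs_le.1 (hb z hz)).1]) (by
        have := hAl.add hl
        rw [add_zero] at this
        exact this) hy
  have hw := parab_pos hy
  have h3 : parab y ^ (k + 1) * |h y| ≤ R * (1 + y) ^ (k + 1) := by
    rw [← abs_of_pos (pow_pos hw (k + 1)), ← abs_mul]
    exact abs_le.2 ⟨by linarith, by linarith⟩
  have h4 : (1 + y) ^ (k + 1) ≤ 2 ^ (k + 1) * parab y ^ (k + 1) := by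
    rw [← mul_pow]
    refine pow_le_pow_left₀ (by linarith [hy.1]) ?_ _
    unfold parab; nlinarith [hy.1, hy.2]
  have h5 := h3.trans (mul_le_mul_of_nonneg_left h4 hR)
  refine le_of_mul_le_mul_left (h5.trans_eq (by ring)) (pow_pos hw (k + 1))

theorem parab_neg (y : ℝ) : parab (-y) = parab y := by simp [parab]

theorem tendsto_neg_left : Tendsto (fun y : ℝ => -y) (𝓝[>] (-1)) (𝓝[<] 1) := by
  refine tendsto_nhdsWithin_iff.2 ⟨?_, ?_⟩
  · have := (continuous_neg.tendsto (-1 : ℝ)).mono_left (nhdsWithin_le_nhds (s := Ioi (-1)))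
    simpa using this
  · filter_upwards [self_mem_nhdsWithin] with y hy
    have : -1 < y := hy
    exact mem_Iio.2 (by linarith)

/-- If `(w^(k+1) h)' = w^k r` for the parabola `w`, then `h` is bounded in terms of `r`. -/
theorem hardy_bound {h r : ℝ → ℝ} {R : ℝ} {k : ℕ}
    (hd : ∀ y ∈ Ioo (-1 : ℝ) 1,
      HasDerivAt (fun y => parab y ^ (k + 1) * h y) (parab y ^ k * r y) y)
    (hr : ∀ y ∈ Ioo (-1 : ℝ) 1, |r y| ≤ R)
    (hl : Tendsto (fun y => parab y ^ (k + 1) * h y) (𝓝[>] (-1)) (𝓝 0))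
    (hrt : Tendsto (fun y => parab y ^ (k + 1) * h y) (𝓝[<] 1) (𝓝 0)) {y : ℝ}
    (hy : y ∈ Ioo (-1 : ℝ) 1) : |h y| ≤ 2 ^ (k + 1) * R := by
  rcases le_total y 0 with h0 | h0
  · exact hardy_left hd hr hl hy h0
  · have hneg : ∀ z ∈ Ioo (-1 : ℝ) 1, -z ∈ Ioo (-1 : ℝ) 1 := fun z hz =>
      ⟨by linarith [hz.2], by linarith [hz.1]⟩
    have := hardy_left (h := fun y => h (-y)) (r := fun y => -r (-y)) (R := R) (k := k)
      (fun z hz => by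
        have := (hd (-z) (hneg z hz)).comp z (hasDerivAt_neg z)
        simp only [Function.comp_def, parab_neg] at this
        exact this.congr_deriv (by ring))
      (fun z hz => by rw [abs_neg]; exact hr _ (hneg z hz))
      (by
        have := hrt.comp tendsto_neg_left
        simpa only [Function.comp_def, parab_neg] using this) (hneg y hy) (by linarith)
    simpa using this

/-- The gain of one power of `w`: boundedness of `w^k h` makes `w^(k+1) h` vanish at the ends, and
Hardy then bounds `h` itself. -/
theorem BddCont.of_hardy {h r : ℝ → ℝ} {k : ℕ} (hc : ContinuousOn h (Ioo (-1) 1))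
    (hd : ∀ y ∈ Ioo (-1 : ℝ) 1,
      HasDerivAt (fun y => parab y ^ (k + 1) * h y) (parab y ^ k * r y) y)
    (hr : BddCont r) (hw : BddCont fun y => parab y ^ k * h y) : BddCont h := by
  obtain ⟨-, R, hR⟩ := hr
  refine ⟨hc, 2 ^ (k + 1) * R, fun y hy => hardy_bound hd hR ?_ ?_ hy⟩
  · have := hw.tendsto_mul_left tendsto_parab_left
    exact this.congr fun y => by ring
  · have := hw.tendsto_mul_right tendsto_parab_right
    exact this.congr fun y => by ring

theorem BddCont.congr {f g : ℝ → ℝ} (hf : BddCont f) (h : ∀ y ∈ Ioo (-1 : ℝ) 1, g y = f y) :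
    BddCont g := by
  obtain ⟨hf, C, hC⟩ := hf
  exact ⟨hf.congr h, C, fun y hy => by rw [h y hy]; exact hC y hy⟩

theorem BddCont.inv {f : ℝ → ℝ} (hf : BddCont f) {α : ℝ} (hα : 0 < α)
    (h : ∀ y ∈ Ioo (-1 : ℝ) 1, α ≤ f y) : BddCont fun y => (f y)⁻¹ := by
  refine ⟨hf.1.inv₀ fun y hy => (hα.trans_le (h y hy)).ne', α⁻¹, fun y hy => ?_⟩
  rw [abs_inv, abs_of_pos (hα.trans_le (h y hy))]
  exact inv_anti₀ hα (h y hy)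

theorem eq_deriv_of_eqOn {f g f' g' : ℝ → ℝ} (h : ∀ y ∈ Ioo (-1 : ℝ) 1, f y = g y)
    (hf : ∀ y ∈ Ioo (-1 : ℝ) 1, HasDerivAt f (f' y) y)
    (hg : ∀ y ∈ Ioo (-1 : ℝ) 1, HasDerivAt g (g' y) y) : ∀ y ∈ Ioo (-1 : ℝ) 1, f' y = g' y := by
  intro y hy
  refine (hf y hy).unique ((hg y hy).congr_of_eventuallyEq ?_)
  filter_upwards [isOpen_Ioo.mem_nhds hy] with z hz using h z hz

/-- Here `g₁` and `g₂` stand for `u_x` and `u_xx` in the mass coordinate, where `∂_x = a ∂_y`. With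
`p = a b` the right side is `w p' - 3 y p - a²`, and `w² (w p' - 3 y p) = (w³ p)'` is the form
required by the Hardy bound. -/
theorem curvature_eq {a b c g₁ g₂ : ℝ → ℝ}
    (hab : ∀ y ∈ Ioo (-1 : ℝ) 1, HasDerivAt a (b y) y)
    (hbc : ∀ y ∈ Ioo (-1 : ℝ) 1, HasDerivAt b (c y) y)
    (h₁ : ∀ y ∈ Ioo (-1 : ℝ) 1, g₁ y = a y * (b y * parab y - y * a y))
    (h₁₂ : ∀ y ∈ Ioo (-1 : ℝ) 1, HasDerivAt g₁ (g₂ y / a y) y) :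
    ∀ y ∈ Ioo (-1 : ℝ) 1, g₂ y / a y =
      parab y * (b y ^ 2 + a y * c y) - 3 * y * (a y * b y) - a y ^ 2 :=
  eq_deriv_of_eqOn h₁ h₁₂ (g' := fun y =>
    parab y * (b y ^ 2 + a y * c y) - 3 * y * (a y * b y) - a y ^ 2) (fun y hy => by
      have := (hab y hy).mul (((hbc y hy).mul (hasDerivAt_parab y)).sub
        ((hasDerivAt_id y).mul (hab y hy)))
      refine this.congr_deriv ?_
      simp only [Pi.mul_apply, Pi.sub_apply, id]
      ring)

/-- The slope of the relative height is bounded in terms of two derivatives of the height. -/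
theorem abs_slope_le {a b c g₁ g₂ : ℝ → ℝ} {α A G₁ G₂ : ℝ}
    (hab : ∀ y ∈ Ioo (-1 : ℝ) 1, HasDerivAt a (b y) y)
    (hbc : ∀ y ∈ Ioo (-1 : ℝ) 1, HasDerivAt b (c y) y)
    (h₁ : ∀ y ∈ Ioo (-1 : ℝ) 1, g₁ y = a y * (b y * parab y - y * a y))
    (h₁₂ : ∀ y ∈ Ioo (-1 : ℝ) 1, HasDerivAt g₁ (g₂ y / a y) y)
    (hα : 0 < α) (hαa : ∀ y ∈ Ioo (-1 : ℝ) 1, α ≤ a y) (haA : ∀ y ∈ Ioo (-1 : ℝ) 1, a y ≤ A)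
    (hG₁ : ∀ y ∈ Ioo (-1 : ℝ) 1, |g₁ y| ≤ G₁) (hG₂ : ∀ y ∈ Ioo (-1 : ℝ) 1, |g₂ y| ≤ G₂)
    {y : ℝ} (hy : y ∈ Ioo (-1 : ℝ) 1) : |b y| ≤ 8 * (G₂ / α + A ^ 2) / α := by
  have ha : ∀ y ∈ Ioo (-1 : ℝ) 1, 0 < a y := fun y hy => hα.trans_le (hαa y hy)
  have hac : ContinuousOn a (Ioo (-1) 1) := fun y hy =>
    (hab y hy).continuousAt.continuousWithinAt
  have hbcn : ContinuousOn b (Ioo (-1) 1) := fun y hy =>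
    (hbc y hy).continuousAt.continuousWithinAt
  have hab' : BddCont a := ⟨hac, A, fun y hy => by rw [abs_of_pos (ha y hy)]; exact haA y hy⟩
  have hg1 : BddCont g₁ := by
    refine ⟨ContinuousOn.congr ?_ h₁, G₁, hG₁⟩
    exact hac.mul ((hbcn.mul continuous_parab.continuousOn).sub (continuousOn_id.mul hac))
  -- No bound on `b` is available yet, but `w a b = g₁ + y a²` is bounded, and this suffices for `w³
  -- a b` to vanish at the ends.
  have hF : BddCont fun y => parab y * (g₁ y + y * a y ^ 2) := by fun_prop
  have hFeq : ∀ y ∈ Ioo (-1 : ℝ) 1,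
      parab y ^ (2 + 1) * (a y * b y) = parab y * (g₁ y + y * a y ^ 2) * parab y := by
    intro y hy
    rw [h₁ y hy]; ring
  have h3 := hardy_bound (h := fun y => a y * b y) (r := fun y => g₂ y / a y + a y ^ 2) (k := 2)
    (R := G₂ / α + A ^ 2) (fun y hy => by
      have := ((hasDerivAt_parab y).pow (2 + 1)).mul ((hab y hy).mul (hbc y hy))
      refine this.congr_deriv ?_
      rw [curvature_eq hab hbc h₁ h₁₂ y hy]
      simp only [Pi.mul_apply, Pi.pow_apply]
      push_cast
      ring)
    (fun y hy => by
      refine (abs_add_le _ _).trans (add_le_add ?_ ?_)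
      · rw [abs_div, abs_of_pos (ha y hy)]
        exact div_le_div₀ ((abs_nonneg _).trans (hG₂ y hy)) (hG₂ y hy) hα (hαa y hy)
      · rw [abs_of_nonneg (sq_nonneg _)]
        exact pow_le_pow_left₀ (ha y hy).le (haA y hy) 2)
    ((hF.tendsto_mul_left tendsto_parab_left).congr' (by
      filter_upwards [Ioo_mem_nhdsGT (show (-1 : ℝ) < 1 by norm_num)] with y hy
      exact (hFeq y hy).symm))
    ((hF.tendsto_mul_right tendsto_parab_right).congr' (by
      filter_upwards [Ioo_mem_nhdsLT (show (-1 : ℝ) < 1 by norm_num)] with y hy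
      exact (hFeq y hy).symm)) hy
  rw [abs_mul, abs_of_pos (ha y hy)] at h3
  rw [le_div_iff₀ hα]
  have := mul_le_mul_of_nonneg_left (hαa y hy) (abs_nonneg (b y))
  norm_num at h3
  linarith

/-- A positive relative height for which the first four Eulerian derivatives of the height,
written in the mass coordinate, are bounded is a profile; its flux is the fourth one. -/
theorem isProfile_of_bounded {a b c d e g₁ g₂ g₃ g₄ : ℝ → ℝ} {α : ℝ}
    (hab : ∀ y ∈ Ioo (-1 : ℝ) 1, HasDerivAt a (b y) y)
    (hbc : ∀ y ∈ Ioo (-1 : ℝ) 1, HasDerivAt b (c y) y)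
    (hcd : ∀ y ∈ Ioo (-1 : ℝ) 1, HasDerivAt c (d y) y)
    (hde : ∀ y ∈ Ioo (-1 : ℝ) 1, HasDerivAt d (e y) y)
    (hα : 0 < α) (hαa : ∀ y ∈ Ioo (-1 : ℝ) 1, α ≤ a y) (ha : BddCont a) (hb : BddCont b)
    (h₁ : ∀ y ∈ Ioo (-1 : ℝ) 1, g₁ y = a y * (b y * parab y - y * a y))
    (h₁₂ : ∀ y ∈ Ioo (-1 : ℝ) 1, HasDerivAt g₁ (g₂ y / a y) y)
    (h₂₃ : ∀ y ∈ Ioo (-1 : ℝ) 1, HasDerivAt g₂ (g₃ y / a y) y)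
    (h₃₄ : ∀ y ∈ Ioo (-1 : ℝ) 1, HasDerivAt g₃ (g₄ y / a y) y)
    (hg₂ : BddCont g₂) (hg₃ : BddCont g₃) (hg₄ : BddCont g₄)
    (hl : Tendsto g₁ (𝓝[>] (-1)) (𝓝 1)) (hr : Tendsto g₁ (𝓝[<] 1) (𝓝 (-1))) :
    IsProfile a b c d ∧
      ∀ y ∈ Ioo (-1 : ℝ) 1, a y * g₄ y = a y ^ 2 * IsProfile.flux a b c d e y := by
  have ha0 : ∀ y ∈ Ioo (-1 : ℝ) 1, 0 < a y := fun y hy => hα.trans_le (hαa y hy)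
  have cont : ∀ {f f' : ℝ → ℝ}, (∀ y ∈ Ioo (-1 : ℝ) 1, HasDerivAt f (f' y) y) →
      ContinuousOn f (Ioo (-1) 1) := fun h y hy => (h y hy).continuousAt.continuousWithinAt
  have h₂ := curvature_eq hab hbc h₁ h₁₂
  have h₃ : ∀ y ∈ Ioo (-1 : ℝ) 1, g₃ y / a y ^ 2 - g₂ y * b y / a y ^ 2 =
      parab y * (3 * b y * c y + a y * d y) - 4 * y * (b y ^ 2 + a y * c y)
        - 5 * (a y * b y) :=
    eq_deriv_of_eqOn h₂ (fun y hy => by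
      refine ((h₂₃ y hy).div (hab y hy) (ha0 y hy).ne').congr_deriv ?_
      have := (ha0 y hy).ne'
      field_simp) fun y hy => by
      have := (((hasDerivAt_parab y).mul (((hbc y hy).pow 2).add ((hab y hy).mul
        (hcd y hy)))).sub (((hasDerivAt_id y).const_mul 3).mul
        ((hab y hy).mul (hbc y hy)))).sub ((hab y hy).pow 2)
      refine this.congr_deriv ?_
      simp only [Pi.mul_apply, Pi.add_apply, Pi.pow_apply, id]
      push_cast
      ring
  have h₄ : ∀ y ∈ Ioo (-1 : ℝ) 1, g₄ y / a y ^ 3 - 3 * g₃ y * b y / a y ^ 3 - g₂ y * c y / a y ^ 2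
        + 2 * g₂ y * b y ^ 2 / a y ^ 3 =
      parab y * (3 * c y ^ 2 + 4 * b y * d y + a y * e y)
        - 5 * y * (3 * b y * c y + a y * d y) - 9 * (b y ^ 2 + a y * c y) :=
    eq_deriv_of_eqOn h₃ (fun y hy => by
      have := ((h₃₄ y hy).div ((hab y hy).pow 2) (pow_ne_zero 2 (ha0 y hy).ne')).sub
        (((h₂₃ y hy).mul (hbc y hy)).div ((hab y hy).pow 2) (pow_ne_zero 2 (ha0 y hy).ne'))
      refine this.congr_deriv ?_
      have := (ha0 y hy).ne'
      simp only [Pi.mul_apply, Pi.pow_apply]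
      field_simp
      push_cast
      ring) fun y hy => by
      have := (((hasDerivAt_parab y).mul ((((hbc y hy).const_mul 3).mul (hcd y hy)).add
        ((hab y hy).mul (hde y hy)))).sub (((hasDerivAt_id y).const_mul 4).mul
        (((hbc y hy).pow 2).add ((hab y hy).mul (hcd y hy))))).sub
        (((hab y hy).mul (hbc y hy)).const_mul 5)
      refine this.congr_deriv ?_
      simp only [Pi.mul_apply, Pi.add_apply, Pi.pow_apply, id]
      push_cast
      ring
  have hi : BddCont fun y => (a y)⁻¹ := ha.inv hα hαa
  -- Bootstrap: each derivative of `p = a b` solves the same kind of equation with one more power of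
  -- the weight. The formula for `g₃` bounds `p' = b² + a c`, hence `c`; the formula for `g₄` bounds
  -- `p'' = 3 b c + a d`, hence `d`.
  have hp2 : BddCont fun y => b y ^ 2 + a y * c y := by
    refine BddCont.of_hardy (k := 3)
      (r := fun y => g₃ y * (a y)⁻¹ ^ 2 - g₂ y * b y * (a y)⁻¹ ^ 2 + 5 * (a y * b y))
      (((cont hbc).pow 2).add ((cont hab).mul (cont hcd))) (fun y hy => ?_) (by fun_prop) ?_
    · have := ((hasDerivAt_parab y).pow (3 + 1)).mul (((hbc y hy).pow 2).add ((hab y hy).mul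
        (hcd y hy)))
      refine this.congr_deriv ?_
      have h3 := h₃ y hy
      simp only [div_eq_mul_inv, ← inv_pow] at h3
      rw [h3]
      simp only [Pi.mul_apply, Pi.add_apply, Pi.pow_apply]
      push_cast
      ring
    · refine BddCont.congr (f := fun y => parab y ^ 2 * (g₂ y * (a y)⁻¹ + 3 * y * (a y * b y)
        + a y ^ 2)) (by fun_prop) fun y hy => ?_
      rw [← div_eq_mul_inv, h₂ y hy]
      ring
  have hc : BddCont c := by
    refine BddCont.congr (f := fun y => (b y ^ 2 + a y * c y - b y ^ 2) * (a y)⁻¹)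
      (by fun_prop) fun y hy => ?_
    have := (ha0 y hy).ne'
    field_simp
    ring
  have hp3 : BddCont fun y => 3 * b y * c y + a y * d y := by
    refine BddCont.of_hardy (k := 4)
      (r := fun y => g₄ y * (a y)⁻¹ ^ 3 - 3 * g₃ y * b y * (a y)⁻¹ ^ 3 - g₂ y * c y * (a y)⁻¹ ^ 2
        + 2 * g₂ y * b y ^ 2 * (a y)⁻¹ ^ 3 + 9 * (b y ^ 2 + a y * c y))
      (((continuousOn_const.mul (cont hbc)).mul (cont hcd)).add ((cont hab).mul (cont hde)))
      (fun y hy => ?_) (by fun_prop) ?_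
    · have := ((hasDerivAt_parab y).pow (4 + 1)).mul ((((hbc y hy).const_mul 3).mul
        (hcd y hy)).add ((hab y hy).mul (hde y hy)))
      refine this.congr_deriv ?_
      have h4 := h₄ y hy
      simp only [div_eq_mul_inv, ← inv_pow] at h4
      rw [h4]
      simp only [Pi.mul_apply, Pi.add_apply, Pi.pow_apply]
      push_cast
      ring
    · refine BddCont.congr (f := fun y => parab y ^ 3 * (g₃ y * (a y)⁻¹ ^ 2
        - g₂ y * b y * (a y)⁻¹ ^ 2 + 4 * y * (b y ^ 2 + a y * c y) + 5 * (a y * b y)))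
        (by fun_prop) fun y hy => ?_
      have h3 := h₃ y hy
      simp only [div_eq_mul_inv, ← inv_pow] at h3
      rw [h3]
      ring
  have hd : BddCont d := by
    refine BddCont.congr (f := fun y => (3 * b y * c y + a y * d y - 3 * b y * c y) * (a y)⁻¹)
      (by fun_prop) fun y hy => ?_
    have := (ha0 y hy).ne'
    field_simp
    ring
  have hF : BddCont fun y => a y * b y := by fun_prop
  have hq : BddCont fun y => a y ^ 2 := by fun_prop
  -- The contact slope determines `a²` at the ends, because `g₁ = w a b - y a²` and the first term
  -- vanishes there; positivity of `a` fixes the root.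
  have sqrt_lim : ∀ {L : Filter ℝ}, (∀ᶠ y in L, y ∈ Ioo (-1 : ℝ) 1) →
      Tendsto (fun y => a y ^ 2) L (𝓝 1) → Tendsto a L (𝓝 1) := by
    intro L hL h
    have := h.sqrt
    rw [Real.sqrt_one] at this
    refine this.congr' ?_
    filter_upwards [hL] with y hy using Real.sqrt_sq (ha0 y hy).le
  refine ⟨⟨hab, hbc, hcd, ha, hb, hc, hd, ?_, ?_⟩, fun y hy => ?_⟩
  · have hmem : ∀ᶠ y in 𝓝[>] (-1 : ℝ), y ∈ Ioo (-1 : ℝ) 1 :=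
      Ioo_mem_nhdsGT (by norm_num)
    refine sqrt_lim hmem ?_
    have hy1 : Tendsto (fun y : ℝ => 1 + y) (𝓝[>] (-1)) (𝓝 0) := by
      have : Continuous fun y : ℝ => 1 + y := by fun_prop
      simpa using (this.tendsto (-1)).mono_left (nhdsWithin_le_nhds (s := Ioi (-1)))
    have := (hl.sub (hF.tendsto_mul_left tendsto_parab_left)).add (hq.tendsto_mul_left hy1)
    simp only [sub_zero, add_zero] at this
    refine this.congr' ?_
    filter_upwards [hmem] with y hy
    rw [h₁ y hy]; ring
  · have hmem : ∀ᶠ y in 𝓝[<] (1 : ℝ), y ∈ Ioo (-1 : ℝ) 1 :=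
      Ioo_mem_nhdsLT (by norm_num)
    refine sqrt_lim hmem ?_
    have hy1 : Tendsto (fun y : ℝ => 1 - y) (𝓝[<] 1) (𝓝 0) := by
      have : Continuous fun y : ℝ => 1 - y := by fun_prop
      simpa using (this.tendsto 1).mono_left (nhdsWithin_le_nhds (s := Iio 1))
    have := ((hF.tendsto_mul_right tendsto_parab_right).sub hr).add (hq.tendsto_mul_right hy1)
    simp only [zero_sub, neg_neg, add_zero] at this
    refine this.congr' ?_
    filter_upwards [hmem] with y hy
    rw [h₁ y hy]; ring
  · have hane := (ha0 y hy).ne'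
    have e2 := h₂ y hy
    have e3 := h₃ y hy
    have e4 := h₄ y hy
    rw [div_eq_iff hane] at e2
    have e3' : g₃ y = g₂ y * b y + a y ^ 2 * (parab y * (3 * b y * c y + a y * d y)
        - 4 * y * (b y ^ 2 + a y * c y) - 5 * (a y * b y)) := by
      rw [← e3]; field_simp; ring
    have e4' : g₄ y = 3 * g₃ y * b y + g₂ y * c y * a y - 2 * g₂ y * b y ^ 2
        + a y ^ 3 * (parab y * (3 * c y ^ 2 + 4 * b y * d y + a y * e y)
        - 5 * y * (3 * b y * c y + a y * d y) - 9 * (b y ^ 2 + a y * c y)) := by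
      rw [← e4]; field_simp; ring
    rw [e4', e3', e2]
    unfold IsProfile.flux
    ring

/-! ### The mass coordinate of a single film -/

/-- The mass of the equilibrium to the left of `y`. -/
noncomputable def massFn (y : ℝ) : ℝ := (1 / 2) * ∫ s in (-1 : ℝ)..y, (1 - s ^ 2)

theorem massFn_eq (y : ℝ) : massFn y = (1 + y) ^ 2 * (2 - y) / 6 := by
  unfold massFn
  rw [intervalIntegral.integral_sub (by simp) ((continuous_pow 2).intervalIntegrable _ _)]
  simp only [intervalIntegral.integral_const, integral_pow, smul_eq_mul]
  ring

theorem two_thirds_sub_massFn (y : ℝ) : 2 / 3 - massFn y = (1 - y) ^ 2 * (2 + y) / 6 := by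
  rw [massFn_eq]; ring

theorem hasDerivAt_massFn (y : ℝ) : HasDerivAt massFn (parab y) y := by
  have : massFn = fun y => (1 + y) ^ 2 * (2 - y) / 6 := funext massFn_eq
  rw [this]
  have := ((((hasDerivAt_id y).const_add 1).pow 2).mul ((hasDerivAt_id y).const_sub 2)).div_const 6
  refine this.congr_deriv ?_
  simp only [parab, id, Pi.pow_apply]
  push_cast
  ring

theorem continuous_massFn : Continuous massFn :=
  continuous_iff_continuousAt.2 fun y => (hasDerivAt_massFn y).continuousAt

theorem massFn_pos {y : ℝ} (hy : y ∈ Ioo (-1 : ℝ) 1) : 0 < massFn y := by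
  rw [massFn_eq]
  have h1 : 0 < 1 + y := by linarith [hy.1]
  have h2 : 0 < 2 - y := by linarith [hy.2]
  positivity

theorem massFn_lt {y : ℝ} (hy : y ∈ Ioo (-1 : ℝ) 1) : massFn y < 2 / 3 := by
  rw [← sub_pos, two_thirds_sub_massFn]
  have h1 : 0 < 1 - y := by linarith [hy.2]
  have h2 : 0 < 2 + y := by linarith [hy.1]
  positivity

/-- Projection of the line to `[l, r]`. -/
noncomputable def clamp (l r x : ℝ) : ℝ := max l (min x r)

theorem clamp_mem {l r : ℝ} (h : l ≤ r) (x : ℝ) : clamp l r x ∈ Icc l r :=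
  ⟨le_max_left _ _, max_le h (min_le_right _ _)⟩

theorem clamp_of_mem {l r x : ℝ} (h : x ∈ Icc l r) : clamp l r x = x := by
  rw [clamp, min_eq_left h.2, max_eq_right h.1]

theorem continuous_clamp (l r : ℝ) : Continuous (clamp l r) := by unfold clamp; fun_prop

/-- Stability of solutions of monotone equations. -/
theorem tendsto_of_monotone_eq {ι : Type*} {L : Filter ι} {G : ι → ℝ → ℝ} {G₀ : ℝ → ℝ}
    {c ζ : ι → ℝ} {c₀ x₀ : ℝ} (hG : ∀ x, Tendsto (fun i => G i x) L (𝓝 (G₀ x)))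
    (hc : Tendsto c L (𝓝 c₀)) (hm : ∀ᶠ i in L, Monotone (G i)) (hζ : ∀ᶠ i in L, G i (ζ i) = c i)
    (hlo : ∀ x < x₀, G₀ x < c₀ ∨ ∀ᶠ i in L, x < ζ i)
    (hhi : ∀ x, x₀ < x → c₀ < G₀ x ∨ ∀ᶠ i in L, ζ i < x) : Tendsto ζ L (𝓝 x₀) := by
  refine tendsto_order.2 ⟨fun x hx => ?_, fun x hx => ?_⟩
  · rcases hlo x hx with h | h
    · filter_upwards [(hG x).eventually_lt hc h, hm, hζ] with i h1 h2 h3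
      rw [← h3] at h1
      exact h2.reflect_lt h1
    · exact h
  · rcases hhi x hx with h | h
    · filter_upwards [hc.eventually_lt (hG x) h, hm, hζ] with i h1 h2 h3
      rw [← h3] at h1
      exact h2.reflect_lt h1
    · exact h

/-- `Z` is the mass coordinate of the film `f` of mass `2/3` on `[l, r]`. -/
structure IsMassCoord (f : ℝ → ℝ) (l r : ℝ) (Z : ℝ → ℝ) : Prop where
  lt : l < r
  cont : ContinuousOn f (Icc l r)
  pos : ∀ x ∈ Ioo l r, 0 < f x
  left : f l = 0
  right : f r = 0
  total : ∫ s in l..r, f s = 2 / 3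
  mem : ∀ y ∈ Icc (-1 : ℝ) 1, Z y ∈ Icc l r
  mass : ∀ y ∈ Icc (-1 : ℝ) 1, ∫ s in l..(Z y), f s = massFn y

/-- The cumulative mass of the extension of `f` by its boundary values. -/
noncomputable def cumMass (f : ℝ → ℝ) (l r x : ℝ) : ℝ := ∫ s in l..x, f (clamp l r s)

/-! ### Regularity of the mass coordinate; two-sided bounds for the relative height -/

namespace IsMassCoord

variable {f : ℝ → ℝ} {l r : ℝ} {Z : ℝ → ℝ}

theorem continuous_ext (h : IsMassCoord f l r Z) : Continuous fun s => f (clamp l r s) :=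
  h.cont.comp_continuous (continuous_clamp l r) (clamp_mem h.lt.le)

theorem nonneg (h : IsMassCoord f l r Z) {x : ℝ} (hx : x ∈ Icc l r) : 0 ≤ f x := by
  rcases hx.1.eq_or_lt with rfl | h1
  · exact h.left.ge
  rcases hx.2.eq_or_lt with rfl | h2
  · exact h.right.ge
  exact (h.pos x ⟨h1, h2⟩).le

theorem cumMass_eq {x : ℝ} (hx : x ∈ Icc l r) : cumMass f l r x = ∫ s in l..x, f s := by
  refine intervalIntegral.integral_congr fun s hs => ?_
  rw [uIcc_of_le hx.1] at hs
  simp only [clamp_of_mem ⟨hs.1, hs.2.trans hx.2⟩]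

theorem hasDerivAt_cumMass (h : IsMassCoord f l r Z) (x : ℝ) :
    HasDerivAt (cumMass f l r) (f (clamp l r x)) x :=
  (h.continuous_ext.integral_hasStrictDerivAt l x).hasDerivAt

theorem continuous_cumMass (h : IsMassCoord f l r Z) : Continuous (cumMass f l r) :=
  continuous_iff_continuousAt.2 fun x => (h.hasDerivAt_cumMass x).continuousAt

theorem monotone_cumMass (h : IsMassCoord f l r Z) : Monotone (cumMass f l r) :=
  monotone_of_deriv_nonneg (fun x => (h.hasDerivAt_cumMass x).differentiableAt) fun x => by
    rw [(h.hasDerivAt_cumMass x).deriv]; exact h.nonneg (clamp_mem h.lt.le x)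

theorem strictMonoOn_cumMass (h : IsMassCoord f l r Z) : StrictMonoOn (cumMass f l r) (Icc l r) :=
  strictMonoOn_of_deriv_pos (convex_Icc l r) h.continuous_cumMass.continuousOn fun x hx => by
    rw [interior_Icc] at hx
    rw [(h.hasDerivAt_cumMass x).deriv, clamp_of_mem (Ioo_subset_Icc_self hx)]
    exact h.pos x hx

theorem cumMass_lt_of_lt (h : IsMassCoord f l r Z) {x x₀ : ℝ} (hx₀ : x₀ ∈ Ioc l r) (hx : x < x₀) :
    cumMass f l r x < cumMass f l r x₀ :=
  (h.monotone_cumMass (le_max_left x l)).trans_lt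
    (h.strictMonoOn_cumMass ⟨le_max_right _ _, max_le (hx.le.trans hx₀.2) h.lt.le⟩
      (Ioc_subset_Icc_self hx₀) (max_lt hx hx₀.1))

theorem lt_cumMass_of_lt (h : IsMassCoord f l r Z) {x x₀ : ℝ} (hx₀ : x₀ ∈ Ico l r) (hx : x₀ < x) :
    cumMass f l r x₀ < cumMass f l r x :=
  (h.strictMonoOn_cumMass (Ico_subset_Icc_self hx₀)
      ⟨le_min (hx₀.1.trans hx.le) h.lt.le, min_le_right _ _⟩ (lt_min hx hx₀.2)).trans_le
    (h.monotone_cumMass (min_le_left x r))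

theorem cumMass_apply (h : IsMassCoord f l r Z) {y : ℝ} (hy : y ∈ Icc (-1 : ℝ) 1) :
    cumMass f l r (Z y) = massFn y :=
  (cumMass_eq (h.mem y hy)).trans (h.mass y hy)

theorem cumMass_left : cumMass f l r l = 0 := intervalIntegral.integral_same

theorem cumMass_right (h : IsMassCoord f l r Z) : cumMass f l r r = 2 / 3 :=
  (cumMass_eq (right_mem_Icc.2 h.lt.le)).trans h.total

theorem mem_Ioo (h : IsMassCoord f l r Z) {y : ℝ} (hy : y ∈ Ioo (-1 : ℝ) 1) : Z y ∈ Ioo l r := by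
  have hy' := Ioo_subset_Icc_self hy
  have hZ := h.mem y hy'
  have hm := h.cumMass_apply hy'
  refine ⟨hZ.1.lt_of_ne fun e => ?_, hZ.2.lt_of_ne fun e => ?_⟩
  · rw [← e, cumMass_left] at hm
    exact (massFn_pos hy).ne hm
  · rw [e, h.cumMass_right] at hm
    exact (massFn_lt hy).ne hm.symm

theorem continuousAt (h : IsMassCoord f l r Z) {y : ℝ} (hy : y ∈ Ioo (-1 : ℝ) 1) :
    ContinuousAt Z y := by
  have hZ := h.mem_Ioo hy
  have hm := h.cumMass_apply (Ioo_subset_Icc_self hy)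
  refine tendsto_of_monotone_eq (G := fun _ => cumMass f l r) (c := massFn) (c₀ := massFn y)
    (fun _ => tendsto_const_nhds) (continuous_massFn.tendsto y)
    (Eventually.of_forall fun _ => h.monotone_cumMass) ?_ (fun x hx => .inl ?_)
    fun x hx => .inl ?_
  · filter_upwards [isOpen_Ioo.mem_nhds hy] with z hz using
      h.cumMass_apply (Ioo_subset_Icc_self hz)
  · rw [← hm]; exact h.cumMass_lt_of_lt (Ioo_subset_Ioc_self hZ) hx
  · rw [← hm]; exact h.lt_cumMass_of_lt (Ioo_subset_Ico_self hZ) hx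

theorem tendsto_left (h : IsMassCoord f l r Z) : Tendsto Z (𝓝[>] (-1)) (𝓝[>] l) := by
  have hmem : ∀ᶠ y in 𝓝[>] (-1 : ℝ), y ∈ Ioo (-1 : ℝ) 1 := Ioo_mem_nhdsGT (by norm_num)
  have hZ : ∀ᶠ y in 𝓝[>] (-1 : ℝ), l < Z y := by
    filter_upwards [hmem] with y hy using (h.mem_Ioo hy).1
  refine tendsto_nhdsWithin_iff.2 ⟨?_, hZ⟩
  refine tendsto_of_monotone_eq (G := fun _ => cumMass f l r) (c := massFn) (c₀ := massFn (-1))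
    (fun _ => tendsto_const_nhds) ((continuous_massFn.tendsto _).mono_left nhdsWithin_le_nhds)
    (Eventually.of_forall fun _ => h.monotone_cumMass) ?_ (fun x hx => .inr ?_)
    fun x hx => .inl ?_
  · filter_upwards [hmem] with z hz using h.cumMass_apply (Ioo_subset_Icc_self hz)
  -- To the left of `l` the cumulative mass is constant, so comparing masses gives nothing strict;
  -- `l < Z y` replaces it.
  · filter_upwards [hZ] with y hy using hx.trans hy
  · have := h.lt_cumMass_of_lt ⟨le_rfl, h.lt⟩ hx
    rw [cumMass_left] at this
    simpa [massFn_eq] using this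

theorem tendsto_right (h : IsMassCoord f l r Z) : Tendsto Z (𝓝[<] 1) (𝓝[<] r) := by
  have hmem : ∀ᶠ y in 𝓝[<] (1 : ℝ), y ∈ Ioo (-1 : ℝ) 1 := Ioo_mem_nhdsLT (by norm_num)
  have hZ : ∀ᶠ y in 𝓝[<] (1 : ℝ), Z y < r := by
    filter_upwards [hmem] with y hy using (h.mem_Ioo hy).2
  refine tendsto_nhdsWithin_iff.2 ⟨?_, hZ⟩
  refine tendsto_of_monotone_eq (G := fun _ => cumMass f l r) (c := massFn) (c₀ := massFn 1)
    (fun _ => tendsto_const_nhds) ((continuous_massFn.tendsto _).mono_left nhdsWithin_le_nhds)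
    (Eventually.of_forall fun _ => h.monotone_cumMass) ?_ (fun x hx => .inl ?_)
    fun x hx => .inr ?_
  · filter_upwards [hmem] with z hz using h.cumMass_apply (Ioo_subset_Icc_self hz)
  · have := h.cumMass_lt_of_lt ⟨h.lt, le_rfl⟩ hx
    rw [h.cumMass_right] at this
    rw [massFn_eq]
    linarith
  · filter_upwards [hZ] with y hy using hy.trans hx

theorem hasDerivAt (h : IsMassCoord f l r Z) {y : ℝ} (hy : y ∈ Ioo (-1 : ℝ) 1) :
    HasDerivAt Z (parab y / f (Z y)) y := by
  have hZ := h.mem_Ioo hy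
  have hd := h.hasDerivAt_cumMass (Z y)
  rw [clamp_of_mem (Ioo_subset_Icc_self hZ)] at hd
  refine HasDerivAt.of_comp_left (h.continuousAt hy) hd (hasDerivAt_massFn y) (h.pos _ hZ).ne' ?_
  filter_upwards [isOpen_Ioo.mem_nhds hy] with z hz using h.cumMass_apply (Ioo_subset_Icc_self hz)

/-- Bootstrap on the equation `Z' = w / f(Z)`, which raises the regularity of `Z` by one. -/
theorem contDiffOn (h : IsMassCoord f l r Z) {n : ℕ} (hf : ContDiffOn ℝ n f (Ioo l r)) :
    ContDiffOn ℝ n Z (Ioo (-1) 1) := by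
  induction n with
  | zero =>
    exact contDiffOn_zero.2 fun y hy => (h.continuousAt hy).continuousWithinAt
  | succ n ih =>
    have hfn : ContDiffOn ℝ n f (Ioo l r) := hf.of_le (by exact_mod_cast n.le_succ)
    have hp : ContDiffOn ℝ n parab (Ioo (-1) 1) := by
      unfold parab; fun_prop
    have key : ContDiffOn ℝ ((n : ℕ∞ω) + 1) Z (Ioo (-1) 1) :=
      (contDiffOn_succ_iff_deriv_of_isOpen (n := (n : ℕ∞ω)) isOpen_Ioo).2 ⟨fun y hy =>
        (h.hasDerivAt hy).differentiableAt.differentiableWithinAt,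
        fun hn => absurd hn (by simp),
        (hp.div (hfn.comp (ih hfn) fun y hy => h.mem_Ioo hy) fun y hy =>
          (h.pos _ (h.mem_Ioo hy)).ne').congr fun y hy => (h.hasDerivAt hy).deriv⟩
    exact_mod_cast key

/-- The height relative to the equilibrium, in the mass coordinate. -/
noncomputable def _root_.ThinFilm.relHeight (f Z : ℝ → ℝ) (y : ℝ) : ℝ := f (Z y) / parab y

theorem contDiffOn_relHeight (h : IsMassCoord f l r Z) {n : ℕ}
    (hf : ContDiffOn ℝ n f (Ioo l r)) : ContDiffOn ℝ n (relHeight f Z) (Ioo (-1) 1) := by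
  have hp : ContDiffOn ℝ n parab (Ioo (-1) 1) := by
    unfold parab; fun_prop
  exact (hf.comp (h.contDiffOn hf) fun y hy => h.mem_Ioo hy).div hp fun y hy => (parab_pos hy).ne'

theorem relHeight_pos (h : IsMassCoord f l r Z) {y : ℝ} (hy : y ∈ Ioo (-1 : ℝ) 1) :
    0 < relHeight f Z y :=
  div_pos (h.pos _ (h.mem_Ioo hy)) (parab_pos hy)

theorem relHeight_mul {y : ℝ} (hy : y ∈ Ioo (-1 : ℝ) 1) : relHeight f Z y * parab y = f (Z y) :=
  div_mul_cancel₀ _ (parab_pos hy).ne'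

/-- The chain rule `∂_y = a⁻¹ ∂_x`, as `Z' = w / f(Z) = 1 / a`. -/
theorem hasDerivAt_comp (h : IsMassCoord f l r Z) {g g' : ℝ → ℝ}
    (hg : ∀ x ∈ Ioo l r, HasDerivAt g (g' x) x) {y : ℝ} (hy : y ∈ Ioo (-1 : ℝ) 1) :
    HasDerivAt (fun y => g (Z y)) (g' (Z y) / relHeight f Z y) y := by
  refine ((hg _ (h.mem_Ioo hy)).comp y (h.hasDerivAt hy)).congr_deriv ?_
  rw [relHeight, div_div_eq_mul_div, mul_div_assoc]

theorem hasDerivAt_relHeight (h : IsMassCoord f l r Z) {g : ℝ → ℝ}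
    (hg : ∀ x ∈ Ioo l r, HasDerivAt f (g x) x) {y : ℝ} (hy : y ∈ Ioo (-1 : ℝ) 1) :
    HasDerivAt (relHeight f Z)
      ((g (Z y) / relHeight f Z y + y * relHeight f Z y) / parab y) y := by
  have hw := (parab_pos hy).ne'
  refine ((h.hasDerivAt_comp hg hy).div (hasDerivAt_parab y) hw).congr_deriv ?_
  have := (h.relHeight_pos hy).ne'
  rw [← relHeight_mul (f := f) (Z := Z) hy]
  field_simp
  ring

/-- Pointwise upper bound for the relative height by the slope. -/
theorem relHeight_sq_le (h : IsMassCoord f l r Z) {g : ℝ → ℝ} {G : ℝ}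
    (hg : ∀ x ∈ Ioo l r, HasDerivAt f (g x) x) (hG : ∀ x ∈ Ioo l r, |g x| ≤ G) {y : ℝ}
    (hy : y ∈ Ioo (-1 : ℝ) 1) : relHeight f Z y ^ 2 ≤ 4 * G := by
  have hZ := h.mem_Ioo hy
  have hm := h.cumMass_apply (Ioo_subset_Icc_self hy)
  have hG0 : 0 ≤ G := (abs_nonneg _).trans (hG _ hZ)
  have hder : ∀ x ∈ Ioo l r, HasDerivAt (fun x => cumMass f l r x) (f x) x := fun x hx => by
    have := h.hasDerivAt_cumMass x
    rwa [clamp_of_mem (Ioo_subset_Icc_self hx)] at this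
  have hcF := h.continuous_cumMass.continuousOn (s := Icc l r)
  -- From `|(f²)'| ≤ 2 G f`, the square `f²` is at most `2 G` times the mass between the point and
  -- either contact point. Both masses are known functions of `y`, and the one on the nearer side is
  -- at most `2 w²`.
  have mono : ∀ (σ : ℝ), σ ^ 2 = 1 →
      MonotoneOn (fun x => 2 * G * cumMass f l r x - σ * f x ^ 2) (Icc l r) := by
    intro σ hσ
    have hd : ∀ x ∈ Ioo l r, HasDerivAt (fun x => 2 * G * cumMass f l r x - σ * f x ^ 2)
        (2 * f x * (G - σ * g x)) x := fun x hx => by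
      refine (((hder x hx).const_mul (2 * G)).sub (((hg x hx).pow 2).const_mul σ)).congr_deriv ?_
      push_cast; ring
    refine monotoneOn_of_deriv_nonneg (convex_Icc l r)
      ((continuousOn_const.mul hcF).sub (continuousOn_const.mul (h.cont.pow 2))) ?_ ?_
    · rw [interior_Icc]
      exact fun x hx => (hd x hx).differentiableAt.differentiableWithinAt
    · rw [interior_Icc]
      intro x hx
      rw [(hd x hx).deriv]
      have h1 : σ * g x ≤ |g x| := by
        rw [← one_mul |g x|]
        have : |σ| = 1 := by rw [← sq_eq_sq₀ (abs_nonneg _) zero_le_one, sq_abs, hσ, one_pow]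
        rw [← this, ← abs_mul]; exact le_abs_self _
      exact mul_nonneg (by linarith [h.pos x hx]) (by linarith [hG x hx])
  have h1 := mono 1 (by norm_num) (left_mem_Icc.2 h.lt.le) (Ioo_subset_Icc_self hZ) hZ.1.le
  have h2 := mono (-1) (by norm_num) (Ioo_subset_Icc_self hZ) (right_mem_Icc.2 h.lt.le) hZ.2.le
  simp only [h.left, h.right, cumMass_left, h.cumMass_right, hm] at h1 h2
  rw [← relHeight_mul (f := f) (Z := Z) hy] at h1 h2
  have e2 := two_thirds_sub_massFn y
  have hw := parab_pos hy
  have key : parab y ^ 2 * relHeight f Z y ^ 2 ≤ parab y ^ 2 * (4 * G) := by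
    rcases le_total y 0 with h0 | h0
    · have : relHeight f Z y ^ 2 * parab y ^ 2 ≤ 2 * G * massFn y := by nlinarith
      have h3 : massFn y ≤ 2 * parab y ^ 2 := by
        rw [massFn_eq]
        have : 2 * parab y ^ 2 = (1 + y) ^ 2 * (1 - y) ^ 2 / 2 := by unfold parab; ring
        rw [this]
        have : (1 + y) ^ 2 * ((1 - y) ^ 2 / 2 - (2 - y) / 6) ≥ 0 :=
          mul_nonneg (sq_nonneg _) (by nlinarith)
        linarith
      nlinarith [mul_le_mul_of_nonneg_left h3 hG0]
    · have : relHeight f Z y ^ 2 * parab y ^ 2 ≤ 2 * G * (2 / 3 - massFn y) := by nlinarith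
      have h3 : 2 / 3 - massFn y ≤ 2 * parab y ^ 2 := by
        rw [e2]
        have : 2 * parab y ^ 2 = (1 - y) ^ 2 * (1 + y) ^ 2 / 2 := by unfold parab; ring
        rw [this]
        have : (1 - y) ^ 2 * ((1 + y) ^ 2 / 2 - (2 + y) / 6) ≥ 0 :=
          mul_nonneg (sq_nonneg _) (by nlinarith)
        linarith
      nlinarith [mul_le_mul_of_nonneg_left h3 hG0]
  exact le_of_mul_le_mul_left key (by positivity)

/-- Lower bound for the relative height, from the slope near the contact points and the height
away from them. -/
theorem le_relHeight (h : IsMassCoord f l r Z) {g : ℝ → ℝ} {δ κ : ℝ}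
    (hg : ∀ x ∈ Ioo l r, HasDerivAt f (g x) x)
    (hl : ∀ x ∈ Ioo l r, x ≤ l + δ → 1 / 2 ≤ g x) (hr : ∀ x ∈ Ioo l r, r - δ ≤ x → g x ≤ -(1 / 2))
    (hκ : ∀ x ∈ Ioo l r, l + δ ≤ x → x ≤ r - δ → κ ≤ f x) {y : ℝ}
    (hy : y ∈ Ioo (-1 : ℝ) 1) : min (2 * κ) (1 / 3) ≤ relHeight f Z y := by
  have hZ := h.mem_Ioo hy
  have hZ' := Ioo_subset_Icc_self hZ
  have hm := h.cumMass_apply (Ioo_subset_Icc_self hy)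
  have hpos := h.relHeight_pos hy
  have hw := parab_pos hy
  have e2 := two_thirds_sub_massFn y
  -- Where the slope is at least `1/2`, `(f²)' ≥ f`, so `f²` exceeds the mass on the left, which is
  -- at least `(1 + y)² / 6`. The right end is symmetric.
  have hder : ∀ x ∈ Ioo l r, HasDerivAt (fun x => f x ^ 2 - cumMass f l r x)
      (f x * (2 * g x - 1)) x := fun x hx => by
    have := h.hasDerivAt_cumMass x
    rw [clamp_of_mem (Ioo_subset_Icc_self hx)] at this
    refine (((hg x hx).pow 2).sub this).congr_deriv ?_
    push_cast; ring
  have hder' : ∀ x ∈ Ioo l r, HasDerivAt (fun x => f x ^ 2 + cumMass f l r x)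
      (f x * (2 * g x + 1)) x := fun x hx => by
    have := h.hasDerivAt_cumMass x
    rw [clamp_of_mem (Ioo_subset_Icc_self hx)] at this
    refine (((hg x hx).pow 2).add this).congr_deriv ?_
    push_cast; ring
  have third : ∀ q : ℝ, q ^ 2 / 6 ≤ f (Z y) ^ 2 → parab y ≤ q → 1 / 3 ≤ relHeight f Z y := by
    intro q hq hpq
    rw [← relHeight_mul (f := f) (Z := Z) hy, mul_pow] at hq
    have h1 : parab y ^ 2 ≤ q ^ 2 := pow_le_pow_left₀ hw.le hpq 2
    have h2 : parab y ^ 2 * (1 / 6) ≤ parab y ^ 2 * relHeight f Z y ^ 2 := by linarith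
    have h3 := le_of_mul_le_mul_left h2 (by positivity)
    nlinarith
  rcases le_total (Z y) (l + δ) with h1 | h1
  · refine (min_le_right _ _).trans (third (1 + y) ?_ (by unfold parab; nlinarith [hy.1, hy.2]))
    have hmono : MonotoneOn (fun x => f x ^ 2 - cumMass f l r x) (Icc l (Z y)) := by
      refine monotoneOn_of_deriv_nonneg (convex_Icc _ _) (((h.cont.pow 2).sub
        h.continuous_cumMass.continuousOn).mono (Icc_subset_Icc_right hZ'.2)) ?_ ?_
      · rw [interior_Icc]
        exact fun x hx => (hder x ⟨hx.1, hx.2.trans hZ.2⟩).differentiableAt.differentiableWithinAt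
      · rw [interior_Icc]
        intro x hx
        have hx' : x ∈ Ioo l r := ⟨hx.1, hx.2.trans hZ.2⟩
        rw [(hder x hx').deriv]
        exact mul_nonneg (h.pos x hx').le (by linarith [hl x hx' (hx.2.le.trans h1)])
    have := hmono (left_mem_Icc.2 hZ'.1) (right_mem_Icc.2 hZ'.1) hZ'.1
    simp only [h.left, cumMass_left, hm, massFn_eq] at this
    nlinarith [sq_nonneg (1 + y), mul_nonneg (sq_nonneg (1 + y)) (sub_nonneg.2 hy.2.le)]
  rcases le_total (r - δ) (Z y) with h2 | h2
  · refine (min_le_right _ _).trans (third (1 - y) ?_ (by unfold parab; nlinarith [hy.1, hy.2]))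
    have hmono : AntitoneOn (fun x => f x ^ 2 + cumMass f l r x) (Icc (Z y) r) := by
      refine antitoneOn_of_deriv_nonpos (convex_Icc _ _) (((h.cont.pow 2).add
        h.continuous_cumMass.continuousOn).mono (Icc_subset_Icc_left hZ'.1)) ?_ ?_
      · rw [interior_Icc]
        exact fun x hx => (hder' x ⟨hZ.1.trans hx.1, hx.2⟩).differentiableAt.differentiableWithinAt
      · rw [interior_Icc]
        intro x hx
        have hx' : x ∈ Ioo l r := ⟨hZ.1.trans hx.1, hx.2⟩
        rw [(hder' x hx').deriv]
        exact mul_nonpos_of_nonneg_of_nonpos (h.pos x hx').le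
          (by linarith [hr x hx' (h2.trans hx.1.le)])
    have := hmono (left_mem_Icc.2 hZ'.2) (right_mem_Icc.2 hZ'.2) hZ'.2
    simp only [h.right, h.cumMass_right, hm] at this
    nlinarith [sq_nonneg (1 - y), mul_nonneg (sq_nonneg (1 - y)) (by linarith [hy.1] : 0 ≤ 1 + y)]
  · refine (min_le_left _ _).trans ?_
    have h3 := hκ _ hZ h1 h2
    rw [← relHeight_mul (f := f) (Z := Z) hy] at h3
    nlinarith [parab_le y, mul_le_mul_of_nonneg_left (parab_le y) hpos.le]

end IsMassCoord

/-! ### Space-time regularity of solutions -/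

/-- The `k`-th space derivative of `u`, up to the contact points. -/
noncomputable def dx (u : ℝ → ℝ → ℝ) (lm lp : ℝ → ℝ) (k : ℕ) (t x : ℝ) : ℝ :=
  iteratedDerivWithin k (u t) (Icc (lm t) (lp t)) x

/-- The time derivative of the `k`-th space derivative of `u`, up to the contact points. -/
noncomputable def dtdx (u : ℝ → ℝ → ℝ) (lm lp : ℝ → ℝ) (k : ℕ) (p : ℝ × ℝ) : ℝ :=
  fderivWithin ℝ (Function.uncurry (dx u lm lp k)) (wetRegion (Ioi 0) lm lp) p (1, 0)

namespace IsGlobalSmoothSolution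

variable {u : ℝ → ℝ → ℝ} {lm lp : ℝ → ℝ}

theorem hasDerivAt_left (h : IsGlobalSmoothSolution u lm lp) {t : ℝ} (ht : 0 < t) :
    HasDerivAt lm (deriv lm t) t :=
  ((h.smooth_left.differentiableOn (by simp) t ht).differentiableAt
    (Ioi_mem_nhds ht)).hasDerivAt

theorem hasDerivAt_right (h : IsGlobalSmoothSolution u lm lp) {t : ℝ} (ht : 0 < t) :
    HasDerivAt lp (deriv lp t) t :=
  ((h.smooth_right.differentiableOn (by simp) t ht).differentiableAt
    (Ioi_mem_nhds ht)).hasDerivAt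

theorem isOpen_interior_wetRegion (h : IsGlobalSmoothSolution u lm lp) :
    IsOpen {p : ℝ × ℝ | 0 < p.1 ∧ p.2 ∈ Ioo (lm p.1) (lp p.1)} := by
  have hO : IsOpen {p : ℝ × ℝ | 0 < p.1} := isOpen_lt continuous_const continuous_fst
  have h1 : ContinuousOn (fun p : ℝ × ℝ => p.2 - lm p.1) {p : ℝ × ℝ | 0 < p.1} :=
    continuousOn_snd.sub (h.smooth_left.continuousOn.comp continuousOn_fst fun p hp => hp)
  have h2 : ContinuousOn (fun p : ℝ × ℝ => lp p.1 - p.2) {p : ℝ × ℝ | 0 < p.1} :=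
    (h.smooth_right.continuousOn.comp continuousOn_fst fun p hp => hp).sub continuousOn_snd
  convert (h1.isOpen_inter_preimage hO isOpen_Ioi (t := Ioi 0)).inter
    (h2.isOpen_inter_preimage hO isOpen_Ioi (t := Ioi 0)) using 1
  ext p
  simp only [mem_ofPred_eq, mem_Ioo, mem_inter_iff, mem_preimage, mem_Ioi, sub_pos]
  tauto

theorem wetRegion_mem_nhds (h : IsGlobalSmoothSolution u lm lp) {t x : ℝ} (ht : 0 < t)
    (hx : x ∈ Ioo (lm t) (lp t)) : wetRegion (Ioi 0) lm lp ∈ 𝓝 (t, x) := by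
  refine mem_of_superset (h.isOpen_interior_wetRegion.mem_nhds ⟨ht, hx⟩) fun p hp => ?_
  exact ⟨hp.1, Ioo_subset_Icc_self hp.2⟩

/-- The region is the image of a fixed strip under a map with surjective differential, obtained by
affine interpolation between the contact points. -/
theorem uniqueDiffOn_wetRegion (h : IsGlobalSmoothSolution u lm lp) :
    UniqueDiffOn ℝ (wetRegion (Ioi 0) lm lp) := by
  have hS : UniqueDiffOn ℝ (Ioi (0 : ℝ) ×ˢ Icc (0 : ℝ) 1) :=
    (uniqueDiffOn_Ioi 0).prod (uniqueDiffOn_Icc zero_lt_one)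
  have himg : wetRegion (Ioi 0) lm lp = (fun p : ℝ × ℝ => (p.1, lm p.1 + p.2 * (lp p.1 - lm p.1))) ''
      (Ioi (0 : ℝ) ×ˢ Icc (0 : ℝ) 1) := by
    ext ⟨t, x⟩
    simp only [wetRegion, mem_ofPred_eq, mem_image, mem_prod, Prod.exists, Prod.mk.injEq]
    constructor
    · rintro ⟨ht, hx⟩
      have hL : 0 < lp t - lm t := sub_pos.2 (h.lt t (le_of_lt ht))
      refine ⟨t, (x - lm t) / (lp t - lm t), ⟨ht, div_nonneg (by linarith [hx.1]) hL.le, ?_⟩, rfl, ?_⟩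
      · rw [div_le_one hL]; linarith [hx.2]
      · field_simp; ring
    · rintro ⟨t', s, ⟨ht, hs⟩, rfl, rfl⟩
      have hL : 0 < lp t' - lm t' := sub_pos.2 (h.lt t' (le_of_lt ht))
      exact ⟨ht, by nlinarith [hs.1], by nlinarith [hs.2]⟩
  rw [himg]
  refine hS.image (f' := fun p => (ContinuousLinearMap.fst ℝ ℝ ℝ).prod
    ((deriv lm p.1 + p.2 * (deriv lp p.1 - deriv lm p.1)) • ContinuousLinearMap.fst ℝ ℝ ℝ
      + (lp p.1 - lm p.1) • ContinuousLinearMap.snd ℝ ℝ ℝ)) ?_ ?_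
  · rintro ⟨t, s⟩ ⟨ht, -⟩
    have h1 : HasFDerivAt (fun p : ℝ × ℝ => lm p.1) (deriv lm t • ContinuousLinearMap.fst ℝ ℝ ℝ)
        (t, s) := (h.hasDerivAt_left ht).comp_hasFDerivAt (t, s) hasFDerivAt_fst
    have h2 : HasFDerivAt (fun p : ℝ × ℝ => lp p.1) (deriv lp t • ContinuousLinearMap.fst ℝ ℝ ℝ)
        (t, s) := (h.hasDerivAt_right ht).comp_hasFDerivAt (t, s) hasFDerivAt_fst
    have h3 := h1.add ((hasFDerivAt_snd (𝕜 := ℝ) (p := (t, s))).mul (h2.sub h1))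
    refine HasFDerivAt.hasFDerivWithinAt (HasFDerivAt.prodMk hasFDerivAt_fst (h3.congr_fderiv ?_))
    ext <;> simp
  · rintro ⟨t, s⟩ ⟨ht, -⟩
    refine Function.Surjective.denseRange fun q => ?_
    have hL : lp t - lm t ≠ 0 := (sub_pos.2 (h.lt t (le_of_lt ht))).ne'
    refine ⟨(q.1, (q.2 - (deriv lm t + s * (deriv lp t - deriv lm t)) * q.1) / (lp t - lm t)), ?_⟩
    ext
    · simp
    · simp only [ContinuousLinearMap.prod_apply, _root_.add_apply,
        _root_.smul_apply, ContinuousLinearMap.coe_fst',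
        ContinuousLinearMap.coe_snd', smul_eq_mul]
      field_simp
      ring

theorem hasDerivWithinAt_slice {F : ℝ → ℝ → ℝ}
    (hF : DifferentiableOn ℝ (Function.uncurry F) (wetRegion (Ioi 0) lm lp)) {t x : ℝ}
    (ht : 0 < t) (hx : x ∈ Icc (lm t) (lp t)) :
    HasDerivWithinAt (F t) (fderivWithin ℝ (Function.uncurry F) (wetRegion (Ioi 0) lm lp)
      (t, x) (0, 1)) (Icc (lm t) (lp t)) x := by
  have h1 := (hF (t, x) ⟨ht, hx⟩).hasFDerivWithinAt
  have h2 : HasDerivWithinAt (fun z : ℝ => (t, z)) ((0 : ℝ), (1 : ℝ)) (Icc (lm t) (lp t)) x :=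
    ((hasDerivAt_const x t).prodMk (hasDerivAt_id x)).hasDerivWithinAt
  exact h1.comp_hasDerivWithinAt x h2 fun z hz => ⟨ht, hz⟩

theorem dx_succ_eq (h : IsGlobalSmoothSolution u lm lp) {k : ℕ}
    (hF : DifferentiableOn ℝ (Function.uncurry (dx u lm lp k)) (wetRegion (Ioi 0) lm lp))
    {t x : ℝ} (ht : 0 < t) (hx : x ∈ Icc (lm t) (lp t)) :
    dx u lm lp (k + 1) t x = fderivWithin ℝ (Function.uncurry (dx u lm lp k))
      (wetRegion (Ioi 0) lm lp) (t, x) (0, 1) := by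
  rw [dx, iteratedDerivWithin_succ]
  exact (hasDerivWithinAt_slice hF ht hx).derivWithin (uniqueDiffOn_Icc (h.lt t ht.le) x hx)

theorem contDiffOn_dx (h : IsGlobalSmoothSolution u lm lp) (k : ℕ) :
    ContDiffOn ℝ ∞ (Function.uncurry (dx u lm lp k)) (wetRegion (Ioi 0) lm lp) := by
  induction k with
  | zero =>
    refine h.smooth.congr fun p _ => ?_
    simp [Function.uncurry, dx]
  | succ k ih =>
    have h1 := ih.fderivWithin h.uniqueDiffOn_wetRegion (m := ∞) (by simp)
    refine (h1.clm_apply (contDiffOn_const (c := ((0 : ℝ), (1 : ℝ))))).congr fun p hp => ?_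
    exact h.dx_succ_eq (ih.differentiableOn (by simp)) hp.1 hp.2

theorem continuousOn_dx (h : IsGlobalSmoothSolution u lm lp) (k : ℕ) :
    ContinuousOn (Function.uncurry (dx u lm lp k)) (wetRegion (Ioi 0) lm lp) :=
  (h.contDiffOn_dx k).continuousOn

theorem continuousOn_dx_slice (h : IsGlobalSmoothSolution u lm lp) (k : ℕ) {t : ℝ} (ht : 0 < t) :
    ContinuousOn (dx u lm lp k t) (Icc (lm t) (lp t)) :=
  (h.continuousOn_dx k).comp (f := fun x => (t, x)) (by fun_prop) fun _ hx => ⟨ht, hx⟩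

theorem continuousOn_dtdx (h : IsGlobalSmoothSolution u lm lp) (k : ℕ) :
    ContinuousOn (dtdx u lm lp k) (wetRegion (Ioi 0) lm lp) :=
  ((h.contDiffOn_dx k).continuousOn_fderivWithin h.uniqueDiffOn_wetRegion (by simp)).clm_apply
    continuousOn_const

theorem hasDerivWithinAt_dx (h : IsGlobalSmoothSolution u lm lp) (k : ℕ) {t x : ℝ}
    (ht : 0 < t) (hx : x ∈ Icc (lm t) (lp t)) :
    HasDerivWithinAt (dx u lm lp k t) (dx u lm lp (k + 1) t x) (Icc (lm t) (lp t)) x := by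
  have hd := (h.contDiffOn_dx k).differentiableOn (by simp)
  rw [h.dx_succ_eq hd ht hx]
  exact hasDerivWithinAt_slice hd ht hx

theorem hasDerivAt_dx (h : IsGlobalSmoothSolution u lm lp) (k : ℕ) {t x : ℝ}
    (ht : 0 < t) (hx : x ∈ Ioo (lm t) (lp t)) :
    HasDerivAt (dx u lm lp k t) (dx u lm lp (k + 1) t x) x :=
  (h.hasDerivWithinAt_dx k ht (Ioo_subset_Icc_self hx)).hasDerivAt (Icc_mem_nhds hx.1 hx.2)

/-- Chain rule along curves in the closed wetted region. -/
theorem hasDerivAt_dx_curve (h : IsGlobalSmoothSolution u lm lp) (k : ℕ) {t x' : ℝ} {x : ℝ → ℝ}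
    (ht : 0 < t) (hx : HasDerivAt x x' t) (hmem : ∀ s, 0 < s → x s ∈ Icc (lm s) (lp s)) :
    HasDerivAt (fun s => dx u lm lp k s (x s))
      (dtdx u lm lp k (t, x t) + x' * dx u lm lp (k + 1) t (x t)) t := by
  have hd := (h.contDiffOn_dx k).differentiableOn (by simp)
  have h1 := (hd (t, x t) ⟨ht, hmem t ht⟩).hasFDerivWithinAt
  have h2 : HasDerivAt (fun s : ℝ => (s, x s)) ((1 : ℝ), x') t := (hasDerivAt_id t).prodMk hx
  have h3 := h1.comp_hasDerivAt t h2 (by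
    filter_upwards [Ioi_mem_nhds ht] with s hs using ⟨hs, hmem s hs⟩)
  refine h3.congr_deriv ?_
  have : ((1 : ℝ), x') = (1, 0) + x' • ((0 : ℝ), (1 : ℝ)) := by simp
  rw [this, map_add, map_smul, ← h.dx_succ_eq hd ht (hmem t ht), smul_eq_mul, dtdx]

theorem dx_zero (t x : ℝ) : dx u lm lp 0 t x = u t x := by simp [dx]

theorem dx_eq_iteratedDeriv (k : ℕ) {t x : ℝ}
    (hx : x ∈ Ioo (lm t) (lp t)) : dx u lm lp k t x = iteratedDeriv k (u t) x := by
  rw [dx, ← iteratedDerivWithin_univ, iteratedDerivWithin, iteratedDerivWithin,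
    iteratedFDerivWithin_congr_set (eventuallyEq_univ.2 (Icc_mem_nhds hx.1 hx.2))]

/-- The time derivative at fixed position inside the film. -/
theorem hasDerivAt_dx_time (h : IsGlobalSmoothSolution u lm lp) (k : ℕ) {t x : ℝ}
    (ht : 0 < t) (hx : x ∈ Ioo (lm t) (lp t)) :
    HasDerivAt (fun s => dx u lm lp k s x) (dtdx u lm lp k (t, x)) t := by
  have hd := (h.contDiffOn_dx k).differentiableOn (by simp)
  have h1 := (hd (t, x) ⟨ht, Ioo_subset_Icc_self hx⟩).hasFDerivWithinAt
  have h2 : HasDerivAt (fun s : ℝ => (s, x)) ((1 : ℝ), (0 : ℝ)) t :=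
    (hasDerivAt_id t).prodMk (hasDerivAt_const t x)
  exact h1.comp_hasDerivAt t h2 (h2.continuousAt.eventually_mem (h.wetRegion_mem_nhds ht hx))

theorem dtdx_zero_interior (h : IsGlobalSmoothSolution u lm lp) {t x : ℝ}
    (ht : 0 < t) (hx : x ∈ Ioo (lm t) (lp t)) :
    dtdx u lm lp 0 (t, x) = -(dx u lm lp 1 t x * dx u lm lp 3 t x
      + dx u lm lp 0 t x * dx u lm lp 4 t x) := by
  have h1 : deriv (fun s => u s x) t = dtdx u lm lp 0 (t, x) := by
    have := (h.hasDerivAt_dx_time 0 ht hx).deriv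
    simpa only [dx_zero] using this
  have h2 : HasDerivAt (fun z => u t z * iteratedDeriv 3 (u t) z)
      (dx u lm lp 1 t x * dx u lm lp 3 t x + dx u lm lp 0 t x * dx u lm lp 4 t x) x := by
    refine ((h.hasDerivAt_dx 0 ht hx).mul (h.hasDerivAt_dx 3 ht hx)).congr_of_eventuallyEq ?_
    filter_upwards [isOpen_Ioo.mem_nhds hx] with z hz
    simp only [Pi.mul_apply, dx_zero, dx_eq_iteratedDeriv 3 hz]
  have := h.equation t ht x hx
  rw [h1, h2.deriv] at this
  linarith

/-- By continuity, the equation and its space derivative remain valid at the contact points, where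
they determine `u_xxxx`. -/
theorem eq_of_eq_interior (h : IsGlobalSmoothSolution u lm lp) {F G : ℝ × ℝ → ℝ}
    (hF : ContinuousOn F (wetRegion (Ioi 0) lm lp)) (hG : ContinuousOn G (wetRegion (Ioi 0) lm lp))
    {t : ℝ} (ht : 0 < t) (heq : ∀ x ∈ Ioo (lm t) (lp t), F (t, x) = G (t, x)) {x : ℝ}
    (hx : x ∈ Icc (lm t) (lp t)) : F (t, x) = G (t, x) := by
  have hs : ∀ {H : ℝ × ℝ → ℝ}, ContinuousOn H (wetRegion (Ioi 0) lm lp) →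
      ContinuousOn (fun x => H (t, x)) (Icc (lm t) (lp t)) := fun hH =>
    hH.comp (f := fun x => (t, x)) (by fun_prop) fun _ hx => ⟨ht, hx⟩
  exact EqOn.of_subset_closure (s := Ioo (lm t) (lp t)) heq (hs hF) (hs hG) Ioo_subset_Icc_self
    (closure_Ioo (h.lt t ht.le).ne).ge hx

theorem dtdx_zero (h : IsGlobalSmoothSolution u lm lp) {t x : ℝ}
    (ht : 0 < t) (hx : x ∈ Icc (lm t) (lp t)) :
    dtdx u lm lp 0 (t, x) = -(dx u lm lp 1 t x * dx u lm lp 3 t x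
      + dx u lm lp 0 t x * dx u lm lp 4 t x) :=
  h.eq_of_eq_interior (G := fun p => -(Function.uncurry (dx u lm lp 1) p *
      Function.uncurry (dx u lm lp 3) p + Function.uncurry (dx u lm lp 0) p *
      Function.uncurry (dx u lm lp 4) p)) (h.continuousOn_dtdx 0)
    (((h.continuousOn_dx 1).mul (h.continuousOn_dx 3)).add
      ((h.continuousOn_dx 0).mul (h.continuousOn_dx 4))).neg ht
    (fun _ hx => h.dtdx_zero_interior ht hx) hx

/-- Symmetry of the second derivative gives `(u_x)_t = (u_t)_x`, after which the equation is
differentiated in `x`. -/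
theorem dtdx_one_interior (h : IsGlobalSmoothSolution u lm lp) {t x : ℝ}
    (ht : 0 < t) (hx : x ∈ Ioo (lm t) (lp t)) :
    dtdx u lm lp 1 (t, x) = -(dx u lm lp 2 t x * dx u lm lp 3 t x
      + 2 * dx u lm lp 1 t x * dx u lm lp 4 t x + dx u lm lp 0 t x * dx u lm lp 5 t x) := by
  have hW := h.wetRegion_mem_nhds ht hx
  have hO := h.isOpen_interior_wetRegion.mem_nhds (show (t, x) ∈ _ from ⟨ht, hx⟩)
  set f := Function.uncurry (dx u lm lp 0) with hf
  have hfc : ContDiffAt ℝ 2 f (t, x) := ((h.contDiffOn_dx 0).contDiffAt hW).of_le ENat.LEInfty.out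
  have hsymm := hfc.isSymmSndFDerivAt (by simp)
  have hfd : DifferentiableAt ℝ (fderiv ℝ f) (t, x) :=
    (hfc.fderiv_right (m := 1) (by norm_num)).differentiableAt (by norm_num)
  have hdir : ∀ v : ℝ × ℝ, HasFDerivAt (fun q => fderiv ℝ f q v)
      ((fderiv ℝ (fderiv ℝ f) (t, x)).flip v) (t, x) := fun v => by
    refine (hfd.hasFDerivAt.clm_apply (hasFDerivAt_const v (t, x))).congr_fderiv ?_
    ext <;> simp
  have e1 : Function.uncurry (dx u lm lp 1) =ᶠ[𝓝 (t, x)] fun q => fderiv ℝ f q (0, 1) := by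
    filter_upwards [hO] with q hq
    rw [Function.uncurry, h.dx_succ_eq ((h.contDiffOn_dx 0).differentiableOn (by simp)) hq.1
      (Ioo_subset_Icc_self hq.2), fderivWithin_of_mem_nhds (h.wetRegion_mem_nhds hq.1 hq.2)]
  have e2 : (fun q : ℝ × ℝ => -(dx u lm lp 1 q.1 q.2 * dx u lm lp 3 q.1 q.2
      + dx u lm lp 0 q.1 q.2 * dx u lm lp 4 q.1 q.2)) =ᶠ[𝓝 (t, x)]
      fun q => fderiv ℝ f q (1, 0) := by
    filter_upwards [hO] with q hq
    rw [← h.dtdx_zero_interior hq.1 hq.2, dtdx,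
      fderivWithin_of_mem_nhds (h.wetRegion_mem_nhds hq.1 hq.2)]
  have d1 : dtdx u lm lp 1 (t, x) = fderiv ℝ (fderiv ℝ f) (t, x) (1, 0) (0, 1) := by
    rw [dtdx, fderivWithin_of_mem_nhds hW, e1.fderiv_eq, (hdir (0, 1)).fderiv,
      ContinuousLinearMap.flip_apply]
  have d2 : HasDerivAt (fun z => -(dx u lm lp 1 t z * dx u lm lp 3 t z
      + dx u lm lp 0 t z * dx u lm lp 4 t z))
      (fderiv ℝ (fderiv ℝ f) (t, x) (0, 1) (1, 0)) x := by
    have h2 : HasDerivAt (fun z : ℝ => (t, z)) ((0 : ℝ), (1 : ℝ)) x :=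
      (hasDerivAt_const x t).prodMk (hasDerivAt_id x)
    exact ((hdir (1, 0)).congr_of_eventuallyEq e2).comp_hasDerivAt x h2
  have d3 := (((h.hasDerivAt_dx 1 ht hx).mul (h.hasDerivAt_dx 3 ht hx)).add
    ((h.hasDerivAt_dx 0 ht hx).mul (h.hasDerivAt_dx 4 ht hx))).neg
  rw [d1, hsymm (1, 0) (0, 1), d2.unique d3]
  ring

theorem dtdx_one (h : IsGlobalSmoothSolution u lm lp) {t x : ℝ}
    (ht : 0 < t) (hx : x ∈ Icc (lm t) (lp t)) :
    dtdx u lm lp 1 (t, x) = -(dx u lm lp 2 t x * dx u lm lp 3 t x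
      + 2 * dx u lm lp 1 t x * dx u lm lp 4 t x + dx u lm lp 0 t x * dx u lm lp 5 t x) :=
  h.eq_of_eq_interior (G := fun p => -(Function.uncurry (dx u lm lp 2) p *
      Function.uncurry (dx u lm lp 3) p + 2 * Function.uncurry (dx u lm lp 1) p *
      Function.uncurry (dx u lm lp 4) p + Function.uncurry (dx u lm lp 0) p *
      Function.uncurry (dx u lm lp 5) p)) (h.continuousOn_dtdx 1)
    ((((h.continuousOn_dx 2).mul (h.continuousOn_dx 3)).add
      ((continuousOn_const.mul (h.continuousOn_dx 1)).mul (h.continuousOn_dx 4))).add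
      ((h.continuousOn_dx 0).mul (h.continuousOn_dx 5))).neg ht
    (fun _ hx => h.dtdx_one_interior ht hx) hx

/-! ### Single times, including the initial one -/

theorem contDiffOn_slice (h : IsGlobalSmoothSolution u lm lp) {t : ℝ} (ht : 0 < t) :
    ContDiffOn ℝ ∞ (u t) (Icc (lm t) (lp t)) :=
  h.smooth.comp (f := fun x => (t, x)) (by fun_prop) fun _ hx => ⟨ht, hx⟩

theorem contDiffOn_two (h : IsGlobalSmoothSolution u lm lp) {t : ℝ} (ht : 0 ≤ t) :
    ContDiffOn ℝ 2 (u t) (Icc (lm t) (lp t)) := by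
  rcases ht.eq_or_lt with rfl | ht
  · exact h.contDiffOn_zero
  · exact (h.contDiffOn_slice ht).of_le ENat.LEInfty.out

theorem hasDerivWithinAt_dx_of_lt_two (h : IsGlobalSmoothSolution u lm lp) {k : ℕ} (hk : k < 2)
    {t x : ℝ} (ht : 0 ≤ t) (hx : x ∈ Icc (lm t) (lp t)) :
    HasDerivWithinAt (dx u lm lp k t) (dx u lm lp (k + 1) t x) (Icc (lm t) (lp t)) x := by
  have h1 := (h.contDiffOn_two ht).differentiableOn_iteratedDerivWithin (m := k)
    (by exact_mod_cast hk) (uniqueDiffOn_Icc (h.lt t ht)) x hx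
  simp only [dx, iteratedDerivWithin_succ]
  exact h1.hasDerivWithinAt

theorem hasDerivAt_dx_of_lt_two (h : IsGlobalSmoothSolution u lm lp) {k : ℕ} (hk : k < 2)
    {t x : ℝ} (ht : 0 ≤ t) (hx : x ∈ Ioo (lm t) (lp t)) :
    HasDerivAt (dx u lm lp k t) (dx u lm lp (k + 1) t x) x :=
  (h.hasDerivWithinAt_dx_of_lt_two hk ht (Ioo_subset_Icc_self hx)).hasDerivAt
    (Icc_mem_nhds hx.1 hx.2)

theorem nonneg (h : IsGlobalSmoothSolution u lm lp) {t x : ℝ} (ht : 0 ≤ t)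
    (hx : x ∈ Icc (lm t) (lp t)) : 0 ≤ u t x := by
  rcases hx.1.eq_or_lt with rfl | h1
  · exact (h.height_left t ht).ge
  rcases hx.2.eq_or_lt with rfl | h2
  · exact (h.height_right t ht).ge
  exact (h.pos t ht x ⟨h1, h2⟩).le

/-- The sign of the slope comes from nonnegativity of the height and its vanishing at the contact
point. -/
theorem dx_one_left (h : IsGlobalSmoothSolution u lm lp) {t : ℝ} (ht : 0 ≤ t) :
    dx u lm lp 1 t (lm t) = 1 := by
  have hlt := h.lt t ht
  have hd := h.hasDerivWithinAt_dx_of_lt_two (k := 0) (by norm_num) ht (left_mem_Icc.2 hlt.le)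
  have habs := h.slope_left t ht
  rw [← iteratedDerivWithin_one] at habs
  have h0 : 0 ≤ dx u lm lp 1 t (lm t) := by
    have := hasDerivWithinAt_iff_tendsto_slope.1 hd
    rw [Icc_sdiff_left, nhdsWithin_Ioc_eq_nhdsGT hlt] at this
    refine ge_of_tendsto this ?_
    filter_upwards [Ioo_mem_nhdsGT hlt] with x hx
    rw [slope_def_field, dx_zero, dx_zero, h.height_left t ht, sub_zero]
    exact div_nonneg (h.nonneg ht (Ioo_subset_Icc_self hx)) (by linarith [hx.1])
  rwa [← dx, abs_of_nonneg h0] at habs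

theorem dx_one_right (h : IsGlobalSmoothSolution u lm lp) {t : ℝ} (ht : 0 ≤ t) :
    dx u lm lp 1 t (lp t) = -1 := by
  have hlt := h.lt t ht
  have hd := h.hasDerivWithinAt_dx_of_lt_two (k := 0) (by norm_num) ht (right_mem_Icc.2 hlt.le)
  have habs := h.slope_right t ht
  rw [← iteratedDerivWithin_one] at habs
  have h0 : dx u lm lp 1 t (lp t) ≤ 0 := by
    have := hasDerivWithinAt_iff_tendsto_slope.1 hd
    rw [Icc_sdiff_right, nhdsWithin_Ico_eq_nhdsLT hlt] at this
    refine le_of_tendsto this ?_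
    filter_upwards [Ioo_mem_nhdsLT hlt] with x hx
    rw [slope_def_field, dx_zero, dx_zero, h.height_right t ht, sub_zero]
    exact div_nonpos_of_nonneg_of_nonpos (h.nonneg ht (Ioo_subset_Icc_self hx))
      (by linarith [hx.2])
  rw [← dx, abs_of_nonpos h0] at habs
  linarith

theorem dx_three_left (h : IsGlobalSmoothSolution u lm lp) {t : ℝ} (ht : 0 < t) :
    dx u lm lp 3 t (lm t) = deriv lm t := by
  have hlt := h.lt t ht.le
  have h1 := (h.continuousOn_dx_slice 3 ht (lm t) (left_mem_Icc.2 hlt.le)).tendsto.mono_left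
    (nhdsWithin_le_iff.2 (mem_of_superset (Ioo_mem_nhdsGT hlt) Ioo_subset_Icc_self))
  refine tendsto_nhds_unique h1 ((h.velocity_left t ht).congr' ?_)
  filter_upwards [Ioo_mem_nhdsGT hlt] with x hx using (dx_eq_iteratedDeriv 3 hx).symm

theorem dx_three_right (h : IsGlobalSmoothSolution u lm lp) {t : ℝ} (ht : 0 < t) :
    dx u lm lp 3 t (lp t) = deriv lp t := by
  have hlt := h.lt t ht.le
  have h1 := (h.continuousOn_dx_slice 3 ht (lp t) (right_mem_Icc.2 hlt.le)).tendsto.mono_left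
    (nhdsWithin_le_iff.2 (mem_of_superset (Ioo_mem_nhdsLT hlt) Ioo_subset_Icc_self))
  refine tendsto_nhds_unique h1 ((h.velocity_right t ht).congr' ?_)
  filter_upwards [Ioo_mem_nhdsLT hlt] with x hx using (dx_eq_iteratedDeriv 3 hx).symm

/-- The fourth space derivative vanishes at the contact points, because the slope there is
constant in time. -/
theorem dx_four_left (h : IsGlobalSmoothSolution u lm lp) {t : ℝ} (ht : 0 < t) :
    dx u lm lp 4 t (lm t) = 0 := by
  have hmem : ∀ s, 0 < s → lm s ∈ Icc (lm s) (lp s) := fun s hs =>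
    left_mem_Icc.2 (h.lt s hs.le).le
  have h1 := h.hasDerivAt_dx_curve 1 ht (h.hasDerivAt_left ht) hmem
  have h2 : HasDerivAt (fun s => dx u lm lp 1 s (lm s)) 0 t := by
    refine (hasDerivAt_const t (1 : ℝ)).congr_of_eventuallyEq ?_
    filter_upwards [Ioi_mem_nhds ht] with s hs using h.dx_one_left (le_of_lt hs)
  have h3 := h1.unique h2
  -- Since `u = 0` here, the derivative of the slope along the contact line is `-(u_xx u_xxx + 2
  -- u_xxxx) + λ' u_xx`, and `λ' = u_xxx` cancels the terms with `u_xx`.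
  rw [h.dtdx_one ht (hmem t ht), h.dx_one_left ht.le, h.dx_three_left ht, dx_zero,
    h.height_left t ht.le] at h3
  linarith

theorem dx_four_right (h : IsGlobalSmoothSolution u lm lp) {t : ℝ} (ht : 0 < t) :
    dx u lm lp 4 t (lp t) = 0 := by
  have hmem : ∀ s, 0 < s → lp s ∈ Icc (lm s) (lp s) := fun s hs =>
    right_mem_Icc.2 (h.lt s hs.le).le
  have h1 := h.hasDerivAt_dx_curve 1 ht (h.hasDerivAt_right ht) hmem
  have h2 : HasDerivAt (fun s => dx u lm lp 1 s (lp s)) 0 t := by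
    refine (hasDerivAt_const t (-1 : ℝ)).congr_of_eventuallyEq ?_
    filter_upwards [Ioi_mem_nhds ht] with s hs using h.dx_one_right (le_of_lt hs)
  have h3 := h1.unique h2
  rw [h.dtdx_one ht (hmem t ht), h.dx_one_right ht.le, h.dx_three_right ht, dx_zero,
    h.height_right t ht.le] at h3
  linarith

end IsGlobalSmoothSolution

/-! ### Conservation of mass and motion of the mass coordinate -/

namespace IsGlobalSmoothSolution

variable {u : ℝ → ℝ → ℝ} {lm lp : ℝ → ℝ}

theorem continuous_left_max (h : IsGlobalSmoothSolution u lm lp) :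
    Continuous fun t => lm (max t 0) :=
  h.continuous_left.comp_continuous (by fun_prop) fun t => le_max_right t 0

theorem continuous_right_max (h : IsGlobalSmoothSolution u lm lp) :
    Continuous fun t => lp (max t 0) :=
  h.continuous_right.comp_continuous (by fun_prop) fun t => le_max_right t 0

theorem continuousOn_dx_initial (h : IsGlobalSmoothSolution u lm lp) {k : ℕ} (hk : k ≤ 2) :
    ContinuousOn (Function.uncurry (dx u lm lp k)) (wetRegion (Ici 0) lm lp) :=
  h.attained k hk

/-- The extension of `u` by its boundary values in space and its initial value in time. -/
theorem continuous_ext (h : IsGlobalSmoothSolution u lm lp) :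
    Continuous fun p : ℝ × ℝ =>
      u (max p.1 0) (clamp (lm (max p.1 0)) (lp (max p.1 0)) p.2) := by
  have h1 := h.continuous_left_max.comp continuous_fst (X := ℝ × ℝ)
  have h2 := h.continuous_right_max.comp continuous_fst (X := ℝ × ℝ)
  simp only [Function.comp_def] at h1 h2
  have hc : Continuous fun p : ℝ × ℝ =>
      (max p.1 0, clamp (lm (max p.1 0)) (lp (max p.1 0)) p.2) :=
    (continuous_fst.max continuous_const).prodMk (h1.max (continuous_snd.min h2))
  exact ((h.continuousOn_dx_initial (k := 0) (by norm_num)).comp_continuous hc fun p =>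
    ⟨le_max_right p.1 0, clamp_mem (h.lt _ (le_max_right p.1 0)).le _⟩).congr fun p => dx_zero _ _

theorem continuous_cumMass_time (h : IsGlobalSmoothSolution u lm lp) {x : ℝ → ℝ}
    (hx : Continuous x) : Continuous fun t =>
      cumMass (u (max t 0)) (lm (max t 0)) (lp (max t 0)) (x t) := by
  have hP := intervalIntegral.continuous_parametric_primitive_of_continuous (a₀ := 0)
    (μ := volume) (f := fun t s => u (max t 0) (clamp (lm (max t 0)) (lp (max t 0)) s))
    h.continuous_ext
  have hi : ∀ t a b, IntervalIntegrable
      (fun s => u (max t 0) (clamp (lm (max t 0)) (lp (max t 0)) s)) volume a b := fun t a b =>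
    (h.continuous_ext.comp (f := fun s => (t, s)) (by fun_prop)).intervalIntegrable a b
  have h1 := hP.comp (f := fun t => (t, x t)) (by fun_prop)
  have h2 := hP.comp (f := fun t => (t, lm (max t 0)))
    (continuous_id.prodMk h.continuous_left_max)
  refine (h1.sub h2).congr fun t => ?_
  exact intervalIntegral.integral_interval_sub_left (hi _ _ _) (hi _ _ _)

/-- The height in coordinates that map the wetted interval to `[0, 1]`, normalized by length. -/
noncomputable def scaled (u : ℝ → ℝ → ℝ) (lm lp : ℝ → ℝ) (t r : ℝ) : ℝ :=
  (lp t - lm t) * u t (lm t + (lp t - lm t) * r)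

/-- The time derivative of `scaled`. -/
noncomputable def scaledDt (u : ℝ → ℝ → ℝ) (lm lp : ℝ → ℝ) (p : ℝ × ℝ) : ℝ :=
  (deriv lp p.1 - deriv lm p.1) * dx u lm lp 0 p.1 (lm p.1 + (lp p.1 - lm p.1) * p.2)
    + (lp p.1 - lm p.1) * (dtdx u lm lp 0 (p.1, lm p.1 + (lp p.1 - lm p.1) * p.2)
      + (deriv lm p.1 + (deriv lp p.1 - deriv lm p.1) * p.2)
        * dx u lm lp 1 p.1 (lm p.1 + (lp p.1 - lm p.1) * p.2))

/-- The mass flux through a moving point. -/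
noncomputable def massFlux (u : ℝ → ℝ → ℝ) (lm lp : ℝ → ℝ) (p : ℝ × ℝ) : ℝ :=
  -(dx u lm lp 0 p.1 (lm p.1 + (lp p.1 - lm p.1) * p.2)
      * dx u lm lp 3 p.1 (lm p.1 + (lp p.1 - lm p.1) * p.2))
    + (deriv lm p.1 + (deriv lp p.1 - deriv lm p.1) * p.2)
      * dx u lm lp 0 p.1 (lm p.1 + (lp p.1 - lm p.1) * p.2)

theorem scaled_mem (h : IsGlobalSmoothSolution u lm lp) {t r : ℝ} (ht : 0 ≤ t)
    (hr : r ∈ Icc (0 : ℝ) 1) : lm t + (lp t - lm t) * r ∈ Icc (lm t) (lp t) := by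
  have := h.lt t ht
  exact ⟨by nlinarith [hr.1], by nlinarith [hr.2]⟩

theorem scaled_mem_Ioo (h : IsGlobalSmoothSolution u lm lp) {t r : ℝ} (ht : 0 ≤ t)
    (hr : r ∈ Ioo (0 : ℝ) 1) : lm t + (lp t - lm t) * r ∈ Ioo (lm t) (lp t) := by
  have := h.lt t ht
  exact ⟨by nlinarith [hr.1], by nlinarith [hr.2]⟩

theorem continuousOn_left_fst (h : IsGlobalSmoothSolution u lm lp) :
    ContinuousOn (fun p : ℝ × ℝ => lm p.1) (Ioi 0 ×ˢ Icc 0 1) :=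
  h.smooth_left.continuousOn.comp continuousOn_fst fun _ hp => hp.1

theorem continuousOn_right_fst (h : IsGlobalSmoothSolution u lm lp) :
    ContinuousOn (fun p : ℝ × ℝ => lp p.1) (Ioi 0 ×ˢ Icc 0 1) :=
  h.smooth_right.continuousOn.comp continuousOn_fst fun _ hp => hp.1

theorem continuousOn_deriv_left_fst (h : IsGlobalSmoothSolution u lm lp) :
    ContinuousOn (fun p : ℝ × ℝ => deriv lm p.1) (Ioi 0 ×ˢ Icc 0 1) :=
  (h.smooth_left.continuousOn_deriv_of_isOpen isOpen_Ioi (by simp)).comp continuousOn_fst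
    fun _ hp => hp.1

theorem continuousOn_deriv_right_fst (h : IsGlobalSmoothSolution u lm lp) :
    ContinuousOn (fun p : ℝ × ℝ => deriv lp p.1) (Ioi 0 ×ˢ Icc 0 1) :=
  (h.smooth_right.continuousOn_deriv_of_isOpen isOpen_Ioi (by simp)).comp continuousOn_fst
    fun _ hp => hp.1

theorem continuousOn_comp_scaled (h : IsGlobalSmoothSolution u lm lp) {F : ℝ × ℝ → ℝ}
    (hF : ContinuousOn F (wetRegion (Ioi 0) lm lp)) :
    ContinuousOn (fun p : ℝ × ℝ => F (p.1, lm p.1 + (lp p.1 - lm p.1) * p.2))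
      (Ioi 0 ×ˢ Icc 0 1) :=
  hF.comp (continuousOn_fst.prodMk (h.continuousOn_left_fst.add
    ((h.continuousOn_right_fst.sub h.continuousOn_left_fst).mul continuousOn_snd)))
    fun _ hp => ⟨hp.1, h.scaled_mem (le_of_lt hp.1) hp.2⟩

theorem continuousOn_scaled (h : IsGlobalSmoothSolution u lm lp) :
    ContinuousOn (Function.uncurry (scaled u lm lp)) (Ioi 0 ×ˢ Icc 0 1) := by
  have := (h.continuousOn_right_fst.sub h.continuousOn_left_fst).mul
    (h.continuousOn_comp_scaled (h.continuousOn_dx 0))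
  refine this.congr fun _ _ => ?_
  simp [Function.uncurry, scaled, dx_zero]

theorem continuousOn_scaledDt (h : IsGlobalSmoothSolution u lm lp) :
    ContinuousOn (scaledDt u lm lp) (Ioi 0 ×ˢ Icc 0 1) :=
  ((h.continuousOn_deriv_right_fst.sub h.continuousOn_deriv_left_fst).mul
    (h.continuousOn_comp_scaled (h.continuousOn_dx 0))).add
  ((h.continuousOn_right_fst.sub h.continuousOn_left_fst).mul
    ((h.continuousOn_comp_scaled (h.continuousOn_dtdx 0)).add
      ((h.continuousOn_deriv_left_fst.add ((h.continuousOn_deriv_right_fst.sub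
        h.continuousOn_deriv_left_fst).mul continuousOn_snd)).mul
        (h.continuousOn_comp_scaled (h.continuousOn_dx 1)))))

theorem continuousOn_massFlux (h : IsGlobalSmoothSolution u lm lp) :
    ContinuousOn (massFlux u lm lp) (Ioi 0 ×ˢ Icc 0 1) :=
  ((h.continuousOn_comp_scaled (h.continuousOn_dx 0)).mul
    (h.continuousOn_comp_scaled (h.continuousOn_dx 3))).neg.add
  ((h.continuousOn_deriv_left_fst.add ((h.continuousOn_deriv_right_fst.sub
    h.continuousOn_deriv_left_fst).mul continuousOn_snd)).mul
    (h.continuousOn_comp_scaled (h.continuousOn_dx 0)))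

theorem hasDerivAt_scaled (h : IsGlobalSmoothSolution u lm lp) {t r : ℝ} (ht : 0 < t)
    (hr : r ∈ Icc (0 : ℝ) 1) :
    HasDerivAt (fun s => scaled u lm lp s r) (scaledDt u lm lp (t, r)) t := by
  have hL := (h.hasDerivAt_right ht).sub (h.hasDerivAt_left ht)
  have hx := (h.hasDerivAt_left ht).add (hL.mul_const r)
  have := hL.mul (h.hasDerivAt_dx_curve 0 ht hx fun s hs => h.scaled_mem hs.le hr)
  simp only [dx_zero] at this
  refine this.congr_deriv ?_
  simp only [scaledDt, dx_zero, Pi.add_apply, Pi.sub_apply]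

/-- The thin-film equation as a conservation law on the fixed interval `[0, 1]`: the time derivative
of the scaled height is the space derivative of the flux. -/
theorem hasDerivAt_massFlux (h : IsGlobalSmoothSolution u lm lp) {t r : ℝ} (ht : 0 < t)
    (hr : r ∈ Ioo (0 : ℝ) 1) :
    HasDerivAt (fun r => massFlux u lm lp (t, r)) (scaledDt u lm lp (t, r)) r := by
  have hx : HasDerivAt (fun r => lm t + (lp t - lm t) * r) (lp t - lm t) r := by
    simpa using ((hasDerivAt_id r).const_mul (lp t - lm t)).const_add (lm t)
  have hmem := h.scaled_mem_Ioo ht.le hr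
  have h0 := (h.hasDerivAt_dx 0 ht hmem).comp r hx
  have h3 := (h.hasDerivAt_dx 3 ht hmem).comp r hx
  have hv := ((hasDerivAt_id r).const_mul (deriv lp t - deriv lm t)).const_add (deriv lm t)
  refine ((h0.mul h3).neg.add (hv.mul h0)).congr_deriv ?_
  simp only [scaledDt, Function.comp_apply, id, h.dtdx_zero_interior ht hmem]
  ring

theorem scaled_slice {F : ℝ × ℝ → ℝ} (hF : ContinuousOn F (Ioi 0 ×ˢ Icc 0 1)) {t : ℝ}
    (ht : 0 < t) : ContinuousOn (fun r => F (t, r)) (Icc 0 1) :=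
  hF.comp (f := fun r => (t, r)) (by fun_prop) fun _ hr => ⟨ht, hr⟩

/-- The mass in the left fraction `[0, s]` of the film changes by the mass flux. -/
theorem hasDerivAt_integral_scaled (h : IsGlobalSmoothSolution u lm lp) {t s : ℝ} (ht : 0 < t)
    (hs : s ∈ Icc (0 : ℝ) 1) :
    HasDerivAt (fun t => ∫ r in (0 : ℝ)..s, scaled u lm lp t r) (massFlux u lm lp (t, s)) t := by
  have hsub : Icc 0 s ⊆ Icc (0 : ℝ) 1 := Icc_subset_Icc_right hs.2
  have hint : ∀ {F : ℝ × ℝ → ℝ}, ContinuousOn F (Ioi 0 ×ˢ Icc 0 1) → ∀ {τ : ℝ}, 0 < τ →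
      IntervalIntegrable (fun r => F (τ, r)) volume 0 s := fun hF τ hτ =>
    ContinuousOn.intervalIntegrable (by
      rw [uIcc_of_le hs.1]; exact (scaled_slice hF hτ).mono hsub)
  have hK : IsCompact (Icc (t / 2) (2 * t) ×ˢ Icc (0 : ℝ) 1) := isCompact_Icc.prod isCompact_Icc
  obtain ⟨C, hC⟩ := hK.exists_bound_of_continuousOn (h.continuousOn_scaledDt.mono
    (prod_mono (fun τ hτ => (by linarith [hτ.1] : (0 : ℝ) < τ)) le_rfl))
  have hpos : ∀ τ ∈ Icc (t / 2) (2 * t), 0 < τ := fun τ hτ => by linarith [hτ.1]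
  have hmemI : ∀ r ∈ uIoc 0 s, r ∈ Icc (0 : ℝ) 1 := fun r hr => by
    rw [uIoc_of_le hs.1] at hr
    exact hsub (Ioc_subset_Icc_self hr)
  have key := intervalIntegral.hasDerivAt_integral_of_dominated_loc_of_deriv_le
    (μ := volume) (a := 0) (b := s) (F := scaled u lm lp) (F' := fun t r => scaledDt u lm lp (t, r))
    (x₀ := t) (s := Icc (t / 2) (2 * t)) (bound := fun _ => C)
    (Icc_mem_nhds (by linarith) (by linarith))
    (by
      filter_upwards [Ioi_mem_nhds ht] with τ hτ
      exact (hint h.continuousOn_scaled hτ).def'.aestronglyMeasurable)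
    (hint h.continuousOn_scaled ht)
    (hint h.continuousOn_scaledDt ht).def'.aestronglyMeasurable
    (Eventually.of_forall fun r hr τ hτ => hC (τ, r) ⟨hτ, hmemI r hr⟩)
    (by simp)
    (Eventually.of_forall fun r hr τ hτ => h.hasDerivAt_scaled (hpos τ hτ) (hmemI r hr))
  refine key.2.congr_deriv ?_
  rw [intervalIntegral.integral_eq_sub_of_hasDerivAt_of_le hs.1
    ((scaled_slice h.continuousOn_massFlux ht).mono hsub)
    (fun r hr => h.hasDerivAt_massFlux ht ⟨hr.1, hr.2.trans_le hs.2⟩)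
    (hint h.continuousOn_scaledDt ht)]
  simp [massFlux, dx_zero, h.height_left t ht.le]

theorem integral_scaled (t s : ℝ) : ∫ r in (0 : ℝ)..s, scaled u lm lp t r =
    ∫ x in (lm t)..(lm t + (lp t - lm t) * s), u t x := by
  unfold scaled
  rw [intervalIntegral.integral_const_mul, intervalIntegral.mul_integral_comp_add_mul, mul_zero,
    add_zero]

theorem hasDerivAt_mass (h : IsGlobalSmoothSolution u lm lp) {t : ℝ} (ht : 0 < t) :
    HasDerivAt (mass u lm lp) 0 t := by
  have h1 := h.hasDerivAt_integral_scaled ht (right_mem_Icc.2 zero_le_one)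
  have h2 : (fun t => ∫ r in (0 : ℝ)..1, scaled u lm lp t r) = mass u lm lp := by
    ext t
    rw [integral_scaled, mul_one, add_sub_cancel, mass]
  rw [h2] at h1
  refine h1.congr_deriv ?_
  simp [massFlux, dx_zero, h.height_right t ht.le]

theorem cumMass_right_eq_mass (h : IsGlobalSmoothSolution u lm lp) {t : ℝ} (ht : 0 ≤ t) :
    cumMass (u t) (lm t) (lp t) (lp t) = mass u lm lp t :=
  IsMassCoord.cumMass_eq (right_mem_Icc.2 (h.lt t ht).le)

/-- Conservation of mass. -/
theorem mass_eq (h : IsGlobalSmoothSolution u lm lp) {t : ℝ} (ht : 0 ≤ t) :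
    mass u lm lp t = mass u lm lp 0 := by
  have hc : ContinuousOn (mass u lm lp) (Ici 0) := by
    refine (h.continuous_cumMass_time h.continuous_right_max).continuousOn.congr fun t ht => ?_
    have : max t 0 = t := max_eq_left ht
    simp only [this]
    exact (h.cumMass_right_eq_mass ht).symm
  rcases ht.eq_or_lt with rfl | ht'
  · rfl
  obtain ⟨c, hc, he⟩ := exists_hasDerivAt_eq_slope (mass u lm lp) (fun _ => 0) ht'
    (hc.mono Icc_subset_Ici_self) fun x hx => h.hasDerivAt_mass hx.1
  rw [eq_div_iff (sub_pos.2 ht').ne', zero_mul] at he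
  linarith

theorem continuousOn_height (h : IsGlobalSmoothSolution u lm lp) {t : ℝ} (ht : 0 ≤ t) :
    ContinuousOn (u t) (Icc (lm t) (lp t)) :=
  (h.contDiffOn_two ht).continuousOn

theorem isMassCoord (h : IsGlobalSmoothSolution u lm lp) (hm : mass u lm lp 0 = 2 / 3) {t : ℝ}
    (ht : 0 ≤ t) : IsMassCoord (u t) (lm t) (lp t) (lagrangian u lm lp t) := by
  have hmt : mass u lm lp t = 2 / 3 := (h.mass_eq ht).trans hm
  have hZ : ∀ y ∈ Icc (-1 : ℝ) 1, lagrangian u lm lp t y ∈ Icc (lm t) (lp t) ∧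
      ∫ s in (lm t)..(lagrangian u lm lp t y), u t s = massFn y := fun y hy =>
    Classical.epsilon_spec (existsUnique_lagrangian u lm lp t y (h.lt t ht)
      (h.continuousOn_height ht) (h.pos t ht) hmt hy).exists
  exact ⟨h.lt t ht, h.continuousOn_height ht, h.pos t ht, h.height_left t ht,
    h.height_right t ht, hmt, fun y hy => (hZ y hy).1, fun y hy => (hZ y hy).2⟩

/-- The coordinate solves `cumMass = massFn y` with a monotone left side that depends continuously
on time and is strictly monotone at the solution. Only continuity of `u` is needed, so `t = 0` is
included. -/
theorem continuousWithinAt_lagrangian (h : IsGlobalSmoothSolution u lm lp) (hm : mass u lm lp 0 = 2 / 3)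
    {t y : ℝ} (ht : 0 ≤ t) (hy : y ∈ Ioo (-1 : ℝ) 1) :
    ContinuousWithinAt (fun s => lagrangian u lm lp s y) (Ici 0) t := by
  have hM := h.isMassCoord hm ht
  have hy' := Ioo_subset_Icc_self hy
  have hZ := hM.mem_Ioo hy
  have hmass := hM.cumMass_apply hy'
  have hev : ∀ᶠ s in 𝓝[Ici 0] t, 0 ≤ s := self_mem_nhdsWithin
  refine tendsto_of_monotone_eq (G := fun s => cumMass (u s) (lm s) (lp s))
    (G₀ := cumMass (u t) (lm t) (lp t)) (c := fun _ => massFn y) (c₀ := massFn y)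
    (fun x => ?_) tendsto_const_nhds ?_ ?_ (fun x hx => .inl ?_) fun x hx => .inl ?_
  · have := ((h.continuous_cumMass_time (continuous_const (y := x))).tendsto t).mono_left
      (nhdsWithin_le_nhds (s := Ici 0))
    rw [max_eq_left ht] at this
    refine this.congr' ?_
    filter_upwards [hev] with s hs
    rw [max_eq_left hs]
  · filter_upwards [hev] with s hs using (h.isMassCoord hm hs).monotone_cumMass
  · filter_upwards [hev] with s hs using (h.isMassCoord hm hs).cumMass_apply hy'
  · rw [← hmass]; exact hM.cumMass_lt_of_lt (Ioo_subset_Ioc_self hZ) hx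
  · rw [← hmass]; exact hM.lt_cumMass_of_lt (Ioo_subset_Ico_self hZ) hx

/-- A point that is implicitly defined by a differentiable equation moves differentiably. -/
theorem _root_.ThinFilm.hasDerivAt_of_implicit {Φ : ℝ → ℝ → ℝ} {Φ₁ Φ₂ : ℝ × ℝ → ℝ} {S : ℝ → ℝ}
    {t c : ℝ} (h₁ : ∀ᶠ p in 𝓝 (t, S t), HasDerivAt (fun τ => Φ τ p.2) (Φ₁ p) p.1)
    (h₂ : ∀ᶠ p in 𝓝 (t, S t), HasDerivAt (fun s => Φ p.1 s) (Φ₂ p) p.2)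
    (c₁ : ContinuousAt Φ₁ (t, S t)) (c₂ : ContinuousAt Φ₂ (t, S t)) (h0 : Φ₂ (t, S t) ≠ 0)
    (hS : ContinuousAt S t) (heq : ∀ᶠ τ in 𝓝 t, Φ τ (S τ) = c) :
    HasDerivAt S (-Φ₁ (t, S t) / Φ₂ (t, S t)) t := by
  have hc : ∀ {g : ℝ × ℝ → ℝ}, ContinuousAt g (t, S t) →
      ContinuousAt (fun p => g p • (1 : ℝ →L[ℝ] ℝ)) (t, S t) := fun hg =>
    hg.smul continuousAt_const
  have hf : ∀ {φ : ℝ → ℝ} {φ' x : ℝ}, HasDerivAt φ φ' x → HasFDerivAt φ (φ' • (1 : ℝ →L[ℝ] ℝ)) x :=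
    fun hφ => hφ.hasFDerivAt.congr_fderiv (by ext; simp)
  have hF := (hasStrictFDerivAt_uncurry_coprod (u := (t, S t)) (f := Φ)
    (f₁ := fun a b => Φ₁ (a, b) • (1 : ℝ →L[ℝ] ℝ)) (f₂ := fun a b => Φ₂ (a, b) • (1 : ℝ →L[ℝ] ℝ))
    (h₁.mono fun p hp => hf hp) (h₂.mono fun p hp => hf hp) (hc c₁) (hc c₂)).hasFDerivAt
  have hG : HasFDerivAt (fun p : ℝ × ℝ => (p.1, Φ p.1 p.2)) _ (t, S t) :=
    hasFDerivAt_fst.prodMk hF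
  have hh : HasFDerivAt (fun τ : ℝ => (τ, c)) _ t :=
    (hasDerivAt_id t).hasFDerivAt.prodMk (hasFDerivAt_const c t)
  have := HasFDerivAt.of_comp_of_leftInverse (g := fun τ => (τ, S τ))
    (f'symm := (ContinuousLinearMap.fst ℝ ℝ ℝ).prod
      ((Φ₂ (t, S t))⁻¹ • (ContinuousLinearMap.snd ℝ ℝ ℝ
        - Φ₁ (t, S t) • ContinuousLinearMap.fst ℝ ℝ ℝ)))
    (continuousAt_id.prodMk hS) hG hh
    (heq.mono fun τ hτ => by simp [hτ]) (fun p => by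
      ext
      · simp
      · simp [Function.HasUncurry.uncurry]
        field_simp)
  have h3 := (this.snd).hasDerivAt
  refine h3.congr_deriv ?_
  simp
  ring

/-- The mass coordinate moves with the third derivative of the height. -/
theorem hasDerivAt_lagrangian (h : IsGlobalSmoothSolution u lm lp) (hm : mass u lm lp 0 = 2 / 3)
    {t y : ℝ} (ht : 0 < t) (hy : y ∈ Ioo (-1 : ℝ) 1) :
    HasDerivAt (fun s => lagrangian u lm lp s y)
      (dx u lm lp 3 t (lagrangian u lm lp t y)) t := by
  set Z := fun s => lagrangian u lm lp s y with hZdef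
  have hy' := Ioo_subset_Icc_self hy
  have hZc : ContinuousAt Z t :=
    (h.continuousWithinAt_lagrangian hm ht.le hy).continuousAt (Ici_mem_nhds ht)
  have hmem : ∀ s, 0 ≤ s → Z s ∈ Ioo (lm s) (lp s) := fun s hs => (h.isMassCoord hm hs).mem_Ioo hy
  have hL : ∀ s, 0 ≤ s → 0 < lp s - lm s := fun s hs => sub_pos.2 (h.lt s hs)
  -- In the normalized position the mass integral runs over a fixed domain. With `v` the velocity of
  -- the normalized frame and `L` the length, implicit differentiation gives `S' = (u_xxx - v) / L`,
  -- and undoing the scaling leaves `Z' = v + L S' = u_xxx`.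
  set S := fun s => (Z s - lm s) / (lp s - lm s) with hSdef
  have hS01 : ∀ s, 0 ≤ s → S s ∈ Ioo (0 : ℝ) 1 := fun s hs =>
    ⟨div_pos (by linarith [(hmem s hs).1]) (hL s hs),
      (div_lt_one (hL s hs)).2 (by linarith [(hmem s hs).2])⟩
  have hZS : ∀ s, 0 ≤ s → lm s + (lp s - lm s) * S s = Z s := fun s hs => by
    have := (hL s hs).ne'
    simp only [hSdef]; field_simp; ring
  have hSc : ContinuousAt S t :=
    (hZc.sub (h.hasDerivAt_left ht).continuousAt).div
      ((h.hasDerivAt_right ht).continuousAt.sub (h.hasDerivAt_left ht).continuousAt) (hL t ht.le).ne'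
  have hU : Ioi (0 : ℝ) ×ˢ Ioo (0 : ℝ) 1 ∈ 𝓝 (t, S t) :=
    (isOpen_Ioi.prod isOpen_Ioo).mem_nhds ⟨ht, hS01 t ht.le⟩
  have hU' : Ioi (0 : ℝ) ×ˢ Icc (0 : ℝ) 1 ∈ 𝓝 (t, S t) :=
    mem_of_superset hU (prod_mono le_rfl Ioo_subset_Icc_self)
  have hderS := hasDerivAt_of_implicit (S := S) (t := t) (c := massFn y)
    (Φ := fun t s => ∫ r in (0 : ℝ)..s, scaled u lm lp t r) (Φ₁ := massFlux u lm lp)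
    (Φ₂ := Function.uncurry (scaled u lm lp))
    (by filter_upwards [hU] with p hp using
      h.hasDerivAt_integral_scaled hp.1 (Ioo_subset_Icc_self hp.2))
    (by
      filter_upwards [hU] with p hp
      have hc := scaled_slice h.continuousOn_scaled hp.1
      have hp2 := Ioo_subset_Icc_self hp.2
      refine intervalIntegral.integral_hasDerivAt_right
        (ContinuousOn.intervalIntegrable (hc.mono ?_)) ?_ (hc.continuousAt (Icc_mem_nhds hp.2.1 hp.2.2))
      · rw [uIcc_of_le hp2.1]; exact Icc_subset_Icc_right hp2.2
      · exact (hc.mono Ioo_subset_Icc_self).stronglyMeasurableAtFilter isOpen_Ioo _ hp.2)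
    (h.continuousOn_massFlux.continuousAt hU') (h.continuousOn_scaled.continuousAt hU')
    (by
      simp only [Function.uncurry, scaled, hZS t ht.le]
      exact (mul_pos (hL t ht.le) (h.pos t ht.le _ (hmem t ht.le))).ne') hSc
    (by
      filter_upwards [Ioi_mem_nhds ht] with s hs
      rw [integral_scaled, hZS s (le_of_lt hs)]
      exact (h.isMassCoord hm (le_of_lt hs)).mass y hy')
  have hder := (h.hasDerivAt_left ht).add
    (((h.hasDerivAt_right ht).sub (h.hasDerivAt_left ht)).mul hderS)
  refine (hder.congr_of_eventuallyEq ?_).congr_deriv ?_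
  · filter_upwards [Ioi_mem_nhds ht] with s hs using (hZS s (le_of_lt hs)).symm
  · have h1 := (hL t ht.le).ne'
    have h2 := (h.pos t ht.le _ (hmem t ht.le)).ne'
    simp only [massFlux, Function.uncurry, scaled, hZS t ht.le, dx_zero, Pi.sub_apply]
    field_simp
    ring

end IsGlobalSmoothSolution

/-! ### Relative height and its slope along a solution -/

/-- The slope of the relative height of `u t` in the mass coordinate. -/
noncomputable def relSlope (u : ℝ → ℝ → ℝ) (lm lp : ℝ → ℝ) (t y : ℝ) : ℝ :=
  (dx u lm lp 1 t (lagrangian u lm lp t y) / relHeight (u t) (lagrangian u lm lp t) y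
    + y * relHeight (u t) (lagrangian u lm lp t) y) / parab y

theorem ae_mem_Ioo_of_mem_uIoc : ∀ᵐ y : ℝ, y ∈ uIoc (-1 : ℝ) 1 → y ∈ Ioo (-1 : ℝ) 1 := by
  have h1 : ∀ᵐ y : ℝ, y ≠ 1 := by simp [ae_iff, measure_singleton]
  filter_upwards [h1] with y hy1 hy
  rw [uIoc_of_le (by norm_num)] at hy
  exact ⟨hy.1, hy.2.lt_of_ne hy1⟩

namespace IsGlobalSmoothSolution

variable {u : ℝ → ℝ → ℝ} {lm lp : ℝ → ℝ}

theorem hasDerivAt_height (h : IsGlobalSmoothSolution u lm lp) {t x : ℝ} (ht : 0 ≤ t)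
    (hx : x ∈ Ioo (lm t) (lp t)) : HasDerivAt (u t) (dx u lm lp 1 t x) x := by
  have := h.hasDerivAt_dx_of_lt_two (k := 0) (by norm_num) ht hx
  rwa [show dx u lm lp 0 t = u t from funext fun x => dx_zero t x] at this

theorem hasDerivAt_relHeight (h : IsGlobalSmoothSolution u lm lp) (hm : mass u lm lp 0 = 2 / 3)
    {t y : ℝ} (ht : 0 ≤ t) (hy : y ∈ Ioo (-1 : ℝ) 1) :
    HasDerivAt (relHeight (u t) (lagrangian u lm lp t)) (relSlope u lm lp t y) y :=
  (h.isMassCoord hm ht).hasDerivAt_relHeight (fun _ hx => h.hasDerivAt_height ht hx) hy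

theorem energy_eq (h : IsGlobalSmoothSolution u lm lp) (hm : mass u lm lp 0 = 2 / 3)
    {t : ℝ} (ht : 0 ≤ t) :
    energy u lm lp t = (1 / 2) * ∫ y in (-1 : ℝ)..1, relSlope u lm lp t y ^ 2 := by
  rw [energy]
  congr 1
  refine intervalIntegral.integral_congr_ae ?_
  filter_upwards [ae_mem_Ioo_of_mem_uIoc] with y hy hyI
  have hy' := hy hyI
  rw [sq_abs]
  congr 1
  refine HasDerivAt.deriv ((h.hasDerivAt_relHeight hm ht hy').congr_of_eventuallyEq ?_)
  filter_upwards [isOpen_Ioo.mem_nhds hy'] with z hz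
  have := parab_pos hz
  rw [relHeight, steady, max_eq_left (by unfold parab at this; linarith), parab]
  congr 1
  ring

/-! ### Uniform bounds -/

theorem isCompact_wetRegion (h : IsGlobalSmoothSolution u lm lp) {s : ℝ} (hs : 0 ≤ s) (T : ℝ) :
    IsCompact (wetRegion (Icc s T) lm lp) := by
  have h1 := h.continuous_left_max.comp continuous_fst (X := ℝ × ℝ)
  have h2 := h.continuous_right_max.comp continuous_fst (X := ℝ × ℝ)
  simp only [Function.comp_def] at h1 h2
  have hc : Continuous fun p : ℝ × ℝ =>
      (p.1, lm (max p.1 0) + (lp (max p.1 0) - lm (max p.1 0)) * p.2) :=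
    continuous_fst.prodMk (h1.add ((h2.sub h1).mul continuous_snd))
  convert (isCompact_Icc.prod isCompact_Icc : IsCompact (Icc s T ×ˢ Icc (0 : ℝ) 1)).image hc
    using 1
  ext ⟨t, x⟩
  simp only [wetRegion, mem_ofPred_eq, mem_image, mem_prod, Prod.exists, Prod.mk.injEq]
  constructor
  · rintro ⟨ht, hx⟩
    have ht0 : 0 ≤ t := hs.trans ht.1
    have hL : 0 < lp t - lm t := sub_pos.2 (h.lt t ht0)
    refine ⟨t, (x - lm t) / (lp t - lm t), ⟨ht, div_nonneg (by linarith [hx.1]) hL.le,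
      (div_le_one hL).2 (by linarith [hx.2])⟩, rfl, ?_⟩
    rw [max_eq_left ht0]
    field_simp
    ring
  · rintro ⟨t, r, ⟨ht, hr⟩, rfl, rfl⟩
    have ht0 : 0 ≤ t := hs.trans ht.1
    rw [max_eq_left ht0]
    exact ⟨ht, h.scaled_mem ht0 hr⟩

theorem exists_bound_dx_initial (h : IsGlobalSmoothSolution u lm lp) {k : ℕ} (hk : k ≤ 2) (T : ℝ) :
    ∃ C, 0 ≤ C ∧ ∀ t ∈ Icc 0 T, ∀ x ∈ Icc (lm t) (lp t), |dx u lm lp k t x| ≤ C := by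
  obtain ⟨C, hC⟩ := (h.isCompact_wetRegion le_rfl T).exists_bound_of_continuousOn
    ((h.continuousOn_dx_initial hk).mono fun p hp => ⟨hp.1.1, hp.2⟩)
  exact ⟨max C 0, le_max_right _ _, fun t ht x hx =>
    (hC (t, x) ⟨ht, hx⟩).trans (le_max_left _ _)⟩

theorem exists_bound_dx (h : IsGlobalSmoothSolution u lm lp) (k : ℕ) {s : ℝ} (hs : 0 < s) (T : ℝ) :
    ∃ C, ∀ t ∈ Icc s T, ∀ x ∈ Icc (lm t) (lp t), |dx u lm lp k t x| ≤ C := by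
  obtain ⟨C, hC⟩ := (h.isCompact_wetRegion hs.le T).exists_bound_of_continuousOn
    ((h.continuousOn_dx k).mono fun p hp => ⟨hs.trans_le hp.1.1, hp.2⟩)
  exact ⟨C, fun t ht x hx => hC (t, x) ⟨ht, hx⟩⟩

theorem exists_pos_le_height (h : IsGlobalSmoothSolution u lm lp) {δ : ℝ} (hδ : 0 < δ) (T : ℝ) :
    ∃ κ, 0 < κ ∧ ∀ t ∈ Icc 0 T, ∀ x, lm t + δ ≤ x → x ≤ lp t - δ → κ ≤ u t x := by
  have h1 := h.continuous_left_max.comp continuous_fst (X := ℝ × ℝ)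
  have h2 := h.continuous_right_max.comp continuous_fst (X := ℝ × ℝ)
  simp only [Function.comp_def] at h1 h2
  have hcl : IsClosed ({p : ℝ × ℝ | lm (max p.1 0) + δ ≤ p.2} ∩
      {p : ℝ × ℝ | p.2 ≤ lp (max p.1 0) - δ}) :=
    (isClosed_le (h1.add continuous_const) continuous_snd).inter
      (isClosed_le continuous_snd (h2.sub continuous_const))
  obtain ⟨κ, hκ, hle⟩ := ((h.isCompact_wetRegion le_rfl T).inter_right hcl).exists_forall_le'
    (f := Function.uncurry (dx u lm lp 0)) (a := 0)
    ((h.continuousOn_dx_initial (k := 0) (by norm_num)).mono fun p hp => ⟨hp.1.1.1, hp.1.2⟩)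
    (by
      rintro ⟨t, x⟩ ⟨⟨ht, -⟩, hx⟩
      simp only [mem_inter_iff, mem_ofPred_eq, max_eq_left ht.1] at hx
      simp only [Function.uncurry, dx_zero]
      exact h.pos t ht.1 x ⟨by linarith [hx.1], by linarith [hx.2]⟩)
  refine ⟨κ, hκ, fun t ht x hx hx' => ?_⟩
  have := hle (t, x) ⟨⟨ht, by linarith, by linarith⟩, by
    simp only [mem_inter_iff, mem_ofPred_eq, max_eq_left ht.1]; exact ⟨hx, hx'⟩⟩
  simpa only [Function.uncurry, dx_zero] using this

theorem abs_dx_one_sub_le (h : IsGlobalSmoothSolution u lm lp) {t G : ℝ} (ht : 0 ≤ t)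
    (hG : ∀ x ∈ Icc (lm t) (lp t), |dx u lm lp 2 t x| ≤ G) {x x' : ℝ}
    (hx : x ∈ Icc (lm t) (lp t)) (hx' : x' ∈ Icc (lm t) (lp t)) :
    |dx u lm lp 1 t x' - dx u lm lp 1 t x| ≤ G * |x' - x| :=
  (convex_Icc _ _).norm_image_sub_le_of_norm_hasDerivWithin_le
    (fun _ hz => h.hasDerivWithinAt_dx_of_lt_two (k := 1) (by norm_num) ht hz) hG hx hx'

theorem differentiableAt_relSlope (h : IsGlobalSmoothSolution u lm lp)
    (hm : mass u lm lp 0 = 2 / 3) {t y : ℝ} (ht : 0 ≤ t) (hy : y ∈ Ioo (-1 : ℝ) 1) :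
    DifferentiableAt ℝ (relSlope u lm lp t) y := by
  have hZ := (h.isMassCoord hm ht).hasDerivAt hy
  have h1 := (h.isMassCoord hm ht).hasDerivAt_comp
    (fun _ hx => h.hasDerivAt_dx_of_lt_two (k := 1) (by norm_num) ht hx) hy
  have h0 := h.hasDerivAt_relHeight hm ht hy
  exact (((h1.div h0 ((h.isMassCoord hm ht).relHeight_pos hy).ne').add
    ((hasDerivAt_id y).mul h0)).div (hasDerivAt_parab y) (parab_pos hy).ne').differentiableAt

theorem dx_one_eq (h : IsGlobalSmoothSolution u lm lp)
    (hm : mass u lm lp 0 = 2 / 3) {t y : ℝ} (ht : 0 ≤ t) (hy : y ∈ Ioo (-1 : ℝ) 1) :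
    dx u lm lp 1 t (lagrangian u lm lp t y) = relHeight (u t) (lagrangian u lm lp t) y *
      (relSlope u lm lp t y * parab y - y * relHeight (u t) (lagrangian u lm lp t) y) := by
  have h1 := ((h.isMassCoord hm ht).relHeight_pos hy).ne'
  have h2 := (parab_pos hy).ne'
  rw [relSlope]
  field_simp
  ring

/-- Bounds on the relative height and its slope which are uniform down to the initial time. -/
theorem exists_uniform_bounds (h : IsGlobalSmoothSolution u lm lp)
    (hm : mass u lm lp 0 = 2 / 3) (T : ℝ) :
    ∃ α A C, 0 < α ∧ ∀ t ∈ Icc 0 T, ∀ y ∈ Ioo (-1 : ℝ) 1,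
      α ≤ relHeight (u t) (lagrangian u lm lp t) y ∧
      relHeight (u t) (lagrangian u lm lp t) y ≤ A ∧ |relSlope u lm lp t y| ≤ C := by
  obtain ⟨G₁, hG₁, hb₁⟩ := h.exists_bound_dx_initial (k := 1) (by norm_num) T
  obtain ⟨G₂, hG₂, hb₂⟩ := h.exists_bound_dx_initial (k := 2) le_rfl T
  -- Within distance `δ` of a contact point the slope changes by at most `1/2`, so its modulus stays
  -- at least `1/2`.
  set δ := 1 / (2 * (G₂ + 1)) with hδdef
  have hδ : 0 < δ := by positivity
  have hGδ : G₂ * δ ≤ 1 / 2 := by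
    rw [hδdef, mul_one_div, div_le_iff₀ (by positivity)]
    linarith
  obtain ⟨κ, hκ, hle⟩ := h.exists_pos_le_height hδ T
  set α := min (2 * κ) (1 / 3) with hαdef
  have hα : 0 < α := lt_min (by linarith) (by norm_num)
  have hlow : ∀ t ∈ Icc 0 T, ∀ y ∈ Ioo (-1 : ℝ) 1,
      α ≤ relHeight (u t) (lagrangian u lm lp t) y := by
    intro t ht y hy
    have hlt := (h.lt t ht.1).le
    refine (h.isMassCoord hm ht.1).le_relHeight (g := dx u lm lp 1 t) (δ := δ)
      (fun x hx => h.hasDerivAt_height ht.1 hx) (fun x hx hxl => ?_) (fun x hx hxr => ?_)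
      (fun x _ hxl hxr => hle t ht x hxl hxr) hy
    · have h1 := h.abs_dx_one_sub_le ht.1 (hb₂ t ht) (left_mem_Icc.2 hlt) (Ioo_subset_Icc_self hx)
      rw [h.dx_one_left ht.1, abs_of_pos (sub_pos.2 hx.1)] at h1
      have h2 := mul_le_mul_of_nonneg_left (show x - lm t ≤ δ by linarith) hG₂
      linarith [(abs_le.1 h1).1]
    · have h1 := h.abs_dx_one_sub_le ht.1 (hb₂ t ht) (right_mem_Icc.2 hlt) (Ioo_subset_Icc_self hx)
      rw [h.dx_one_right ht.1, abs_of_neg (sub_neg.2 hx.2)] at h1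
      have h2 := mul_le_mul_of_nonneg_left (show -(x - lp t) ≤ δ by linarith) hG₂
      linarith [(abs_le.1 h1).2]
  have hup : ∀ t ∈ Icc 0 T, ∀ y ∈ Ioo (-1 : ℝ) 1,
      relHeight (u t) (lagrangian u lm lp t) y ≤ 4 * G₁ + 1 := by
    intro t ht y hy
    have := (h.isMassCoord hm ht.1).relHeight_sq_le (fun x hx => h.hasDerivAt_height ht.1 hx)
      (fun x hx => hb₁ t ht x (Ioo_subset_Icc_self hx)) hy
    nlinarith
  refine ⟨α, 4 * G₁ + 1, 8 * (G₂ / α + (4 * G₁ + 1) ^ 2) / α, hα, fun t ht y hy =>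
    ⟨hlow t ht y hy, hup t ht y hy, ?_⟩⟩
  have hMC := h.isMassCoord hm ht.1
  have hZ : ∀ y ∈ Ioo (-1 : ℝ) 1, lagrangian u lm lp t y ∈ Icc (lm t) (lp t) := fun y hy =>
    hMC.mem y (Ioo_subset_Icc_self hy)
  exact abs_slope_le (fun y hy => h.hasDerivAt_relHeight hm ht.1 hy)
    (fun y hy => (h.differentiableAt_relSlope hm ht.1 hy).hasDerivAt)
    (fun y hy => h.dx_one_eq hm ht.1 hy)
    (fun y hy => hMC.hasDerivAt_comp
      (fun _ hx => h.hasDerivAt_dx_of_lt_two (k := 1) (by norm_num) ht.1 hx) hy)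
    hα (hlow t ht) (hup t ht) (fun y hy => hb₁ t ht _ (hZ y hy))
    (fun y hy => hb₂ t ht _ (hZ y hy)) hy

theorem bddCont_relHeight (h : IsGlobalSmoothSolution u lm lp) (hm : mass u lm lp 0 = 2 / 3)
    {t : ℝ} (ht : 0 ≤ t) : BddCont (relHeight (u t) (lagrangian u lm lp t)) := by
  obtain ⟨α, A, C, -, hb⟩ := h.exists_uniform_bounds hm t
  refine ⟨fun y hy => (h.hasDerivAt_relHeight hm ht hy).continuousAt.continuousWithinAt, A,
    fun y hy => ?_⟩
  rw [abs_of_pos ((h.isMassCoord hm ht).relHeight_pos hy)]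
  exact (hb t ⟨ht, le_rfl⟩ y hy).2.1

theorem bddCont_relSlope (h : IsGlobalSmoothSolution u lm lp) (hm : mass u lm lp 0 = 2 / 3)
    {t : ℝ} (ht : 0 ≤ t) : BddCont (relSlope u lm lp t) := by
  obtain ⟨α, A, C, -, hb⟩ := h.exists_uniform_bounds hm t
  exact ⟨fun y hy => (h.differentiableAt_relSlope hm ht hy).continuousAt.continuousWithinAt, C,
    fun y hy => (hb t ⟨ht, le_rfl⟩ y hy).2.2⟩

theorem bddCont_dx (h : IsGlobalSmoothSolution u lm lp) (hm : mass u lm lp 0 = 2 / 3) (k : ℕ)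
    {t : ℝ} (ht : 0 < t) : BddCont fun y => dx u lm lp k t (lagrangian u lm lp t y) := by
  have hMC := h.isMassCoord hm ht.le
  obtain ⟨C, hC⟩ := h.exists_bound_dx k ht t
  refine ⟨fun y hy => ?_, C, fun y hy => hC t ⟨le_rfl, le_rfl⟩ _
    (hMC.mem y (Ioo_subset_Icc_self hy))⟩
  exact ((hMC.hasDerivAt_comp (fun _ hx => h.hasDerivAt_dx k ht hx) hy).continuousAt).continuousWithinAt

/-! ### The energy inequality -/

/-- Along particles `ũ_t = u_t + u_xxx u_x = -u u_xxxx`, so `a_t = -a u_xxxx`; the formula is its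
`y`-derivative. It is checked directly on the expression of `b` through `u` and `u_x`, which avoids
exchanging derivatives of the mass coordinate. -/
theorem hasDerivAt_relSlope_time (h : IsGlobalSmoothSolution u lm lp)
    (hm : mass u lm lp 0 = 2 / 3) {t y : ℝ} (ht : 0 < t) (hy : y ∈ Ioo (-1 : ℝ) 1) :
    HasDerivAt (fun s => relSlope u lm lp s y)
      (-(relSlope u lm lp t y * dx u lm lp 4 t (lagrangian u lm lp t y)
        + dx u lm lp 5 t (lagrangian u lm lp t y))) t := by
  have hmem : ∀ s, 0 < s → lagrangian u lm lp s y ∈ Icc (lm s) (lp s) := fun s hs =>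
    (h.isMassCoord hm hs.le).mem y (Ioo_subset_Icc_self hy)
  have hZ := h.hasDerivAt_lagrangian hm ht hy
  have h0 := h.hasDerivAt_dx_curve 0 ht hZ hmem
  have h1 := h.hasDerivAt_dx_curve 1 ht hZ hmem
  rw [h.dtdx_zero ht (hmem t ht)] at h0
  rw [h.dtdx_one ht (hmem t ht)] at h1
  have hp := h.pos t ht.le _ ((h.isMassCoord hm ht.le).mem_Ioo hy)
  simp only [dx_zero] at h0 h1
  have hw := (parab_pos hy).ne'
  have hrel := h0.div_const (parab y)
  have := ((h1.div hrel (div_ne_zero hp.ne' hw)).add (hrel.const_mul y)).div_const (parab y)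
  refine this.congr_deriv ?_
  rw [relSlope, relHeight]
  have := hp.ne'
  field_simp
  ring

theorem isProfile (h : IsGlobalSmoothSolution u lm lp) (hm : mass u lm lp 0 = 2 / 3)
    {t : ℝ} (ht : 0 < t) : ∃ c d e : ℝ → ℝ,
      IsProfile (relHeight (u t) (lagrangian u lm lp t)) (relSlope u lm lp t) c d ∧
      (∀ y ∈ Ioo (-1 : ℝ) 1, HasDerivAt d (e y) y) ∧
      ∀ y ∈ Ioo (-1 : ℝ) 1, relHeight (u t) (lagrangian u lm lp t) y *
        dx u lm lp 4 t (lagrangian u lm lp t y) =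
        relHeight (u t) (lagrangian u lm lp t) y ^ 2 *
          IsProfile.flux (relHeight (u t) (lagrangian u lm lp t)) (relSlope u lm lp t) c d e y := by
  have hMC := h.isMassCoord hm ht.le
  set a := relHeight (u t) (lagrangian u lm lp t) with ha
  have hsm : ContDiffOn ℝ (4 : ℕ) a (Ioo (-1) 1) :=
    hMC.contDiffOn_relHeight (((h.contDiffOn_slice ht).mono Ioo_subset_Icc_self).of_le
      ENat.LEInfty.out)
  have hD : ∀ k < 4, ∀ y ∈ Ioo (-1 : ℝ) 1, HasDerivAt (iteratedDeriv k a)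
      (iteratedDeriv (k + 1) a y) y := by
    intro k hk y hy
    rw [iteratedDeriv_succ]
    have h1 := (hsm.differentiableOn_iteratedDerivWithin (m := k) (by exact_mod_cast hk)
      isOpen_Ioo.uniqueDiffOn).congr fun z hz =>
        (iteratedDerivWithin_of_isOpen (n := k) (f := a) isOpen_Ioo hz).symm
    exact ((h1 y hy).differentiableAt (isOpen_Ioo.mem_nhds hy)).hasDerivAt
  have hb1 : ∀ y ∈ Ioo (-1 : ℝ) 1, iteratedDeriv 1 a y = relSlope u lm lp t y := fun y hy => by
    rw [iteratedDeriv_one]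
    exact (h.hasDerivAt_relHeight hm ht.le hy).deriv
  have hcomp : ∀ k, ∀ y ∈ Ioo (-1 : ℝ) 1,
      HasDerivAt (fun y => dx u lm lp k t (lagrangian u lm lp t y))
        (dx u lm lp (k + 1) t (lagrangian u lm lp t y) / a y) y := fun k y hy =>
    hMC.hasDerivAt_comp (fun _ hx => h.hasDerivAt_dx k ht hx) hy
  obtain ⟨α, A, C, hα, hb⟩ := h.exists_uniform_bounds hm t
  have hlt := h.lt t ht.le
  have hcont := h.continuousOn_dx_slice 1 ht
  obtain ⟨h1, h2⟩ := isProfile_of_bounded (a := a) (b := relSlope u lm lp t)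
    (c := iteratedDeriv 2 a) (d := iteratedDeriv 3 a) (e := iteratedDeriv 4 a)
    (fun y hy => h.hasDerivAt_relHeight hm ht.le hy)
    (fun y hy => (hD 1 (by norm_num) y hy).congr_of_eventuallyEq (by
      filter_upwards [isOpen_Ioo.mem_nhds hy] with z hz using (hb1 z hz).symm))
    (hD 2 (by norm_num)) (hD 3 (by norm_num)) hα
    (fun y hy => (hb t ⟨ht.le, le_rfl⟩ y hy).1) (h.bddCont_relHeight hm ht.le)
    (h.bddCont_relSlope hm ht.le) (fun y hy => h.dx_one_eq hm ht.le hy)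
    (hcomp 1) (hcomp 2) (hcomp 3) (h.bddCont_dx hm 2 ht) (h.bddCont_dx hm 3 ht)
    (h.bddCont_dx hm 4 ht)
    (by
      have := (hcont (lm t) (left_mem_Icc.2 hlt.le)).tendsto.mono_left
        (nhdsWithin_le_iff.2 (mem_of_superset (Ioo_mem_nhdsGT hlt) Ioo_subset_Icc_self))
      rw [h.dx_one_left ht.le] at this
      exact this.comp hMC.tendsto_left)
    (by
      have := (hcont (lp t) (right_mem_Icc.2 hlt.le)).tendsto.mono_left
        (nhdsWithin_le_iff.2 (mem_of_superset (Ioo_mem_nhdsLT hlt) Ioo_subset_Icc_self))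
      rw [h.dx_one_right ht.le] at this
      exact this.comp hMC.tendsto_right)
  exact ⟨_, _, _, h1, hD 3 (by norm_num), h2⟩

/-- The rate of change of the energy. -/
noncomputable def energyRate (u : ℝ → ℝ → ℝ) (lm lp : ℝ → ℝ) (t : ℝ) : ℝ :=
  -∫ y in (-1 : ℝ)..1, relSlope u lm lp t y *
    (relSlope u lm lp t y * dx u lm lp 4 t (lagrangian u lm lp t y)
      + dx u lm lp 5 t (lagrangian u lm lp t y))

/-- The profile estimates with `s = a u_xxxx`, which vanishes at both ends because `u_xxxx` does. As
`∫ b² = 2 E`, the constant `1/2048` becomes `1/1024`. -/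
theorem energyRate_le (h : IsGlobalSmoothSolution u lm lp) (hm : mass u lm lp 0 = 2 / 3)
    {t : ℝ} (ht : 0 < t) (hE : energy u lm lp t ≤ 1 / (2 * 10 ^ 8)) :
    energyRate u lm lp t ≤ -(1 / 1024) * energy u lm lp t := by
  obtain ⟨c, d, e, hp, hde, hs⟩ := h.isProfile hm ht
  have hMC := h.isMassCoord hm ht.le
  have hlt := h.lt t ht.le
  have hcont := h.continuousOn_dx_slice 4 ht
  have hB : ∫ y in (-1 : ℝ)..1, relSlope u lm lp t y ^ 2 = 2 * energy u lm lp t := by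
    rw [h.energy_eq hm ht.le]; ring
  have hb0 := h.bddCont_relHeight hm ht.le
  have hb1 := h.bddCont_relSlope hm ht.le
  have hb4 := h.bddCont_dx hm 4 ht
  have hb5 := h.bddCont_dx hm 5 ht
  have h1 := hp.integral_dissip_ge (by rw [hB]; norm_num at hE ⊢; linarith)
  have h2 := hp.integral_mul_deriv_le hde (s := fun y =>
      relHeight (u t) (lagrangian u lm lp t) y * dx u lm lp 4 t (lagrangian u lm lp t y))
    (s' := fun y => relSlope u lm lp t y * dx u lm lp 4 t (lagrangian u lm lp t y)
      + dx u lm lp 5 t (lagrangian u lm lp t y)) hs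
    (fun y hy => by
      refine ((h.hasDerivAt_relHeight hm ht.le hy).mul
        (hMC.hasDerivAt_comp (fun _ hx => h.hasDerivAt_dx 4 ht hx) hy)).congr_deriv ?_
      have := (hMC.relHeight_pos hy).ne'
      field_simp)
    (by fun_prop) (by fun_prop)
    (hb0.tendsto_mul_left (by
      have := (hcont (lm t) (left_mem_Icc.2 hlt.le)).tendsto.mono_left
        (nhdsWithin_le_iff.2 (mem_of_superset (Ioo_mem_nhdsGT hlt) Ioo_subset_Icc_self))
      rw [h.dx_four_left ht] at this
      exact this.comp hMC.tendsto_left))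
    (hb0.tendsto_mul_right (by
      have := (hcont (lp t) (right_mem_Icc.2 hlt.le)).tendsto.mono_left
        (nhdsWithin_le_iff.2 (mem_of_superset (Ioo_mem_nhdsLT hlt) Ioo_subset_Icc_self))
      rw [h.dx_four_right ht] at this
      exact this.comp hMC.tendsto_right))
  rw [hB] at h1
  unfold energyRate
  linarith

/-- Differentiation under the integral, dominated on a time window away from `t = 0`, where the
fourth and fifth derivatives of `u` are bounded. -/
theorem hasDerivAt_energy (h : IsGlobalSmoothSolution u lm lp) (hm : mass u lm lp 0 = 2 / 3)
    {t : ℝ} (ht : 0 < t) : HasDerivAt (energy u lm lp) (energyRate u lm lp t) t := by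
  obtain ⟨α, A, C, -, hb⟩ := h.exists_uniform_bounds hm (2 * t)
  obtain ⟨C₄, hC₄⟩ := h.exists_bound_dx 4 (half_pos ht) (2 * t)
  obtain ⟨C₅, hC₅⟩ := h.exists_bound_dx 5 (half_pos ht) (2 * t)
  have hW : Ioo (t / 2) (2 * t) ∈ 𝓝 t := Ioo_mem_nhds (by linarith) (by linarith)
  have hW0 : ∀ s ∈ Ioo (t / 2) (2 * t), 0 < s := fun s hs => (half_pos ht).trans hs.1
  have hb1 := h.bddCont_relSlope hm ht.le
  have hb4 := h.bddCont_dx hm 4 ht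
  have hb5 := h.bddCont_dx hm 5 ht
  have key := intervalIntegral.hasDerivAt_integral_of_dominated_loc_of_deriv_le (μ := volume)
    (a := -1) (b := 1) (𝕜 := ℝ) (F := fun s y => relSlope u lm lp s y ^ 2)
    (F' := fun s y => 2 * relSlope u lm lp s y *
      -(relSlope u lm lp s y * dx u lm lp 4 s (lagrangian u lm lp s y)
        + dx u lm lp 5 s (lagrangian u lm lp s y)))
    (bound := fun _ => 2 * C * (C * C₄ + C₅)) (x₀ := t) hW
    (by
      filter_upwards [hW] with s hs
      exact ((h.bddCont_relSlope hm (hW0 s hs).le).pow 2).intervalIntegrable.def'.aestronglyMeasurable)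
    (hb1.pow 2).intervalIntegrable
    (BddCont.intervalIntegrable (by fun_prop)).def'.aestronglyMeasurable
    (by
      filter_upwards [ae_mem_Ioo_of_mem_uIoc] with y hy hyI s hs
      have hy := hy hyI
      have hZ := (h.isMassCoord hm (hW0 s hs).le).mem y (Ioo_subset_Icc_self hy)
      have h1 := (hb s ⟨(hW0 s hs).le, hs.2.le⟩ y hy).2.2
      have h4 := hC₄ s ⟨hs.1.le, hs.2.le⟩ _ hZ
      have h5 := hC₅ s ⟨hs.1.le, hs.2.le⟩ _ hZ
      have hC : 0 ≤ C := (abs_nonneg _).trans h1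
      rw [Real.norm_eq_abs, abs_mul, abs_neg, abs_mul, abs_two]
      refine mul_le_mul (by linarith) ((abs_add_le _ _).trans (add_le_add ?_ h5))
        (abs_nonneg _) (by positivity)
      rw [abs_mul]
      exact mul_le_mul h1 h4 (abs_nonneg _) hC)
    (by simp)
    (by
      filter_upwards [ae_mem_Ioo_of_mem_uIoc] with y hy hyI s hs
      refine ((h.hasDerivAt_relSlope_time hm (hW0 s hs) (hy hyI)).pow 2).congr_deriv ?_
      push_cast
      ring)
  have hd := key.2.const_mul (1 / 2)
  refine (hd.congr_of_eventuallyEq ?_).congr_deriv ?_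
  · filter_upwards [Ioi_mem_nhds ht] with s hs using h.energy_eq hm (le_of_lt hs)
  · rw [energyRate, ← intervalIntegral.integral_const_mul, ← intervalIntegral.integral_neg]
    congr 1
    ext y
    ring

theorem continuousWithinAt_relSlope (h : IsGlobalSmoothSolution u lm lp)
    (hm : mass u lm lp 0 = 2 / 3) {y : ℝ} (hy : y ∈ Ioo (-1 : ℝ) 1) :
    ContinuousWithinAt (fun s => relSlope u lm lp s y) (Ici 0) 0 := by
  have hmem : ∀ s, 0 ≤ s → lagrangian u lm lp s y ∈ Icc (lm s) (lp s) := fun s hs =>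
    (h.isMassCoord hm hs).mem y (Ioo_subset_Icc_self hy)
  have hZ := h.continuousWithinAt_lagrangian hm le_rfl hy
  have hg : ∀ k ≤ 2, ContinuousWithinAt
      (fun s => dx u lm lp k s (lagrangian u lm lp s y)) (Ici 0) 0 := fun k hk =>
    ((h.continuousOn_dx_initial hk) (0, lagrangian u lm lp 0 y)
      ⟨self_mem_Ici, hmem 0 le_rfl⟩).comp (f := fun s => (s, lagrangian u lm lp s y))
      (continuousWithinAt_id.prodMk hZ) fun s hs => ⟨hs, hmem s hs⟩
  have h0 := (hg 0 (by norm_num)).div_const (parab y)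
  simp only [dx_zero] at h0
  have hp := h.pos 0 le_rfl _ ((h.isMassCoord hm le_rfl).mem_Ioo hy)
  exact ((((hg 1 (by norm_num)).div h0 (div_pos hp (parab_pos hy)).ne').add
    (h0.const_mul y))).div_const _

/-- Dominated convergence: the slope of the relative height converges pointwise and is bounded
uniformly down to the initial time. This links the decay for `t > 0` to `E(0)`. -/
theorem continuousWithinAt_energy (h : IsGlobalSmoothSolution u lm lp)
    (hm : mass u lm lp 0 = 2 / 3) : ContinuousWithinAt (energy u lm lp) (Ici 0) 0 := by
  obtain ⟨α, A, C, -, hb⟩ := h.exists_uniform_bounds hm 1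
  have key : Tendsto (fun s => ∫ y in (-1 : ℝ)..1, relSlope u lm lp s y ^ 2) (𝓝[≥] 0)
      (𝓝 (∫ y in (-1 : ℝ)..1, relSlope u lm lp 0 y ^ 2)) := by
    refine intervalIntegral.tendsto_integral_filter_of_dominated_convergence (fun _ => C ^ 2)
      ?_ ?_ (by simp) ?_
    · filter_upwards [self_mem_nhdsWithin] with s hs
      exact ((h.bddCont_relSlope hm hs).pow 2).intervalIntegrable.def'.aestronglyMeasurable
    · filter_upwards [Icc_mem_nhdsGE (show (0 : ℝ) < 1 by norm_num)] with s hs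
      filter_upwards [ae_mem_Ioo_of_mem_uIoc] with y hy hyI
      rw [norm_pow]
      exact pow_le_pow_left₀ (norm_nonneg _) (hb s hs y (hy hyI)).2.2 2
    · filter_upwards [ae_mem_Ioo_of_mem_uIoc] with y hy hyI
      exact ((h.continuousWithinAt_relSlope hm (hy hyI)).pow 2)
  have := key.const_mul (1 / 2)
  rw [← h.energy_eq hm le_rfl] at this
  refine this.congr' ?_
  filter_upwards [self_mem_nhdsWithin] with s hs using (h.energy_eq hm hs).symm

end IsGlobalSmoothSolution

/-- A differential inequality which holds below a threshold yields exponential decay below it. -/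
theorem le_mul_exp_of_rate_le {E E' : ℝ → ℝ} {c₀ γ : ℝ} (hγ : 0 ≤ γ)
    (hc : ContinuousOn E (Ici 0)) (hd : ∀ t, 0 < t → HasDerivAt E (E' t) t) (hE : ∀ t, 0 ≤ E t)
    (hr : ∀ t, 0 < t → E t ≤ c₀ → E' t ≤ -γ * E t) (h0 : E 0 < c₀) {t : ℝ} (ht : 0 ≤ t) :
    E t ≤ E 0 * Real.exp (-γ * t) := by
  have decay : ∀ T, 0 ≤ T → (∀ s ∈ Ioo 0 T, E s ≤ c₀) → E T ≤ E 0 * Real.exp (-γ * T) := by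
    intro T hT hs
    have hder : ∀ s ∈ Ioo 0 T, HasDerivAt (fun s => E s * Real.exp (γ * s))
        (E' s * Real.exp (γ * s) + E s * (Real.exp (γ * s) * γ)) s := fun s hs => by
      refine (hd s hs.1).mul ?_
      exact (((hasDerivAt_id s).const_mul γ).exp).congr_deriv (by simp)
    have hanti : AntitoneOn (fun s => E s * Real.exp (γ * s)) (Icc 0 T) := by
      refine antitoneOn_of_deriv_nonpos (convex_Icc 0 T)
        ((hc.mono fun s hs => hs.1).mul (by fun_prop)) ?_ ?_
      · rw [interior_Icc]
        exact fun s hs => (hder s hs).differentiableAt.differentiableWithinAt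
      · rw [interior_Icc]
        intro s hs'
        rw [(hder s hs').deriv]
        nlinarith [hr s hs'.1 (hs s hs'), Real.exp_pos (γ * s)]
    have := hanti (left_mem_Icc.2 hT) (right_mem_Icc.2 hT) hT
    simp only [mul_zero, Real.exp_zero, mul_one] at this
    rw [neg_mul, Real.exp_neg, ← div_eq_mul_inv, le_div_iff₀ (Real.exp_pos _)]
    exact this
  refine decay t ht fun s hs => ?_
  by_contra! hlt
  -- At the first time `τ` at which `E` reaches `c₀`, the decay valid up to `τ` gives `E τ ≤ E 0 <
  -- c₀`, a contradiction.
  have hcl : IsCompact (Icc 0 s ∩ E ⁻¹' Ici c₀) :=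
    isCompact_Icc.of_isClosed_subset
      ((hc.mono fun r hr => hr.1).preimage_isClosed_of_isClosed isClosed_Icc isClosed_Ici)
      inter_subset_left
  obtain ⟨τ, ⟨hτ, hEτ⟩, hmin⟩ := hcl.exists_isLeast ⟨s, ⟨hs.1.le, le_rfl⟩, hlt.le⟩
  have h1 := decay τ hτ.1 fun r hr => by
    by_contra! hr'
    exact absurd (hmin ⟨⟨hr.1.le, hr.2.le.trans hτ.2⟩, hr'.le⟩) (not_le.2 hr.2)
  have h2 : Real.exp (-γ * τ) ≤ 1 := Real.exp_le_one_iff.2 (by nlinarith [hτ.1])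
  have h3 : c₀ ≤ E τ := hEτ
  nlinarith [hE 0]

end ThinFilm

theorem theorem1p1 :
    ∃ c₀ : ℝ, 0 < c₀ ∧ ∃ γ : ℝ, 0 < γ ∧
      ∀ (u : ℝ → ℝ → ℝ) (lm lp : ℝ → ℝ),
        ThinFilm.IsGlobalSmoothSolution u lm lp →
        ThinFilm.mass u lm lp 0 = 2 / 3 →
        ThinFilm.centerOfMass u lm lp 0 = 0 →
        ThinFilm.energy u lm lp 0 < c₀ →
        ∀ t : ℝ, 0 ≤ t →
          ThinFilm.energy u lm lp t ≤ ThinFilm.energy u lm lp 0 * Real.exp (-γ * t) := by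
  -- The threshold is the smallness condition `∫ b² ≤ 10⁻⁸` of the dissipation estimate, read
  -- through `∫ b² = 2 E`.
  refine ⟨1 / (2 * 10 ^ 8), by norm_num, 1 / 1024, by norm_num, ?_⟩
  intro u lm lp h hm _ h0 t ht
  refine ThinFilm.le_mul_exp_of_rate_le (by norm_num) (fun s hs => ?_)
    (fun s hs => h.hasDerivAt_energy hm hs) (fun s => ?_)
    (fun s hs hle => h.energyRate_le hm hs hle) h0 ht
  · rcases (show (0 : ℝ) ≤ s from hs).eq_or_lt with rfl | hs
    · exact h.continuousWithinAt_energy hm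
    · exact (h.hasDerivAt_energy hm hs).continuousAt.continuousWithinAt
  · refine mul_nonneg (by norm_num) (intervalIntegral.integral_nonneg (by norm_num) fun y _ => ?_)
    positivity
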